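/- Let $m\ge 2$, $n_1,\dots,n_m\ge 1$, and let $\Omega_i\subset\mathbb{R}^{n_i}$ be non-empty bounded open sets. For real $s>0$ let $H^{s}(\mathbb{R}^{n})$ be the space of real-valued $U\in L^2(\mathbb{R}^n)$ with $\|U\|_{H^s(\mathbb{R}^n)}^2=\int(1+|\xi|^2)^{s}|\widehat U(\xi)|^2\,d\xi<\infty$ (with $\widehat U(\xi)=\int U(x)e^{-2\pi i x\cdot\xi}\,dx$ extended to $L^2$), and for open $\Omega\subset\mathbb{R}^n$ let $H^{s}(\Omega)$ be the space of restrictions $U|_{\Omega}$ of $U\in H^s(\mathbb{R}^n)$, with the quotient norm $\|u\|_{H^s(\Omega)}=\inf\{\|U\|_{H^s(\mathbb{R}^n)}: U|_\Omega=u\}$ (for bounded smooth domains this is the usual Sobolev space, with an equivalent norm). Let $\boldsymbol\Omega=\Omega_1\times\cdots\times\Omega_m$, $\boldsymbol s=(s_1,\dots,s_m)$ with all $s_i>0$, and let $\mathbf H^{\boldsymbol s}(\boldsymbol\Omega)=H^{s_1}(\Omega_1)\otimes\cdots\otimes H^{s_m}(\Omega_m)\subset L^2(\boldsymbol\Omega)$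 be the Hilbert tensor product. For integers $r_1,\dots,r_{m-1}\ge1$ and $r_0=1$, the truncated tensor train decomposition of $f\in L^2(\boldsymbol\Omega)$ is obtained as follows. Put $\boldsymbol g_0=f$. In step $j=1,\dots,m-1$ take a singular value decomposition $$\boldsymbol g_{j-1}(\boldsymbol x_j,\dots,\boldsymbol x_m)=\Big[\sum_{\alpha_j=1}^{\infty}\sqrt{\lambda_j(\alpha_j)}\,\varphi_j(\alpha_{j-1},\boldsymbol x_j,\alpha_j)\,\psi_j(\alpha_j,\boldsymbol x_{j+1},\dots,\boldsymbol x_m)\Big]_{\alpha_{j-1}=1}^{r_{j-1}}$$ with non-increasing $\lambda_j(\alpha_j)\ge0$, orthonormal $[\varphi_j(\cdot,\cdot,\alpha_j)]$, $\alpha_j\in\mathbb N$, in $[L^2(\Omega_j)]^{r_{j-1}}$ and orthonormal $\psi_j(\alpha_j,\cdot)$ in $L^2(\Omega_{j+1}\times\cdots\times\Omega_m)$, and set $\boldsymbol g_j=[\sqrt{\lambda_j(\alpha_j)}\,\psi_j(\alpha_j,\cdot)]_{\alpha_j=1}^{r_j}$. With $\varphi_m(\alpha,\boldsymbol x_m)=\sqrt{\lambda_{m-1}(\alpha)}\,\psi_{m-1}(\alpha,\boldsymbol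 x_m)$ put $$f^{\mathrm{TT}}_{r_1,\dots,r_{m-1}}(\boldsymbol x)=\sum_{\alpha_1=1}^{r_1}\cdots\sum_{\alpha_{m-1}=1}^{r_{m-1}}\varphi_1(\boldsymbol x_1,\alpha_1)\,\varphi_2(\alpha_1,\boldsymbol x_2,\alpha_2)\cdots\varphi_{m-1}(\alpha_{m-2},\boldsymbol x_{m-1},\alpha_{m-1})\,\varphi_m(\alpha_{m-1},\boldsymbol x_m),$$ where the single index $\alpha_0=1$ is omitted. Set $\beta_1=\frac{s_1}{n_1}+\min_{2\le i\le m}\frac{s_i}{n_i}$ and $\beta_j=\min_{j<i\le m}\frac{s_i}{n_i}$ for $2\le j\le m-1$. Then there are constants $C$ and $p$, depending only on $m$, the $n_i$, the $s_i$ and the $\Omega_i$, such that for all $f\in\mathbf H^{\boldsymbol s}(\boldsymbol\Omega)$, all $0<\varepsilon<1$ and all truncation ranks $r_j=\varepsilon^{-1/\beta_j}$, rounded up or down to an integer, $j=1,\dots,m-1$, the truncated tensor train decomposition exists, and for every choice of the singular value decompositions $$\|f-f^{\mathrm{TT}}_{r_1,\dots,r_{m-1}}\|_{L^2(\boldsymbol\Omega)}\le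 C\,\sqrt m\,\varepsilon\,(1+|\log\varepsilon|)^{p}\,\|f\|_{\mathbf H^{\boldsymbol s}(\boldsymbol\Omega)} .$$ Moreover, the storage cost $r_1+\sum_{j=2}^{m-1}r_{j-1}r_j$ equals $$\varepsilon^{-1/\beta_1}+\varepsilon^{-1/\beta_1-1/\beta_2}+\cdots+\varepsilon^{-1/\beta_{m-2}-1/\beta_{m-1}}$$ up to a factor in $[\tfrac14,4]$ that is due to the rounding of the ranks, and it is at most $4\,m\,\varepsilon^{-2/\min_{1\le j\le m-1}\beta_j}$. -/

import Mathlib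

open MeasureTheory Filter Topology
open scoped ENNReal FourierTransform

noncomputable section

namespace TTApprox

/-- The Euclidean space `ℝⁿ`. -/
abbrev E (n : ℕ) : Type := EuclideanSpace ℝ (Fin n)

/-! ### Sobolev spaces of real order on a domain -/

/-- The norm of `H^s(ℝⁿ)`, `(∫ (1 + |ξ|²)^s |Û(ξ)|² dξ)^{1/2}`, of a real valued `U ∈ L²(ℝⁿ)`
(the value is `∞` if `U ∉ H^s(ℝⁿ)`). The Fourier transform is the one on `L²`. -/
def sobolevENormRn {n : ℕ} (s : ℝ) (U : Lp ℝ 2 (volume : Measure (E n))) : ℝ≥0∞ :=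
  (∫⁻ ξ : E n, ENNReal.ofReal ((1 + ‖ξ‖ ^ 2) ^ s) *
    ‖(𝓕 (Complex.ofRealCLM.compLp U) : Lp ℂ 2 (volume : Measure (E n))) ξ‖ₑ ^ 2)
      ^ (1 / 2 : ℝ)

/-- The norm of `H^s(Ω)`, the space of restrictions to `Ω` of the elements of `H^s(ℝⁿ)`: the
infimum of the norms of all extensions of `u` (the value is `∞` if `u ∉ H^s(Ω)`). -/
def sobolevENorm {n : ℕ} (s : ℝ) (Ω : Set (E n)) (u : E n → ℝ) : ℝ≥0∞ :=
  ⨅ (U : Lp ℝ 2 (volume : Measure (E n))) (_ : U =ᵐ[volume.restrict Ω] u), sobolevENormRn s U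

/-- `u ∈ H^s(Ω)`. -/
def MemH {n : ℕ} (s : ℝ) (Ω : Set (E n)) (u : E n → ℝ) : Prop :=
  sobolevENorm s Ω u < ∞

/-- The scalar product of the Hilbert space `H^s(Ω)`, obtained from its norm by polarization. -/
def sobolevInner {n : ℕ} (s : ℝ) (Ω : Set (E n)) (u v : E n → ℝ) : ℝ :=
  ((sobolevENorm s Ω (u + v)).toReal ^ 2 - (sobolevENorm s Ω (u - v)).toReal ^ 2) / 4

/-! ### The Hilbert tensor product of Sobolev spaces -/

section Tensor

variable {m : ℕ} (n : Fin m → ℕ)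

/-- A formal finite sum `∑ₖ u_{k,1} ⊗ ⋯ ⊗ u_{k,m}` of elementary tensors. -/
structure TensorSum where
  /-- the number of summands -/
  size : ℕ
  /-- the factors of the summands -/
  term : Fin size → (i : Fin m) → E (n i) → ℝ

variable {n}

/-- The function `∑ₖ u_{k,1}(x₁) ⋯ u_{k,m}(x_m)`. -/
def TensorSum.toFun (A : TensorSum n) (x : (i : Fin m) → E (n i)) : ℝ :=
  ∑ k, ∏ i, A.term k i (x i)

/-- The scalar product of `H^{s₁}(Ω₁) ⊗ ⋯ ⊗ H^{s_m}(Ω_m)` on finite sums of elementary tensors: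
the bilinear extension of `⟨⊗ᵢ uᵢ, ⊗ᵢ vᵢ⟩ = ∏ᵢ ⟨uᵢ, vᵢ⟩`. -/
def TensorSum.inner (Ω : (i : Fin m) → Set (E (n i))) (s : Fin m → ℝ) (A B : TensorSum n) : ℝ :=
  ∑ k, ∑ l, ∏ i, sobolevInner (s i) (Ω i) (A.term k i) (B.term l i)

/-- The Lebesgue measure on `Ω₁ × ⋯ × Ω_m`. -/
def prodMeasure (Ω : (i : Fin m) → Set (E (n i))) : Measure ((i : Fin m) → E (n i)) :=
  Measure.pi fun i => volume.restrict (Ω i)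

/-- `f` belongs to the Hilbert tensor product `H^{s₁}(Ω₁) ⊗ ⋯ ⊗ H^{s_m}(Ω_m)`, the completion of
the algebraic tensor product regarded as a subspace of `L²(Ω₁ × ⋯ × Ω_m)`, and has norm `M`
there: `f` is the `L²` limit of algebraic tensors that form a Cauchy sequence for the tensor
norm, and their tensor norms tend to `M`. -/
def HasMixedSobolevNorm (Ω : (i : Fin m) → Set (E (n i))) (s : Fin m → ℝ)
    (f : ((i : Fin m) → E (n i)) → ℝ) (M : ℝ) : Prop :=
  MemLp f 2 (prodMeasure Ω) ∧
  ∃ A : ℕ → TensorSum n,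
    (∀ ν k i, MemH (s i) (Ω i) ((A ν).term k i)) ∧
    (∀ δ > 0, ∃ N, ∀ ν ≥ N, ∀ ν' ≥ N,
      (A ν).inner Ω s (A ν) - 2 * (A ν).inner Ω s (A ν') + (A ν').inner Ω s (A ν') < δ) ∧
    Tendsto (fun ν => eLpNorm (f - (A ν).toFun) 2 (prodMeasure Ω)) atTop (𝓝 0) ∧
    Tendsto (fun ν => √((A ν).inner Ω s (A ν))) atTop (𝓝 M)

end Tensor

/-! ### Singular value decompositions and the tensor train decomposition -/

/-- A singular value decomposition of a vector valued function `g = [g(α')]_{α' < p}` on `Y` that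
separates `(α', a)` from `b`, where `y ∈ Y` has the two components `a = fst y` and `b = snd y`:
`g(α', y) = ∑_α σ(α) φ(α', fst y, α) ψ(α, snd y)`, convergent in `L²`, with nonincreasing
singular values `σ(α) = √λ(α) ≥ 0`, an orthonormal sequence `[φ(α', ·, α)]_{α' < p}` in `[L²(A)]^p`
and an orthonormal sequence `ψ(α, ·)` in `L²(B)`. -/
structure IsSVD {Y A B : Type*} [MeasurableSpace Y] [MeasurableSpace A] [MeasurableSpace B]
    (μY : Measure Y) (μA : Measure A) (μB : Measure B) (fst : Y → A) (snd : Y → B)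
    (p : ℕ) (g : ℕ → Y → ℝ) (σ : ℕ → ℝ) (φ : ℕ → A → ℕ → ℝ) (ψ : ℕ → B → ℝ) : Prop where
  nonneg : ∀ α, 0 ≤ σ α
  antitone : Antitone σ
  memLp_left : ∀ α' < p, ∀ α, MemLp (fun x => φ α' x α) 2 μA
  memLp_right : ∀ α, MemLp (ψ α) 2 μB
  orthonormal_left : ∀ α β,
    ∑ α' ∈ Finset.range p, ∫ x, φ α' x α * φ α' x β ∂μA = if α = β then 1 else 0
  orthonormal_right : ∀ α β, ∫ y, ψ α y * ψ β y ∂μB = if α = β then 1 else 0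
  tendsto : ∀ α' < p, Tendsto (fun N => eLpNorm
    (fun y => g α' y - ∑ α ∈ Finset.range N, σ α * φ α' (fst y) α * ψ α (snd y)) 2 μY)
      atTop (𝓝 0)

section TT

variable {k : ℕ} (n : Fin (k + 2) → ℕ)

/-- The variables `(x_j, x_{j+1}, …)`. -/
abbrev Tail (j : Fin (k + 2)) : Type := (i : {i : Fin (k + 2) // j ≤ i}) → E (n i)

variable {n}

/-- The Lebesgue measure on `Ω_j × Ω_{j+1} × ⋯`. -/
def tailMeasure (Ω : (i : Fin (k + 2)) → Set (E (n i))) (j : Fin (k + 2)) :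
    Measure (Tail n j) :=
  Measure.pi fun i => volume.restrict (Ω i)

/-- The variable `x_j` of `(x_j, x_{j+1}, …)`. -/
def Tail.head (j : Fin (k + 1)) (y : Tail n j.castSucc) : E (n j.castSucc) :=
  y ⟨j.castSucc, le_rfl⟩

/-- The variables `(x_{j+1}, …)` of `(x_j, x_{j+1}, …)`. -/
def Tail.rest (j : Fin (k + 1)) (y : Tail n j.castSucc) : Tail n j.succ :=
  fun i => y ⟨i.1, j.castSucc_lt_succ.le.trans i.2⟩

/-- The ranks `(r₁, …, r_{m-1})` with `r₀ = 1` put in front. -/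
def extRank (r : Fin (k + 1) → ℕ) : Fin (k + 2) → ℕ := Fin.cons 1 r

/-- The tensor train decomposition of `f`, a function of `m = k + 2` variables, by successive
singular value decompositions, the `j`-th of which is truncated after `r_j` terms,
`j = 1, …, m - 1`. Indices start from `0`; the singular value decompositions are not unique, and
every possible sequence of them is admitted. -/
structure TTDecomposition (Ω : (i : Fin (k + 2)) → Set (E (n i)))
    (f : ((i : Fin (k + 2)) → E (n i)) → ℝ) (r : Fin (k + 1) → ℕ) where
  /-- the vector valued functions that are decomposed -/
  g : (j : Fin (k + 2)) → ℕ → Tail n j → ℝ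
  /-- the singular values -/
  σ : Fin (k + 1) → ℕ → ℝ
  /-- the left singular functions -/
  φ : (j : Fin (k + 1)) → ℕ → E (n j.castSucc) → ℕ → ℝ
  /-- the right singular functions -/
  ψ : (j : Fin (k + 1)) → ℕ → Tail n j.succ → ℝ
  /-- the first function is `f` -/
  g_zero : ∀ α y, g 0 α y = f fun i => y ⟨i, Fin.zero_le i⟩
  /-- the next function consists of the right singular functions times the singular values -/
  g_succ : ∀ j α y, g j.succ α y = σ j α * ψ j α y
  /-- in each step, `(α_{j-1}, x_j)` is separated from `(x_{j+1}, …, x_m)`; only the first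
  `r_{j-1}` components of the function are used -/
  isSVD : ∀ j : Fin (k + 1), IsSVD (tailMeasure Ω j.castSucc) (volume.restrict (Ω j.castSucc))
    (tailMeasure Ω j.succ) (Tail.head j) (Tail.rest j) (extRank r j.castSucc)
    (g j.castSucc) (σ j) (φ j) (ψ j)

/-- The truncated tensor train
`f^TT(x) = ∑_{α₁ ≤ r₁} ⋯ ∑_{α_{m-1} ≤ r_{m-1}} φ₁(x₁, α₁) φ₂(α₁, x₂, α₂) ⋯ φ_m(α_{m-1}, x_m)`,
where `φ_m(α, x_m) = √λ_{m-1}(α) ψ_{m-1}(α, x_m)`. -/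
def TTDecomposition.approx {Ω : (i : Fin (k + 2)) → Set (E (n i))}
    {f : ((i : Fin (k + 2)) → E (n i)) → ℝ} {r : Fin (k + 1) → ℕ} (T : TTDecomposition Ω f r)
    (x : (i : Fin (k + 2)) → E (n i)) : ℝ :=
  ∑ α ∈ Fintype.piFinset fun j => Finset.range (extRank r j),
    (∏ j : Fin (k + 1), T.φ j (α j.castSucc) (x j.castSucc) (α j.succ)) *
      T.g (Fin.last (k + 1)) (α (Fin.last (k + 1))) fun i => x i

/-- The storage cost `r₁ + ∑_{j=2}^{m-1} r_{j-1} r_j`. -/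
def storageCost (r : Fin (k + 1) → ℕ) : ℕ :=
  r 0 + ∑ j : Fin k, r j.castSucc * r j.succ

/-- The rates `β₁ = s₁/n₁ + min_{i>1} s_i/n_i` and `β_j = min_{i>j} s_i/n_i` for `j > 1`. -/
def rate (n : Fin (k + 2) → ℕ) (s : Fin (k + 2) → ℝ) (j : Fin (k + 1)) : ℝ :=
  (if j = 0 then s 0 / n 0 else 0) + ⨅ i : {i : Fin (k + 2) // j.castSucc < i}, s i / n i

/-- The ranks are `r_j = ε^{-1/β_j}`, rounded up or down to an integer. -/
def IsRankChoice (n : Fin (k + 2) → ℕ) (s : Fin (k + 2) → ℝ) (ε : ℝ)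
    (r : Fin (k + 1) → ℕ) : Prop :=
  ∀ j, ⌊ε ^ (-1 / rate n s j)⌋₊ ≤ r j ∧ r j ≤ ⌈ε ^ (-1 / rate n s j)⌉₊

end TT

end TTApprox

end

/-! The error of the tensor train is controlled one truncation at a time. The left singular
functions of each step are orthonormal, so tensoring with them preserves norms and the errors of
later steps are not magnified; by the triangle inequality the total error is at most the sum of the
m - 1 step errors (`TTDecomposition.norm_vec_sub_reconstr_le`).

The error in step J is an error of best approximation, by the Eckart-Young theorem
(`SVD.norm_sub_truncation_le`). The function decomposed in that step arises from f by contractions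
with orthonormal systems, which do not increase norms by Bessel's inequality. Applying the same
contractions to an approximant h of f bounds the step error by ‖f - h‖ as soon as the contractions
of h in the variables up to x_J stay in a space of dimension at most r_J
(`TTDecomposition.stepError_le`).

Suitable h come from a multilevel expansion. Cutting off frequencies and expanding the exponential
into a Taylor series gives, on each Ω_i, polynomial spaces of dimension less than 2^l that
approximate H^{s_i}(Ω_i) in L² with error O(2^{-a_i l}), a_i = s_i/n_i. Tensor products of
differences of the projections split f into parts indexed by level vectors l, of norm O(2^{-∑ a_i
l_i}) ‖f‖; this tensor bound is the Schur product theorem for Gram matrices. Keeping the parts with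
∑_{i>J} l_i ≤ L costs a dimension of order L^m 2^L and an error of order 2^{-L min_{i>J} a_i}, up to
powers of L. In the first step the parts with l_1 ≤ L can be kept as well, since their first factor
lies in a space of dimension less than 2^L. Every discarded part then has both l_1 > L and ∑_{i>1}
l_i > L, whence the additional s_1/n_1 in β_1 (`exists_stepError_le`). The largest L that fits into
r_J makes the error ε up to a power of the logarithm (`exists_level_error_le`).

The decomposition exists because operators with square integrable kernels are compact; the infinite
dimension of the L² spaces provides full orthonormal sequences even when singular values vanish. -/

noncomputable section

namespace TTApprox

open scoped RealInnerProductSpace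

/-! ### Compact operators attain their norm -/

section Compact

variable {A B : Type*} [NormedAddCommGroup A] [InnerProductSpace ℝ A]
  [NormedAddCommGroup B] [InnerProductSpace ℝ B]

/-- The self-adjoint operator S = T*T has spectral radius ‖S‖ = ‖T‖², attained at some μ in the
spectrum. As S is compact, μ ≠ 0 is an eigenvalue, and a unit eigenvector x satisfies ‖T x‖² = μ =
‖T‖². -/
theorem exists_norm_apply_eq_opNorm [CompleteSpace A] [CompleteSpace B] [Nontrivial A]
    (T : A →L[ℝ] B) (hT : IsCompactOperator T) :
    ∃ x, ‖x‖ = 1 ∧ ‖T x‖ = ‖T‖ := by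
  by_cases h0 : T = 0
  · obtain ⟨x, hx⟩ := exists_norm_eq A zero_le_one
    exact ⟨x, hx, by simp [h0]⟩
  set S : A →L[ℝ] A := (ContinuousLinearMap.adjoint T).comp T with hS
  have hSn : ‖S‖ = ‖T‖ * ‖T‖ := ContinuousLinearMap.norm_adjoint_comp_self T
  have hS0 : S ≠ 0 := by
    rw [← norm_ne_zero_iff, hSn]
    exact mul_ne_zero (norm_ne_zero_iff.2 h0) (norm_ne_zero_iff.2 h0)
  have hSc : IsCompactOperator S := hT.clm_comp (ContinuousLinearMap.adjoint T)
  have hsa : IsSelfAdjoint S := by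
    rw [ContinuousLinearMap.isSelfAdjoint_iff_isSymmetric]
    intro x y
    simp [hS, ContinuousLinearMap.adjoint_inner_left, ContinuousLinearMap.adjoint_inner_right]
  have hr := S.spectralRadius_eq_nnnorm hsa
  -- Over ℝ a spectrum may be empty; here that would make the spectral radius, hence ‖S‖, equal to
  -- 0.
  have hne : (spectrum ℝ S).Nonempty := by
    by_contra hcon
    rw [Set.not_nonempty_iff_eq_empty] at hcon
    rw [spectralRadius, hcon] at hr
    simp only [Set.mem_empty_iff_false, iSup_false, iSup_const, bot_eq_zero'] at hr
    exact hS0 (nnnorm_eq_zero.1 (by exact_mod_cast hr.symm))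
  obtain ⟨μ, hμ, hμn⟩ := spectrum.exists_nnnorm_eq_spectralRadius_of_nonempty hne
  rw [hr] at hμn
  have hμn' : ‖μ‖ = ‖S‖ := by
    have : ‖μ‖₊ = ‖S‖₊ := by exact_mod_cast hμn
    exact congrArg NNReal.toReal this
  have hμ0 : μ ≠ 0 := by
    rw [← norm_ne_zero_iff, hμn']
    exact norm_ne_zero_iff.2 hS0
  obtain ⟨x, hx⟩ := ((hSc.hasEigenvalue_iff_mem_spectrum hμ0).2 hμ).exists_hasEigenvector
  have hx0 : x ≠ 0 := hx.2
  have hSx : S x = μ • x := hx.apply_eq_smul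
  have hTx : ‖T x‖ ^ 2 = μ * ‖x‖ ^ 2 := by
    rw [← real_inner_self_eq_norm_sq, ← ContinuousLinearMap.adjoint_inner_right,
      show (ContinuousLinearMap.adjoint T) (T x) = S x from rfl, hSx, real_inner_smul_right,
      real_inner_self_eq_norm_sq]
  have hxp : 0 < ‖x‖ := norm_pos_iff.2 hx0
  have hμp : 0 ≤ μ := by
    by_contra hneg
    push Not at hneg
    nlinarith [sq_nonneg ‖T x‖, mul_pos (neg_pos.2 hneg) (pow_pos hxp 2)]
  rw [Real.norm_of_nonneg hμp, hSn] at hμn'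
  have hTx' : ‖T x‖ = ‖T‖ * ‖x‖ := by
    rw [hμn', show ‖T‖ * ‖T‖ * ‖x‖ ^ 2 = (‖T‖ * ‖x‖) ^ 2 by ring] at hTx
    exact (sq_eq_sq₀ (norm_nonneg _) (by positivity)).1 hTx
  refine ⟨‖x‖⁻¹ • x, ?_, ?_⟩
  · rw [norm_smul, norm_inv, norm_norm, inv_mul_cancel₀ hxp.ne']
  · rw [map_smul, norm_smul, norm_inv, norm_norm, hTx']
    field_simp

theorem exists_unit_mem_orthogonal (hA : ¬ FiniteDimensional ℝ A) (F : Submodule ℝ A)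
    [FiniteDimensional ℝ F] : ∃ x ∈ Fᗮ, ‖x‖ = 1 := by
  have hne : Fᗮ ≠ ⊥ := by
    intro h
    rw [Submodule.orthogonal_eq_bot_iff] at h
    subst h
    exact hA (Submodule.topEquiv (R := ℝ) (M := A)).finiteDimensional
  have : Nontrivial Fᗮ := Submodule.nontrivial_iff_ne_bot.2 hne
  obtain ⟨x, hx⟩ := exists_norm_eq Fᗮ zero_le_one
  exact ⟨x, x.2, hx⟩

theorem exists_maximizer_mem_orthogonal [CompleteSpace A] [CompleteSpace B]
    (hA : ¬ FiniteDimensional ℝ A) (T : A →L[ℝ] B)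
    (hT : IsCompactOperator T) (F : Submodule ℝ A) [FiniteDimensional ℝ F] :
    ∃ x ∈ Fᗮ, ‖x‖ = 1 ∧ ∀ y ∈ Fᗮ, ‖T y‖ ≤ ‖T x‖ * ‖y‖ := by
  obtain ⟨x₀, hx₀, hx₀'⟩ := exists_unit_mem_orthogonal hA F
  have : Nontrivial Fᗮ := ⟨⟨⟨x₀, hx₀⟩, 0, fun h => by
    have : x₀ = 0 := congrArg Subtype.val h
    simp [this] at hx₀'⟩⟩
  obtain ⟨x, hx, hTx⟩ := exists_norm_apply_eq_opNorm (T.comp Fᗮ.subtypeL)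
    (hT.comp_clm Fᗮ.subtypeL)
  refine ⟨x, x.2, hx, fun y hy => ?_⟩
  have := (T.comp Fᗮ.subtypeL).le_opNorm ⟨y, hy⟩
  rw [← hTx] at this
  exact this

/-- At a maximizer of `‖T ·‖` the images of orthogonal vectors are orthogonal. -/
theorem inner_apply_eq_zero_of_maximizer (T : A →L[ℝ] B) (F : Submodule ℝ A) {x y : A}
    (hx : x ∈ F) (hx1 : ‖x‖ = 1) (hmax : ∀ z ∈ F, ‖T z‖ ≤ ‖T x‖ * ‖z‖) (hy : y ∈ F)
    (hxy : ⟪x, y⟫ = 0) : ⟪T x, T y⟫ = 0 := by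
  -- First variation at the maximizer x in the direction y: the linear term in t is dominated by a
  -- quadratic one for every t, so it vanishes.
  have key : ∀ t : ℝ, 2 * t * ⟪T x, T y⟫ ≤ t ^ 2 * (‖T x‖ ^ 2 * ‖y‖ ^ 2) := by
    intro t
    have h := hmax (x + t • y) (F.add_mem hx (F.smul_mem t hy))
    have h2 : ‖T (x + t • y)‖ ^ 2 ≤ ‖T x‖ ^ 2 * ‖x + t • y‖ ^ 2 := by
      rw [← mul_pow]
      exact pow_le_pow_left₀ (norm_nonneg _) h 2
    rw [map_add, map_smul, norm_add_sq_real, norm_add_sq_real, real_inner_smul_right,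
      real_inner_smul_right, hxy, hx1, norm_smul, norm_smul, mul_pow, mul_pow, Real.norm_eq_abs,
      sq_abs] at h2
    nlinarith [mul_nonneg (sq_nonneg t) (sq_nonneg ‖T y‖)]
  set c := ⟪T x, T y⟫
  set D := ‖T x‖ ^ 2 * ‖y‖ ^ 2
  have hD : 0 ≤ D := by positivity
  -- With this t the inequality becomes c² (D + 2) ≤ 0; the 1 in the denominator avoids a case
  -- distinction for D = 0.
  have h1 := key (c / (D + 1))
  have h2 : 0 < D + 1 := by linarith
  rw [div_pow, div_mul_eq_mul_div, mul_div_assoc', div_mul_eq_mul_div,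
    div_le_div_iff₀ h2 (by positivity)] at h1
  have h3 : c ^ 2 * (D + 1) * (D + 2) ≤ 0 := by nlinarith
  have h4 : c ^ 2 ≤ 0 := by
    by_contra hcon
    push Not at hcon
    have : 0 < c ^ 2 * (D + 1) * (D + 2) := by positivity
    linarith
  exact pow_eq_zero_iff two_ne_zero |>.1 (le_antisymm h4 (sq_nonneg c))

end Compact

/-! ### Hilbert tensor products and singular value decompositions -/

/-- `C` is a Hilbert tensor product of `A` and `B`. -/
structure HilbertTensor (A B C : Type*) [NormedAddCommGroup A] [InnerProductSpace ℝ A]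
    [NormedAddCommGroup B] [InnerProductSpace ℝ B]
    [NormedAddCommGroup C] [InnerProductSpace ℝ C] where
  /-- the elementary tensors -/
  tmul : A →ₗ[ℝ] B →ₗ[ℝ] C
  inner_tmul : ∀ a b a' b', ⟪tmul a b, tmul a' b'⟫ = ⟪a, a'⟫ * ⟪b, b'⟫
  total : ∀ c, (∀ a b, ⟪tmul a b, c⟫ = 0) → c = 0

namespace HilbertTensor

variable {A B C : Type*} [NormedAddCommGroup A] [InnerProductSpace ℝ A]
    [NormedAddCommGroup B] [InnerProductSpace ℝ B]
    [NormedAddCommGroup C] [InnerProductSpace ℝ C]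
    (H : HilbertTensor A B C)

theorem norm_tmul (a : A) (b : B) : ‖H.tmul a b‖ = ‖a‖ * ‖b‖ := by
  have h : ‖H.tmul a b‖ ^ 2 = (‖a‖ * ‖b‖) ^ 2 := by
    rw [← real_inner_self_eq_norm_sq, H.inner_tmul, real_inner_self_eq_norm_sq,
      real_inner_self_eq_norm_sq, mul_pow]
  exact (sq_eq_sq₀ (norm_nonneg _) (by positivity)).1 h

/-- The elementary tensors as a continuous bilinear map. -/
def tmulL : A →L[ℝ] B →L[ℝ] C :=
  H.tmul.mkContinuous₂ 1 fun a b => by rw [H.norm_tmul, one_mul]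

@[simp] theorem tmulL_apply (a : A) (b : B) : H.tmulL a b = H.tmul a b := rfl

theorem norm_sum_tmul_sq {ι : Type*} (S : Finset ι) {φ : ι → A} (hφ : Orthonormal ℝ φ)
    (b : ι → B) : ‖∑ i ∈ S, H.tmul (φ i) (b i)‖ ^ 2 = ∑ i ∈ S, ‖b i‖ ^ 2 := by
  classical
  rw [← real_inner_self_eq_norm_sq, sum_inner]
  refine Finset.sum_congr rfl fun i hi => ?_
  rw [inner_sum, Finset.sum_eq_single i]
  · rw [H.inner_tmul, real_inner_self_eq_norm_sq, hφ.1 i, real_inner_self_eq_norm_sq]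
    simp
  · intro j _ hj
    rw [H.inner_tmul, hφ.2 (Ne.symm hj), zero_mul]
  · exact fun h => absurd hi h

/-- The Hilbert tensor product of vectors of elements of `A` with `B`. -/
def pi (p : ℕ) : HilbertTensor (PiLp 2 fun _ : Fin p => A) B (PiLp 2 fun _ : Fin p => C) where
  tmul := LinearMap.mk₂ ℝ (fun a b => WithLp.toLp 2 fun i => H.tmul (a i) b)
    (fun a a' b => by ext i; simp) (fun c a b => by ext i; simp) (fun a b b' => by ext i; simp)
    (fun c a b => by ext i; simp)
  inner_tmul a b a' b' := by
    simp only [LinearMap.mk₂_apply, PiLp.inner_apply, H.inner_tmul, Finset.sum_mul]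
  total c hc := by
    classical
    ext i
    refine H.total _ fun a b => ?_
    have := hc (PiLp.single 2 i a) b
    simp only [LinearMap.mk₂_apply, PiLp.inner_apply] at this
    rw [Finset.sum_eq_single i] at this
    · simpa using this
    · intro j _ hj
      simp [hj]
    · simp

@[simp] theorem pi_tmul_apply (p : ℕ) (a : PiLp 2 fun _ : Fin p => A) (b : B) (i : Fin p) :
    (H.pi p).tmul a b i = H.tmul (a i) b := rfl

variable [CompleteSpace B] [CompleteSpace C]

/-- The Hilbert-Schmidt operator with kernel `g`, as a continuous linear map of `g`. -/
def op : C →L[ℝ] A →L[ℝ] B :=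
  (LinearMap.mk₂ ℝ (fun g a => ContinuousLinearMap.adjoint (H.tmulL a) g)
    (fun _ _ _ => map_add _ _ _) (fun _ _ _ => map_smul _ _ _)
    (fun g a a' => by rw [map_add, map_add, _root_.add_apply])
    (fun c g a => by
      rw [map_smul, map_smulₛₗ, _root_.smul_apply, conj_trivial])).mkContinuous₂ 1
    fun g a => by
      rw [LinearMap.mk₂_apply, one_mul, mul_comm]
      refine (ContinuousLinearMap.le_opNorm _ _).trans ?_
      rw [LinearIsometryEquiv.norm_map]
      gcongr
      exact ContinuousLinearMap.opNorm_le_bound _ (norm_nonneg _) fun b => (H.norm_tmul a b).le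

theorem op_apply (g : C) (a : A) : H.op g a = ContinuousLinearMap.adjoint (H.tmulL a) g := rfl

theorem inner_op (g : C) (a : A) (b : B) : ⟪b, H.op g a⟫ = ⟪H.tmul a b, g⟫ := by
  rw [op_apply, ContinuousLinearMap.adjoint_inner_right, tmulL_apply]

theorem op_tmul (a a' : A) (b : B) : H.op (H.tmul a b) a' = ⟪a, a'⟫ • b := by
  refine ext_inner_left ℝ fun v => ?_
  rw [inner_op, H.inner_tmul, real_inner_smul_right, real_inner_comm a a']

theorem op_injective {g : C} (h : ∀ a, H.op g a = 0) : g = 0 :=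
  H.total g fun a b => by rw [← H.inner_op, h, inner_zero_right]

/-- Elementary tensors give operators of rank one and span a dense subspace; compact operators are
closed in operator norm, and the kernel determines the operator continuously. -/
theorem isCompactOperator_op (g : C) : IsCompactOperator (H.op g) := by
  let K : Submodule ℝ C := Submodule.span ℝ {c | ∃ a b, c = H.tmul a b}
  have hK : K.topologicalClosure = ⊤ := by
    rw [Submodule.topologicalClosure_eq_top_iff, Submodule.eq_bot_iff]
    intro c hc
    exact H.total c fun a b => hc _ (Submodule.subset_span ⟨a, b, rfl⟩)
  let L : Submodule ℝ C := (compactOperator (RingHom.id ℝ) A B).comap (H.op : C →ₗ[ℝ] A →L[ℝ] B)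
  have hL : IsClosed (L : Set C) :=
    (isClosed_setOfPred_isCompactOperator (σ₁₂ := RingHom.id ℝ) (M₁ := A) (M₂ := B)).preimage
      H.op.continuous
  have hKL : K ≤ L := by
    refine Submodule.span_le.2 ?_
    rintro _ ⟨a, b, rfl⟩
    change IsCompactOperator (H.op (H.tmul a b))
    have : H.op (H.tmul a b) = (ContinuousLinearMap.toSpanSingleton ℝ b).comp (innerSL ℝ a) := by
      ext a'
      simp [op_tmul]
    rw [this]
    exact (isCompactOperator_id.clm_comp (ContinuousLinearMap.toSpanSingleton ℝ b) :).comp_clm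
      (innerSL ℝ a)
  have hg : g ∈ K.topologicalClosure := hK ▸ Submodule.mem_top
  exact (Submodule.topologicalClosure_minimal K hKL hL) hg

/-- Bessel's inequality, from expanding ‖g - ∑ φ_i ⊗ (op g φ_i)‖² ≥ 0. It makes contraction with an
orthonormal family a map of norm at most one. -/
theorem sum_norm_op_sq_le {ι : Type*} (S : Finset ι) {φ : ι → A} (hφ : Orthonormal ℝ φ)
    (g : C) : ∑ i ∈ S, ‖H.op g (φ i)‖ ^ 2 ≤ ‖g‖ ^ 2 := by
  have h := sq_nonneg ‖g - ∑ i ∈ S, H.tmul (φ i) (H.op g (φ i))‖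
  rw [norm_sub_sq_real, H.norm_sum_tmul_sq S hφ, inner_sum] at h
  have h2 : ∑ i ∈ S, ⟪g, H.tmul (φ i) (H.op g (φ i))⟫ = ∑ i ∈ S, ‖H.op g (φ i)‖ ^ 2 := by
    refine Finset.sum_congr rfl fun i _ => ?_
    rw [real_inner_comm, ← H.inner_op, real_inner_self_eq_norm_sq]
  rw [h2] at h
  linarith

/-- A singular value decomposition in a Hilbert tensor product. -/
structure SVD (g : C) (σ : ℕ → ℝ) (φ : ℕ → A) (ψ : ℕ → B) : Prop where
  nonneg : ∀ α, 0 ≤ σ α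
  antitone : Antitone σ
  left : Orthonormal ℝ φ
  right : Orthonormal ℝ ψ
  tendsto : Tendsto (fun N => ∑ α ∈ Finset.range N, σ α • H.tmul (φ α) (ψ α)) atTop (𝓝 g)

variable {H}

/-- Through this identity the function of the next step, σ ψ, is recognized as a contraction of the
present one. -/
theorem SVD.op_left {g : C} {σ : ℕ → ℝ} {φ : ℕ → A} {ψ : ℕ → B} (h : H.SVD g σ φ ψ) (α : ℕ) :
    H.op g (φ α) = σ α • ψ α := by
  have h1 : Tendsto (fun N => H.op (∑ β ∈ Finset.range N, σ β • H.tmul (φ β) (ψ β)) (φ α)) atTop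
      (𝓝 (H.op g (φ α))) :=
    (((ContinuousLinearMap.apply ℝ B (φ α)).comp H.op).continuous.tendsto g).comp h.tendsto
  refine tendsto_nhds_unique h1 (tendsto_const_nhds.congr' ?_)
  filter_upwards [eventually_gt_atTop α] with N hN
  rw [map_sum, _root_.sum_apply, Finset.sum_eq_single α]
  · rw [map_smul, _root_.smul_apply, op_tmul, real_inner_self_eq_norm_sq, h.left.1 α]
    simp
  · intro β _ hβ
    rw [map_smul, _root_.smul_apply, op_tmul, h.left.2 hβ, zero_smul, smul_zero]
  · intro hα
    exact absurd (Finset.mem_range.2 hN) hα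

/-- If at most `r` of the weights count, a weighted sum of a nonincreasing sequence is at most the
sum of its first `r` members. -/
theorem sum_mul_le_sum_range {c w : ℕ → ℝ} (hc : Antitone c) (hc0 : ∀ α, 0 ≤ c α)
    (hw0 : ∀ α, 0 ≤ w α) (hw1 : ∀ α, w α ≤ 1) {N r : ℕ} (hrN : r ≤ N)
    (hw : ∑ α ∈ Finset.range N, w α ≤ r) :
    ∑ α ∈ Finset.range N, c α * w α ≤ ∑ α ∈ Finset.range r, c α := by
  -- Compare with the threshold c r: before r the excess c α - c r is counted with full weight,
  -- after r it is nonpositive.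
  have h1 : ∀ α ∈ Finset.range N, c α * w α ≤ (if α < r then c α - c r else 0) + c r * w α := by
    intro α _
    split_ifs with h
    · nlinarith [hc h.le, hw1 α]
    · nlinarith [hc (not_lt.1 h), hw0 α]
  refine (Finset.sum_le_sum h1).trans ?_
  rw [Finset.sum_add_distrib, ← Finset.mul_sum, ← Finset.sum_filter]
  have h2 : (Finset.range N).filter (fun α => α < r) = Finset.range r := by
    ext α
    simp only [Finset.mem_filter, Finset.mem_range]
    omega
  rw [h2, Finset.sum_sub_distrib, Finset.sum_const, Finset.card_range, nsmul_eq_mul]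
  nlinarith [hc0 r]

/-- The lower bound in the Eckart-Young theorem. Let P be the projection onto V. By Bessel, ‖g - k‖²
is at least ∑ ‖σ_α ψ_α - op k φ_α‖², and as op k φ_α ∈ V, each term is at least σ_α² (1 - ‖P ψ_α‖²).
The weights ‖P ψ_α‖² ≤ 1 have sum at most dim V ≤ r, so they remove no more than the r largest σ_α².
-/
theorem SVD.sum_Ico_sq_le {g : C} {σ : ℕ → ℝ} {φ : ℕ → A} {ψ : ℕ → B} (h : H.SVD g σ φ ψ)
    {r N : ℕ} (hrN : r ≤ N) (V : Submodule ℝ B) [FiniteDimensional ℝ V]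
    (hV : Module.finrank ℝ V ≤ r) {k : C}
    (hk : ∀ a, H.op k a ∈ V) :
    ∑ α ∈ Finset.Ico r N, σ α ^ 2 ≤ ‖g - k‖ ^ 2 := by
  have h1 := H.sum_norm_op_sq_le (Finset.range N) h.left (g - k)
  have hle : ∀ α, ‖V.starProjection (ψ α)‖ ≤ 1 := fun α =>
    (V.norm_starProjection_apply_le (ψ α)).trans (h.right.1 α).le
  have h2 : ∀ α ∈ Finset.range N, σ α ^ 2 - σ α ^ 2 * ‖V.starProjection (ψ α)‖ ^ 2 ≤
      ‖H.op (g - k) (φ α)‖ ^ 2 := by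
    intro α _
    rw [map_sub, _root_.sub_apply, h.op_left α]
    set v := H.op k (φ α)
    have hv : v ∈ V := hk _
    have e1 : ‖σ α • ψ α - v‖ ^ 2 = ‖V.starProjection (σ α • ψ α - v)‖ ^ 2
        + ‖Vᗮ.starProjection (σ α • ψ α - v)‖ ^ 2 := V.norm_sq_eq_add_norm_sq_starProjection _
    have e2 : Vᗮ.starProjection (σ α • ψ α - v) = σ α • Vᗮ.starProjection (ψ α) := by
      rw [map_sub, map_smul, (Submodule.starProjection_apply_eq_zero_iff (K := Vᗮ)).2
        (V.le_orthogonal_orthogonal hv), sub_zero]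
    have e3 := V.norm_sq_eq_add_norm_sq_starProjection (ψ α)
    rw [h.right.1 α] at e3
    rw [e1, e2, norm_smul, mul_pow, Real.norm_eq_abs, sq_abs]
    nlinarith [sq_nonneg ‖V.starProjection (σ α • ψ α - v)‖]
  -- A trace estimate: expand in an orthonormal basis of V, exchange the sums, and apply Bessel's
  -- inequality for ψ to each basis vector.
  have h3 : ∑ α ∈ Finset.range N, ‖V.starProjection (ψ α)‖ ^ 2 ≤ r := by
    set b := stdOrthonormalBasis ℝ V
    have e1 : ∀ α, ‖V.starProjection (ψ α)‖ ^ 2 = ∑ i, ⟪ψ α, (b i : B)⟫ ^ 2 := by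
      intro α
      have := b.sum_sq_norm_inner_right (V.orthogonalProjectionOnto (ψ α))
      rw [Submodule.starProjection_apply, ← Submodule.coe_norm, ← this]
      refine Finset.sum_congr rfl fun i _ => ?_
      rw [Real.norm_eq_abs, sq_abs, Submodule.inner_orthogonalProjectionOnto_eq_of_mem_left,
        real_inner_comm]
    simp_rw [e1]
    rw [Finset.sum_comm]
    calc _ ≤ ∑ i : Fin (Module.finrank ℝ V), (1 : ℝ) := by
          refine Finset.sum_le_sum fun i _ => ?_
          have := h.right.sum_inner_products_le (s := Finset.range N) (b i : B)
          simp only [Real.norm_eq_abs, sq_abs] at this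
          refine this.trans ?_
          rw [Submodule.norm_coe, b.orthonormal.1 i]
          norm_num
      _ ≤ r := by simpa using hV
  have h4 := sum_mul_le_sum_range (c := fun α => σ α ^ 2)
    (w := fun α => ‖V.starProjection (ψ α)‖ ^ 2)
    (fun α β hαβ => pow_le_pow_left₀ (h.nonneg β) (h.antitone hαβ) 2) (fun α => sq_nonneg _)
    (fun α => sq_nonneg _) (fun α => pow_le_one₀ (norm_nonneg _) (hle α)) hrN h3
  have h5 := Finset.sum_le_sum h2
  rw [Finset.sum_sub_distrib] at h5
  have h6 := Finset.sum_range_add_sum_Ico (fun α => σ α ^ 2) hrN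
  linarith

/-- Among the tensors of rank at most `r`, the truncated singular value decomposition is the best
approximation. -/
theorem SVD.norm_sub_truncation_le {g : C} {σ : ℕ → ℝ} {φ : ℕ → A} {ψ : ℕ → B}
    (h : H.SVD g σ φ ψ) {r : ℕ} (V : Submodule ℝ B) [FiniteDimensional ℝ V]
    (hV : Module.finrank ℝ V ≤ r) {k : C} (hk : ∀ a, H.op k a ∈ V) :
    ‖g - ∑ α ∈ Finset.range r, σ α • H.tmul (φ α) (ψ α)‖ ≤ ‖g - k‖ := by
  have h1 := (h.tendsto.sub_const (∑ α ∈ Finset.range r, σ α • H.tmul (φ α) (ψ α))).norm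
  refine le_of_tendsto h1 ?_
  filter_upwards [eventually_ge_atTop r] with N hN
  rw [← Finset.sum_range_add_sum_Ico _ hN, add_sub_cancel_left]
  refine (sq_le_sq₀ (norm_nonneg _) (norm_nonneg _)).1 ?_
  have h2 : ∀ α, σ α • H.tmul (φ α) (ψ α) = H.tmul (φ α) (σ α • ψ α) := fun α => by simp
  simp_rw [h2]
  rw [H.norm_sum_tmul_sq _ h.left]
  refine le_trans (le_of_eq ?_) (h.sum_Ico_sq_le hN V hV hk)
  refine Finset.sum_congr rfl fun α _ => ?_
  rw [norm_smul, h.right.1 α, mul_one, Real.norm_eq_abs, sq_abs]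

-- Greedy construction: φ n maximizes ‖T ·‖ on the complement of the earlier φ. At a maximizer the
-- images of orthogonal vectors are orthogonal, so the normalized images serve as ψ.
variable (H) in
theorem exists_svd [CompleteSpace A] (hA : ¬ FiniteDimensional ℝ A) (hB : ¬ FiniteDimensional ℝ B)
    (g : C) : ∃ σ φ ψ, H.SVD g σ φ ψ := by
  set T := H.op g with hT
  choose! pick hpick_mem hpick_norm hpick_max using fun (F : Submodule ℝ A)
    (hF : FiniteDimensional ℝ F) =>
      exists_maximizer_mem_orthogonal hA T (H.isCompactOperator_op g) F
  choose! free hfree_mem hfree_norm using fun (G : Submodule ℝ B)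
    (hG : FiniteDimensional ℝ G) => exists_unit_mem_orthogonal hB G
  -- F n is the span of the first n vectors φ. The recursion runs on subspaces, since the next
  -- choice depends on the span only.
  let F : ℕ → Submodule ℝ A := fun n =>
    Nat.rec (motive := fun _ => Submodule ℝ A) ⊥ (fun _ F => F ⊔ ℝ ∙ pick F) n
  have hF_succ : ∀ n, F (n + 1) = F n ⊔ ℝ ∙ pick (F n) := fun n => rfl
  have hF_fin : ∀ n, FiniteDimensional ℝ ↥(F n) := by
    intro n
    induction n with
    | zero => exact inferInstanceAs (FiniteDimensional ℝ (⊥ : Submodule ℝ A))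
    | succ n ih => rw [hF_succ]; infer_instance
  have hF_mono : Monotone F := monotone_nat_of_le_succ fun n => by rw [hF_succ]; exact le_sup_left
  set φ : ℕ → A := fun n => pick (F n) with hφ
  have hφF : ∀ m n, m < n → φ m ∈ F n := fun m n hmn =>
    hF_mono (Nat.succ_le_of_lt hmn) (by
      rw [hF_succ]; exact Submodule.mem_sup_right (Submodule.mem_span_singleton_self _))
  have hφ_perp : ∀ n, φ n ∈ (F n)ᗮ := fun n => hpick_mem _ (hF_fin n)
  have hφ_norm : ∀ n, ‖φ n‖ = 1 := fun n => hpick_norm _ (hF_fin n)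
  have hφ_lt : ∀ m n, m < n → ⟪φ m, φ n⟫ = 0 := fun m n hmn => hφ_perp n _ (hφF m n hmn)
  have hφ_on : Orthonormal ℝ φ := by
    refine ⟨hφ_norm, fun m n hmn => ?_⟩
    rcases lt_or_gt_of_ne hmn with h | h
    · exact hφ_lt m n h
    · rw [real_inner_comm]; exact hφ_lt n m h
  have hTφ : ∀ m n, m < n → ⟪T (φ m), T (φ n)⟫ = 0 := fun m n hmn =>
    inner_apply_eq_zero_of_maximizer T (F m)ᗮ (hφ_perp m) (hφ_norm m)
      (hpick_max _ (hF_fin m)) (Submodule.orthogonal_le (hF_mono hmn.le) (hφ_perp n))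
      (hφ_lt m n hmn)
  set σ : ℕ → ℝ := fun n => ‖T (φ n)‖ with hσ
  have hσ_anti : Antitone σ := by
    refine antitone_nat_of_succ_le fun n => ?_
    have := hpick_max _ (hF_fin n) (φ (n + 1))
      (Submodule.orthogonal_le (hF_mono n.le_succ) (hφ_perp (n + 1)))
    calc σ (n + 1) ≤ σ n * ‖φ (n + 1)‖ := this
      _ = σ n := by rw [hφ_norm (n + 1), mul_one]
  -- Once a singular value vanishes there is no image to normalize; any unit vector orthogonal to
  -- the earlier ψ is taken instead.
  let pickB : ℕ → Submodule ℝ B → B := fun n G =>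
    if σ n = 0 then free G else (σ n)⁻¹ • T (φ n)
  let G : ℕ → Submodule ℝ B := fun n =>
    Nat.rec (motive := fun _ => Submodule ℝ B) ⊥ (fun n G => G ⊔ ℝ ∙ pickB n G) n
  have hG_succ : ∀ n, G (n + 1) = G n ⊔ ℝ ∙ pickB n (G n) := fun n => rfl
  have hG_fin : ∀ n, FiniteDimensional ℝ ↥(G n) := by
    intro n
    induction n with
    | zero => exact inferInstanceAs (FiniteDimensional ℝ (⊥ : Submodule ℝ B))
    | succ n ih => rw [hG_succ]; infer_instance
  have hG_mono : Monotone G := monotone_nat_of_le_succ fun n => by rw [hG_succ]; exact le_sup_left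
  set ψ : ℕ → B := fun n => pickB n (G n) with hψ
  have hψG : ∀ m n, m < n → ψ m ∈ G n := fun m n hmn =>
    hG_mono (Nat.succ_le_of_lt hmn) (by
      rw [hG_succ]; exact Submodule.mem_sup_right (Submodule.mem_span_singleton_self _))
  have hψ0 : ∀ n, σ n = 0 → ψ n = free (G n) := fun n h => if_pos h
  have hψ1 : ∀ n, σ n ≠ 0 → ψ n = (σ n)⁻¹ • T (φ n) := fun n h => if_neg h
  have hTψ : ∀ n, T (φ n) = σ n • ψ n := by
    intro n
    by_cases h : σ n = 0
    · rw [h, zero_smul, ← norm_eq_zero]; exact h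
    · rw [hψ1 n h, smul_smul, mul_inv_cancel₀ h, one_smul]
  have hψ_lt : ∀ m n, m < n → ⟪ψ m, ψ n⟫ = 0 := by
    intro m n hmn
    by_cases h : σ n = 0
    · rw [hψ0 n h]
      exact hfree_mem _ (hG_fin n) _ (hψG m n hmn)
    · have hm : σ m ≠ 0 := fun hm => h (le_antisymm (hm ▸ hσ_anti hmn.le) (norm_nonneg _))
      rw [hψ1 n h, hψ1 m hm, real_inner_smul_left, real_inner_smul_right, hTφ m n hmn, mul_zero,
        mul_zero]
  have hψ_on : Orthonormal ℝ ψ := by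
    refine ⟨fun n => ?_, fun m n hmn => ?_⟩
    · by_cases h : σ n = 0
      · rw [hψ0 n h]; exact hfree_norm _ (hG_fin n)
      · rw [hψ1 n h, norm_smul, norm_inv, norm_norm]
        exact inv_mul_cancel₀ h
    · rcases lt_or_gt_of_ne hmn with h | h
      · exact hψ_lt m n h
      · rw [real_inner_comm]; exact hψ_lt n m h
  set u : ℕ → C := fun n => H.tmul (φ n) (ψ n) with hu
  have hu_on : Orthonormal ℝ u := by
    refine ⟨fun n => ?_, fun m n hmn => ?_⟩
    · rw [hu, H.norm_tmul, hφ_norm, hψ_on.1 n, mul_one]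
    · change ⟪H.tmul _ _, H.tmul _ _⟫ = 0
      rw [H.inner_tmul, hφ_on.2 hmn, zero_mul]
  have hug : ∀ n, ⟪u n, g⟫ = σ n := by
    intro n
    rw [hu, ← H.inner_op, ← hT, hTψ, real_inner_smul_right, real_inner_self_eq_norm_sq, hψ_on.1 n]
    norm_num
  have hsq : Summable fun n => σ n ^ 2 := by
    have := hu_on.inner_products_summable g
    simpa only [hug, Real.norm_eq_abs, sq_abs] using this
  have hσ0 : Tendsto σ atTop (𝓝 0) := by
    have h1 := hsq.tendsto_atTop_zero.sqrt
    simpa only [Real.sqrt_zero, Real.sqrt_sq (norm_nonneg _), hσ] using h1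
  have hsum : Summable fun n => σ n • u n := by
    have h1 := (hu_on.orthogonalFamily.summable_iff_norm_sq_summable (fun n => σ n)).2
      (by simpa only [Real.norm_eq_abs, sq_abs] using hsq)
    simpa using h1
  have htend := hsum.hasSum.tendsto_sum_nat
  set S := ∑' n, σ n • u n
  have hS : g = S := by
    rw [← sub_eq_zero]
    refine H.op_injective fun a => ?_
    have hlim : Tendsto (fun N => H.op (g - ∑ n ∈ Finset.range N, σ n • u n) a) atTop
        (𝓝 (H.op (g - S) a)) :=
      (((ContinuousLinearMap.apply ℝ B a).comp H.op).continuous.tendsto (g - S)).comp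
        (tendsto_const_nhds.sub htend)
    refine tendsto_nhds_unique hlim (squeeze_zero_norm (fun N => ?_)
      (by simpa using hσ0.mul_const ‖a‖))
    -- Contracting the remainder g - S_N with a amounts to applying T to the part w of a orthogonal
    -- to φ 0, …, φ (N - 1). By the choice of φ N this has norm at most σ N ‖a‖, which tends to 0.
    set w := a - ∑ n ∈ Finset.range N, ⟪φ n, a⟫ • φ n with hw
    have e1 : H.op (g - ∑ n ∈ Finset.range N, σ n • u n) a = T w := by
      rw [hw, map_sub, map_sub, _root_.sub_apply, map_sum, map_sum, _root_.sum_apply]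
      congr 1
      refine Finset.sum_congr rfl fun n _ => ?_
      rw [map_smul, map_smul, _root_.smul_apply, hu, op_tmul, hTψ, smul_comm]
    have hFN : ∀ N, ∀ x ∈ F N, (∀ n < N, ⟪φ n, w⟫ = 0) → ⟪x, w⟫ = 0 := by
      intro N
      induction N with
      | zero =>
        intro x hx _
        rw [(Submodule.mem_bot ℝ).1 hx, inner_zero_left]
      | succ N ih =>
        intro x hx h
        rw [hF_succ] at hx
        obtain ⟨y, hy, z, hz, rfl⟩ := Submodule.mem_sup.1 hx
        obtain ⟨c, rfl⟩ := Submodule.mem_span_singleton.1 hz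
        rw [inner_add_left, ih y hy fun n hn => h n (by omega), real_inner_smul_left,
          h N (by omega), mul_zero, add_zero]
    have hwφ : ∀ n < N, ⟪φ n, w⟫ = 0 := by
      intro n hn
      rw [hw, inner_sub_right, inner_sum, Finset.sum_eq_single n]
      · rw [real_inner_smul_right, real_inner_self_eq_norm_sq, hφ_norm]; ring
      · intro m _ hm
        rw [real_inner_smul_right, hφ_on.2 hm.symm, mul_zero]
      · exact fun h => absurd (Finset.mem_range.2 hn) h
    have hwle : ‖w‖ ≤ ‖a‖ := by
      have e2 : a = w + ∑ n ∈ Finset.range N, ⟪φ n, a⟫ • φ n := by rw [hw]; abel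
      have e3 : ⟪w, ∑ n ∈ Finset.range N, ⟪φ n, a⟫ • φ n⟫ = 0 := by
        rw [inner_sum]
        refine Finset.sum_eq_zero fun n hn => ?_
        rw [real_inner_smul_right, real_inner_comm (φ n) w, hwφ n (Finset.mem_range.1 hn), mul_zero]
      have e4 := norm_add_sq_real w (∑ n ∈ Finset.range N, ⟪φ n, a⟫ • φ n)
      rw [← e2, e3] at e4
      refine (sq_le_sq₀ (norm_nonneg _) (norm_nonneg _)).1 ?_
      nlinarith [sq_nonneg ‖∑ n ∈ Finset.range N, ⟪φ n, a⟫ • φ n‖]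
    rw [e1]
    have hwF : w ∈ (F N)ᗮ := fun x hx => hFN N x hx hwφ
    exact (hpick_max _ (hF_fin N) w hwF).trans
      (mul_le_mul_of_nonneg_left hwle (norm_nonneg _))
  exact ⟨σ, φ, ψ, fun n => norm_nonneg _, hσ_anti, hφ_on, hψ_on, hS ▸ htend⟩

theorem pi_op (p : ℕ) (g : PiLp 2 fun _ : Fin p => C) (a : PiLp 2 fun _ : Fin p => A) :
    (H.pi p).op g a = ∑ i, H.op (g i) (a i) := by
  refine ext_inner_left ℝ fun b => ?_
  rw [inner_op, PiLp.inner_apply, inner_sum]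
  exact Finset.sum_congr rfl fun i _ => by rw [inner_op, pi_tmul_apply]

end HilbertTensor

/-! ### Square integrable functions on product spaces -/

section Inner

variable {X : Type*} [MeasurableSpace X] {μ : Measure X}

theorem inner_lp_eq_integral (f g : Lp ℝ 2 μ) : ⟪f, g⟫ = ∫ x, f x * g x ∂μ := by
  rw [L2.inner_def]
  refine integral_congr_ae (ae_of_all _ fun x => ?_)
  simp [mul_comm]

theorem inner_toLp {f g : X → ℝ} (hf : MemLp f 2 μ) (hg : MemLp g 2 μ) :
    ⟪hf.toLp f, hg.toLp g⟫ = ∫ x, f x * g x ∂μ := by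
  rw [inner_lp_eq_integral]
  refine integral_congr_ae ?_
  filter_upwards [hf.coeFn_toLp, hg.coeFn_toLp] with x h1 h2
  rw [h1, h2]

end Inner

section PureTensor

variable {ι : Type*} [Fintype ι] {X : ι → Type*} [∀ i, MeasurableSpace (X i)]
  {μ : (i : ι) → Measure (X i)} [∀ i, SigmaFinite (μ i)]

theorem memLp_prod_apply {u : (i : ι) → X i → ℝ} (hu : ∀ i, MemLp (u i) 2 (μ i)) :
    MemLp (fun x : (i : ι) → X i => ∏ i, u i (x i)) 2 (Measure.pi μ) := by
  have hm : AEStronglyMeasurable (fun x : (i : ι) → X i => ∏ i, u i (x i)) (Measure.pi μ) :=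
    Finset.aestronglyMeasurable_fun_prod _ fun i _ =>
      (hu i).1.comp_quasiMeasurePreserving (Measure.quasiMeasurePreserving_eval _ i)
  rw [memLp_two_iff_integrable_sq hm]
  simp_rw [← Finset.prod_pow]
  exact Integrable.fintype_prod_dep fun i => (hu i).integrable_sq

theorem prod_apply_congr_ae {u v : (i : ι) → X i → ℝ} (h : ∀ i, u i =ᵐ[μ i] v i) :
    (fun x : (i : ι) → X i => ∏ i, u i (x i)) =ᵐ[Measure.pi μ] fun x => ∏ i, v i (x i) := by
  have : ∀ i, ∀ᵐ x ∂Measure.pi μ, u i (x i) = v i (x i) := fun i =>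
    (Measure.quasiMeasurePreserving_eval μ i).ae (h i)
  filter_upwards [ae_all_iff.2 this] with x hx
  exact Finset.prod_congr rfl fun i _ => hx i

variable (μ) in
/-- The elementary tensor `u₁ ⊗ ⋯ ⊗ u_m` of square integrable functions. -/
def pureTensor : MultilinearMap ℝ (fun i => Lp ℝ 2 (μ i)) (Lp ℝ 2 (Measure.pi μ)) where
  toFun u := (memLp_prod_apply fun i => Lp.memLp (u i)).toLp _
  map_update_add' := by
    intro inst u i a b
    rw [← MemLp.toLp_add]
    refine MemLp.toLp_congr _ _ ?_
    have h1 := (Measure.quasiMeasurePreserving_eval μ i).ae (Lp.coeFn_add a b)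
    filter_upwards [h1] with x hx
    simp only [Pi.add_apply]
    rw [Fintype.prod_eq_mul_prod_compl i, Fintype.prod_eq_mul_prod_compl i,
      Fintype.prod_eq_mul_prod_compl i]
    have h2 : ∀ c : Lp ℝ 2 (μ i), ∏ j ∈ {i}ᶜ, (Function.update u i c j : X j → ℝ) (x j) =
        ∏ j ∈ {i}ᶜ, (u j : X j → ℝ) (x j) := fun c =>
      Finset.prod_congr rfl fun j hj => by
        rw [Function.update_of_ne (by simpa using hj)]
    rw [h2, h2, h2]
    simp only [Function.update_self]
    rw [hx, Pi.add_apply, add_mul]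
  map_update_smul' := by
    intro inst u i c a
    rw [← MemLp.toLp_const_smul]
    refine MemLp.toLp_congr _ _ ?_
    have h1 := (Measure.quasiMeasurePreserving_eval μ i).ae (Lp.coeFn_smul c a)
    filter_upwards [h1] with x hx
    simp only [Pi.smul_apply]
    rw [Fintype.prod_eq_mul_prod_compl i, Fintype.prod_eq_mul_prod_compl i]
    have h2 : ∀ c : Lp ℝ 2 (μ i), ∏ j ∈ {i}ᶜ, (Function.update u i c j : X j → ℝ) (x j) =
        ∏ j ∈ {i}ᶜ, (u j : X j → ℝ) (x j) := fun c =>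
      Finset.prod_congr rfl fun j hj => by
        rw [Function.update_of_ne (by simpa using hj)]
    rw [h2, h2]
    simp only [Function.update_self]
    rw [hx, Pi.smul_apply, smul_eq_mul, smul_eq_mul, mul_assoc]

theorem coeFn_pureTensor (u : (i : ι) → Lp ℝ 2 (μ i)) :
    pureTensor μ u =ᵐ[Measure.pi μ] fun x => ∏ i, u i (x i) :=
  (memLp_prod_apply fun i => Lp.memLp (u i)).coeFn_toLp

theorem coeFn_pureTensor_toLp {u : (i : ι) → X i → ℝ} (hu : ∀ i, MemLp (u i) 2 (μ i)) :
    pureTensor μ (fun i => (hu i).toLp (u i)) =ᵐ[Measure.pi μ] fun x => ∏ i, u i (x i) :=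
  (coeFn_pureTensor _).trans (prod_apply_congr_ae fun i => (hu i).coeFn_toLp)

theorem inner_pureTensor (u v : (i : ι) → Lp ℝ 2 (μ i)) :
    ⟪pureTensor μ u, pureTensor μ v⟫ = ∏ i, ⟪u i, v i⟫ := by
  simp_rw [inner_lp_eq_integral]
  rw [← integral_fintype_prod_eq_prod (fun i x => u i x * v i x)]
  refine integral_congr_ae ?_
  filter_upwards [coeFn_pureTensor u, coeFn_pureTensor v] with x h1 h2
  rw [h1, h2, Finset.prod_mul_distrib]

end PureTensor

section LpTensor

variable {Y A B : Type*} [MeasurableSpace Y] [MeasurableSpace A] [MeasurableSpace B]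
  {μY : Measure Y} {μA : Measure A} {μB : Measure B}

theorem mul_prod_congr_ae {e : Y → A × B} (he : MeasurePreserving e μY (μA.prod μB))
    {a a' : A → ℝ} {b b' : B → ℝ} (ha : a =ᵐ[μA] a') (hb : b =ᵐ[μB] b') :
    (fun y => a (e y).1 * b (e y).2) =ᵐ[μY] fun y => a' (e y).1 * b' (e y).2 := by
  have h1 := he.quasiMeasurePreserving.ae (Measure.quasiMeasurePreserving_fst.ae ha)
  have h2 := he.quasiMeasurePreserving.ae (Measure.quasiMeasurePreserving_snd.ae hb)
  filter_upwards [h1, h2] with y hy1 hy2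
  rw [hy1, hy2]

theorem memLp_mul_prod {e : Y → A × B} (he : MeasurePreserving e μY (μA.prod μB)) {a : A → ℝ}
    {b : B → ℝ} (ha : MemLp a 2 μA) (hb : MemLp b 2 μB) :
    MemLp (fun y => a (e y).1 * b (e y).2) 2 μY := by
  have : MemLp (fun z : A × B => a z.1 * b z.2) 2 (μA.prod μB) := by
    have hm : AEStronglyMeasurable (fun z : A × B => a z.1 * b z.2) (μA.prod μB) :=
      ha.1.comp_fst.mul hb.1.comp_snd
    rw [memLp_two_iff_integrable_sq hm]
    simp_rw [mul_pow]
    exact ha.integrable_sq.mul_prod hb.integrable_sq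
  exact this.comp_measurePreserving he

variable [IsFiniteMeasure μA] [IsFiniteMeasure μB]

theorem integral_mul_prod {e : Y ≃ᵐ A × B} (he : MeasurePreserving e μY (μA.prod μB)) (a : A → ℝ)
    (b : B → ℝ) : ∫ y, a (e y).1 * b (e y).2 ∂μY = (∫ x, a x ∂μA) * ∫ x, b x ∂μB := by
  rw [← integral_prod_mul, ← he.integral_comp']

/-- Rectangles form a π-system generating the product σ-algebra, so the vanishing of the integrals
extends to all measurable sets. This yields the totality of elementary tensors in L². -/
theorem ae_eq_zero_of_setIntegral_prod {e : Y ≃ᵐ A × B} [IsFiniteMeasure μY] {c : Y → ℝ}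
    (hc : Integrable c μY)
    (h : ∀ s t, MeasurableSet s → MeasurableSet t → ∫ y in e ⁻¹' (s ×ˢ t), c y ∂μY = 0) :
    c =ᵐ[μY] 0 := by
  have key : ∀ W : Set (A × B), MeasurableSet W → ∫ y in e ⁻¹' W, c y ∂μY = 0 := by
    intro W hW
    induction W, hW using MeasurableSpace.induction_on_inter generateFrom_prod.symm
      isPiSystem_prod with
    | empty => simp
    | basic W hW =>
      obtain ⟨s, hs, t, ht, rfl⟩ := hW
      exact h s t hs ht
    | compl W hW ih =>
      have h1 := integral_add_compl (e.measurable hW) hc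
      have h2 := h Set.univ Set.univ .univ .univ
      rw [Set.univ_prod_univ, Set.preimage_univ, setIntegral_univ] at h2
      rw [ih, h2, zero_add] at h1
      exact h1
    | iUnion W hd hW ih =>
      rw [Set.preimage_iUnion, integral_iUnion (fun i => e.measurable (hW i))
        (fun i j hij => (hd hij).preimage e) hc.integrableOn]
      simp [ih]
  refine ae_eq_zero_of_forall_setIntegral_eq_of_sigmaFinite (fun s _ _ => hc.integrableOn)
    fun s hs _ => ?_
  have := key (e.symm ⁻¹' s) (e.symm.measurable hs)
  rwa [← Set.preimage_comp, e.symm_comp_self, Set.preimage_id] at this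

/-- `L²(A × B)` is the Hilbert tensor product of `L²(A)` and `L²(B)`. -/
def lpTensor (e : Y ≃ᵐ A × B) (he : MeasurePreserving e μY (μA.prod μB)) :
    HilbertTensor (Lp ℝ 2 μA) (Lp ℝ 2 μB) (Lp ℝ 2 μY) where
  tmul := LinearMap.mk₂ ℝ
    (fun a b => (memLp_mul_prod he (Lp.memLp a) (Lp.memLp b)).toLp _)
    (fun a a' b => by
      rw [← MemLp.toLp_add]
      refine MemLp.toLp_congr _ _ ((mul_prod_congr_ae he (Lp.coeFn_add a a') .rfl).trans ?_)
      exact ae_of_all _ fun y => by simp [add_mul])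
    (fun c a b => by
      rw [← MemLp.toLp_const_smul]
      refine MemLp.toLp_congr _ _ ((mul_prod_congr_ae he (Lp.coeFn_smul c a) .rfl).trans ?_)
      exact ae_of_all _ fun y => by simp [mul_assoc])
    (fun a b b' => by
      rw [← MemLp.toLp_add]
      refine MemLp.toLp_congr _ _ ((mul_prod_congr_ae he .rfl (Lp.coeFn_add b b')).trans ?_)
      exact ae_of_all _ fun y => by simp [mul_add])
    (fun c a b => by
      rw [← MemLp.toLp_const_smul]
      refine MemLp.toLp_congr _ _ ((mul_prod_congr_ae he .rfl (Lp.coeFn_smul c b)).trans ?_)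
      exact ae_of_all _ fun y => by simp [mul_left_comm])
  inner_tmul a b a' b' := by
    rw [LinearMap.mk₂_apply, LinearMap.mk₂_apply, inner_toLp, inner_lp_eq_integral,
      inner_lp_eq_integral, ← integral_mul_prod he]
    exact integral_congr_ae (ae_of_all _ fun y => by ring)
  total c hc := by
    have : IsFiniteMeasure μY := ⟨by
      rw [← Set.preimage_univ (f := e), he.measure_preimage MeasurableSet.univ.nullMeasurableSet]
      exact measure_lt_top _ _⟩
    rw [Lp.eq_zero_iff_ae_eq_zero]
    refine ae_eq_zero_of_setIntegral_prod (e := e) ((Lp.memLp c).integrable one_le_two)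
      fun s t hs ht => ?_
    have h1 := hc (indicatorConstLp 2 hs (measure_ne_top _ _) 1)
      (indicatorConstLp 2 ht (measure_ne_top _ _) 1)
    rw [inner_lp_eq_integral] at h1
    rw [← integral_indicator (e.measurable (hs.prod ht)), ← h1]
    refine integral_congr_ae ?_
    have h2 := mul_prod_congr_ae he
      (indicatorConstLp_coeFn (p := 2) (hs := hs) (hμs := measure_ne_top μA s) (c := (1 : ℝ)))
      (indicatorConstLp_coeFn (p := 2) (hs := ht) (hμs := measure_ne_top μB t) (c := (1 : ℝ)))
    filter_upwards [(memLp_mul_prod he (Lp.memLp _) (Lp.memLp _)).coeFn_toLp.trans h2] with y hy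
    rw [LinearMap.mk₂_apply, hy]
    by_cases h3 : (e y).1 ∈ s <;> by_cases h4 : (e y).2 ∈ t <;>
      simp [Set.indicator, h3, h4]

theorem coeFn_lpTensor_tmul {e : Y ≃ᵐ A × B} (he : MeasurePreserving e μY (μA.prod μB))
    (a : Lp ℝ 2 μA) (b : Lp ℝ 2 μB) :
    (lpTensor e he).tmul a b =ᵐ[μY] fun y => a (e y).1 * b (e y).2 :=
  (memLp_mul_prod he (Lp.memLp a) (Lp.memLp b)).coeFn_toLp

theorem lpTensor_tmul_toLp {e : Y ≃ᵐ A × B} (he : MeasurePreserving e μY (μA.prod μB))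
    {a : A → ℝ} {b : B → ℝ} (ha : MemLp a 2 μA) (hb : MemLp b 2 μB) :
    (lpTensor e he).tmul (ha.toLp a) (hb.toLp b) =
      (memLp_mul_prod he ha hb).toLp _ :=
  MemLp.toLp_congr (memLp_mul_prod he (Lp.memLp _) (Lp.memLp _)) _
    (mul_prod_congr_ae he ha.coeFn_toLp hb.coeFn_toLp)

end LpTensor

section VecLp

variable {Y : Type*} [MeasurableSpace Y] {μ : Measure Y}

/-- A vector of square integrable functions. -/
def vecLp (p : ℕ) (g : ℕ → Y → ℝ) (hg : ∀ i < p, MemLp (g i) 2 μ) :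
    PiLp 2 fun _ : Fin p => Lp ℝ 2 μ :=
  WithLp.toLp 2 fun i => (hg i i.2).toLp (g i)

@[simp] theorem vecLp_apply {p : ℕ} {g : ℕ → Y → ℝ} (hg : ∀ i < p, MemLp (g i) 2 μ) (i : Fin p) :
    vecLp p g hg i = (hg i i.2).toLp (g i) := rfl

theorem tendsto_piLp_iff {p : ℕ} {f : ℕ → PiLp 2 fun _ : Fin p => Lp ℝ 2 μ}
    {F : PiLp 2 fun _ : Fin p => Lp ℝ 2 μ} :
    Tendsto f atTop (𝓝 F) ↔ ∀ i, Tendsto (fun N => f N i) atTop (𝓝 (F i)) := by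
  constructor
  · intro h i
    exact ((PiLp.continuous_apply 2 (fun _ : Fin p => Lp ℝ 2 μ) i).tendsto F).comp h
  · intro h
    have h1 : Tendsto (fun N => WithLp.ofLp (f N)) atTop (𝓝 (WithLp.ofLp F)) := tendsto_pi_nhds.2 h
    exact ((PiLp.continuous_toLp 2 (fun _ : Fin p => Lp ℝ 2 μ)).tendsto _).comp h1

theorem sum_apply_piLp {p : ℕ} {ι : Type*} (S : Finset ι)
    (f : ι → PiLp 2 fun _ : Fin p => Lp ℝ 2 μ) (i : Fin p) :
    (∑ α ∈ S, f α) i = ∑ α ∈ S, f α i := by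
  rw [WithLp.ofLp_sum, Finset.sum_apply]

theorem toLp_finset_sum {ι : Type*} (S : Finset ι) {f : ι → Y → ℝ} (hf : ∀ i, MemLp (f i) 2 μ) :
    (memLp_finsetSum S fun i _ => hf i).toLp (fun y => ∑ i ∈ S, f i y) =
      ∑ i ∈ S, (hf i).toLp (f i) := by
  have h : ∀ᵐ y ∂μ, ∀ i ∈ S, (hf i).toLp (f i) y = f i y :=
    (ae_ball_iff S.countable_toSet).2 fun i _ => (hf i).coeFn_toLp
  refine Lp.ext ?_
  filter_upwards [(memLp_finsetSum S fun i _ => hf i).coeFn_toLp, h,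
    Lp.coeFn_finsetSum S fun i => (hf i).toLp (f i)] with y hy1 hy2 hy3
  rw [hy1, hy3, Finset.sum_apply]
  exact Finset.sum_congr rfl fun i hi => (hy2 i hi).symm

theorem not_finiteDimensional_piLp {p : ℕ} (hp : 0 < p) {V : Type*} [NormedAddCommGroup V]
    [NormedSpace ℝ V] (hV : ¬ FiniteDimensional ℝ V) :
    ¬ FiniteDimensional ℝ (PiLp 2 fun _ : Fin p => V) := by
  intro h
  refine hV (Module.Finite.of_surjective
    (PiLp.proj (𝕜 := ℝ) 2 (fun _ : Fin p => V) ⟨0, hp⟩ : _ →L[ℝ] V).toLinearMap fun v => ?_)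
  exact ⟨WithLp.toLp 2 fun _ => v, rfl⟩

end VecLp

/-! ### Singular value decompositions of functions and of elements of L² -/

section Link

variable {Y A B : Type*} [MeasurableSpace Y] [MeasurableSpace A] [MeasurableSpace B]
  {μY : Measure Y} {μA : Measure A} {μB : Measure B} [IsFiniteMeasure μA] [IsFiniteMeasure μB]
  {e : Y ≃ᵐ A × B} {p : ℕ} {g : ℕ → Y → ℝ}

theorem IsSVD.svd (he : MeasurePreserving e μY (μA.prod μB)) {σ : ℕ → ℝ} {φ : ℕ → A → ℕ → ℝ} {ψ : ℕ → B → ℝ}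
    (h : IsSVD μY μA μB (fun y => (e y).1) (fun y => (e y).2) p g σ φ ψ)
    (hg : ∀ i < p, MemLp (g i) 2 μY) :
    ((lpTensor e he).pi p).SVD (vecLp p g hg) σ
      (fun α => vecLp p (fun i x => φ i x α) fun i hi => h.memLp_left i hi α)
      (fun α => (h.memLp_right α).toLp (ψ α)) where
  nonneg := h.nonneg
  antitone := h.antitone
  left := by
    rw [orthonormal_iff_ite]
    intro α β
    rw [← h.orthonormal_left α β, PiLp.inner_apply, Finset.sum_range]
    refine Finset.sum_congr rfl fun i _ => ?_
    rw [vecLp_apply, vecLp_apply, inner_toLp]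
  right := by
    rw [orthonormal_iff_ite]
    intro α β
    rw [← h.orthonormal_right α β, inner_toLp]
  tendsto := by
    rw [tendsto_piLp_iff]
    intro i
    have h1 : ∀ N, MemLp (fun y => ∑ α ∈ Finset.range N, σ α * φ i (e y).1 α * ψ α (e y).2) 2 μY :=
      fun N => memLp_finsetSum _ fun α _ => by
        simpa only [mul_assoc] using
          (memLp_mul_prod he (h.memLp_left i i.2 α) (h.memLp_right α)).const_mul (σ α)
    have h2 := (Lp.tendsto_Lp_iff_tendsto_eLpNorm'' _ h1 (g i) (hg i i.2)).2 (by
      refine (h.tendsto i i.2).congr fun N => ?_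
      rw [← eLpNorm_neg]
      congr 1
      ext y
      simp)
    refine h2.congr fun N => ?_
    rw [sum_apply_piLp]
    simp only [PiLp.smul_apply, HilbertTensor.pi_tmul_apply, vecLp_apply]
    simp_rw [lpTensor_tmul_toLp, ← MemLp.toLp_const_smul]
    rw [← toLp_finset_sum]
    refine MemLp.toLp_congr _ _ (ae_of_all _ fun y => ?_)
    simp [mul_assoc]

theorem exists_isSVD (he : MeasurePreserving e μY (μA.prod μB))
    (hA : ¬ FiniteDimensional ℝ (Lp ℝ 2 μA))
    (hB : ¬ FiniteDimensional ℝ (Lp ℝ 2 μB)) (hp : 0 < p) (hg : ∀ i < p, MemLp (g i) 2 μY) :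
    ∃ σ φ ψ, IsSVD μY μA μB (fun y => (e y).1) (fun y => (e y).2) p g σ φ ψ := by
  obtain ⟨σ, φ, ψ, h⟩ := ((lpTensor e he).pi p).exists_svd (not_finiteDimensional_piLp hp hA) hB
    (vecLp p g hg)
  -- Components with index at least p are unconstrained; they are set to 0.
  refine ⟨σ, fun i x α => if hi : i < p then (φ α ⟨i, hi⟩ : A → ℝ) x else 0,
    fun α => (ψ α : B → ℝ), h.nonneg, h.antitone, ?_, fun α => Lp.memLp _, ?_, ?_, ?_⟩
  · intro i hi α
    simpa only [hi, dif_pos] using Lp.memLp (φ α ⟨i, hi⟩)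
  · intro α β
    rw [← orthonormal_iff_ite.1 h.left α β, PiLp.inner_apply, Finset.sum_range]
    refine Finset.sum_congr rfl fun i _ => ?_
    simp only [i.2, dif_pos, inner_lp_eq_integral]
  · intro α β
    rw [← orthonormal_iff_ite.1 h.right α β, inner_lp_eq_integral]
  · intro i hi
    have h1 := tendsto_piLp_iff.1 h.tendsto ⟨i, hi⟩
    rw [vecLp_apply, Lp.tendsto_Lp_iff_tendsto_eLpNorm] at h1
    refine h1.congr fun N => ?_
    rw [← eLpNorm_neg]
    refine eLpNorm_congr_ae ?_
    rw [sum_apply_piLp]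
    have h2 := Lp.coeFn_finsetSum (Finset.range N)
      (fun α => (σ α • ((lpTensor e he).pi p).tmul (φ α) (ψ α)) ⟨i, hi⟩)
    have h3 : ∀ᵐ y ∂μY, ∀ α, ((σ α • ((lpTensor e he).pi p).tmul (φ α) (ψ α)) ⟨i, hi⟩ : Lp ℝ 2 μY) y
        = σ α * (φ α ⟨i, hi⟩ : A → ℝ) (e y).1 * ψ α (e y).2 := by
      rw [ae_all_iff]
      intro α
      have h4 := Lp.coeFn_smul (σ α) ((lpTensor e he).tmul (φ α ⟨i, hi⟩) (ψ α))
      filter_upwards [h4, coeFn_lpTensor_tmul he (φ α ⟨i, hi⟩) (ψ α)] with y hy1 hy2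
      rw [PiLp.smul_apply, HilbertTensor.pi_tmul_apply, hy1, Pi.smul_apply, hy2, smul_eq_mul,
        mul_assoc]
    filter_upwards [h2, h3] with y hy2 hy3
    simp only [Pi.neg_apply, Pi.sub_apply, hy2, Finset.sum_apply, hy3, neg_sub, hi, dif_pos]

end Link

/-! ### The spaces of functions of the last variables -/

section Tails

variable {k : ℕ} {n : Fin (k + 2) → ℕ}

theorem prod_tail_eq {M : Type*} [CommMonoid M] (j : Fin (k + 1))
    (F : {i : Fin (k + 2) // j.castSucc ≤ i} → M) :
    ∏ i, F i = F ⟨j.castSucc, le_rfl⟩ *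
      ∏ i : {i : Fin (k + 2) // j.succ ≤ i}, F ⟨i.1, j.castSucc_lt_succ.le.trans i.2⟩ := by
  rw [Fintype.prod_eq_mul_prod_subtype_ne F ⟨j.castSucc, le_rfl⟩]
  congr 1
  refine Fintype.prod_equiv
    { toFun := fun i => ⟨i.1.1, by
        have h1 := i.1.2
        have h2 : i.1.1 ≠ j.castSucc := fun h => i.2 (Subtype.ext h)
        exact Fin.castSucc_lt_iff_succ_le.1 (lt_of_le_of_ne h1 h2.symm)⟩
      invFun := fun i => ⟨⟨i.1, j.castSucc_lt_succ.le.trans i.2⟩, fun h => by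
        have h1 : i.1 = j.castSucc := congrArg Subtype.val h
        have h2 := i.2
        rw [h1] at h2
        exact absurd j.castSucc_lt_succ (not_lt.2 h2)⟩
      left_inv := fun i => rfl
      right_inv := fun i => rfl } _ _ fun i => rfl

/-- The inverse of `y ↦ (head y, rest y)`. -/
def Tail.join (j : Fin (k + 1)) (z : E (n j.castSucc) × Tail n j.succ) : Tail n j.castSucc :=
  fun i => if h : j.castSucc = i.1 then h ▸ z.1 else
    z.2 ⟨i.1, Fin.castSucc_lt_iff_succ_le.1 (lt_of_le_of_ne i.2 h)⟩

theorem Tail.head_join (j : Fin (k + 1)) (z : E (n j.castSucc) × Tail n j.succ) :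
    Tail.head j (Tail.join j z) = z.1 := by
  simp [Tail.head, Tail.join]

theorem Tail.rest_join (j : Fin (k + 1)) (z : E (n j.castSucc) × Tail n j.succ) :
    Tail.rest j (Tail.join j z) = z.2 := by
  ext1 i
  have h : j.castSucc ≠ i.1 := (j.castSucc_lt_succ.trans_le i.2).ne
  simp [Tail.rest, Tail.join, h]

theorem Tail.join_head_rest (j : Fin (k + 1)) (y : Tail n j.castSucc) :
    Tail.join j (Tail.head j y, Tail.rest j y) = y := by
  ext1 ⟨i, hi⟩
  by_cases h : j.castSucc = i
  · subst h
    simp [Tail.head, Tail.join]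
  · simp [Tail.rest, Tail.join, h]

theorem Tail.measurable_join (j : Fin (k + 1)) : Measurable (Tail.join (n := n) j) := by
  refine measurable_pi_lambda _ fun ⟨i, hi⟩ => ?_
  by_cases h : j.castSucc = i
  · subst h
    simpa [Tail.join] using measurable_fst
  · simp only [Tail.join, h, dif_neg, not_false_iff]
    exact (measurable_pi_apply _).comp measurable_snd

/-- The splitting `y ↦ (head y, rest y)`. -/
def tailEquiv (n : Fin (k + 2) → ℕ) (j : Fin (k + 1)) :
    Tail n j.castSucc ≃ᵐ E (n j.castSucc) × Tail n j.succ where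
  toFun y := (Tail.head j y, Tail.rest j y)
  invFun := Tail.join j
  left_inv := Tail.join_head_rest j
  right_inv z := Prod.ext (Tail.head_join j z) (Tail.rest_join j z)
  measurable_toFun := by
    refine Measurable.prodMk (measurable_pi_apply _) ?_
    exact measurable_pi_lambda _ fun _ => measurable_pi_apply _
  measurable_invFun := Tail.measurable_join j

variable (Ω : (i : Fin (k + 2)) → Set (E (n i)))

theorem measurePreserving_tailEquiv (j : Fin (k + 1)) :
    MeasurePreserving (tailEquiv n j) (tailMeasure Ω j.castSucc)
      ((volume.restrict (Ω j.castSucc)).prod (tailMeasure Ω j.succ)) := by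
  have : SigmaFinite (tailMeasure Ω j.succ) := by unfold tailMeasure; infer_instance
  refine MeasurePreserving.symm (tailEquiv n j).symm ⟨(tailEquiv n j).symm.measurable, ?_⟩
  refine (Measure.pi_eq fun s hs => ?_).symm
  rw [Measure.map_apply (tailEquiv n j).symm.measurable (MeasurableSet.univ_pi hs)]
  have h1 : (tailEquiv n j).symm ⁻¹' Set.univ.pi s = s ⟨j.castSucc, le_rfl⟩ ×ˢ
      Set.univ.pi fun i : {i : Fin (k + 2) // j.succ ≤ i} =>
        s ⟨i.1, j.castSucc_lt_succ.le.trans i.2⟩ := by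
    ext z
    have h2 : ∀ y : Tail n j.castSucc, y ∈ Set.univ.pi s ↔ Tail.head j y ∈ s ⟨j.castSucc, le_rfl⟩ ∧
        ∀ i : {i : Fin (k + 2) // j.succ ≤ i},
          Tail.rest j y i ∈ s ⟨i.1, j.castSucc_lt_succ.le.trans i.2⟩ := by
      intro y
      simp only [Set.mem_pi, Set.mem_univ, true_implies]
      constructor
      · exact fun h => ⟨h _, fun i => h _⟩
      · rintro ⟨h3, h4⟩ ⟨i, hi⟩
        by_cases h : j.castSucc = i
        · subst h; exact h3
        · exact h4 ⟨i, Fin.castSucc_lt_iff_succ_le.1 (lt_of_le_of_ne hi h)⟩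
    rw [Set.mem_preimage, h2, Set.mem_prod, Set.mem_univ_pi]
    change Tail.head j (Tail.join j z) ∈ _ ∧ (∀ i, Tail.rest j (Tail.join j z) i ∈ _) ↔ _
    rw [Tail.head_join, Tail.rest_join]
  rw [h1, Measure.prod_prod, tailMeasure, Measure.pi_pi, prod_tail_eq]

/-- The identification of all variables with the variables `(x₀, x₁, …)`. -/
def fullEquiv (n : Fin (k + 2) → ℕ) : ((i : Fin (k + 2)) → E (n i)) ≃ᵐ Tail n 0 where
  toFun x i := x i
  invFun y i := y ⟨i, Fin.zero_le i⟩
  left_inv _ := rfl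
  right_inv _ := rfl
  measurable_toFun := measurable_pi_lambda _ fun _ => measurable_pi_apply _
  measurable_invFun := measurable_pi_lambda _ fun _ => measurable_pi_apply _

theorem measurePreserving_fullEquiv :
    MeasurePreserving (fullEquiv n) (prodMeasure Ω) (tailMeasure Ω 0) := by
  refine MeasurePreserving.symm (fullEquiv n).symm ⟨(fullEquiv n).symm.measurable, ?_⟩
  refine (Measure.pi_eq fun s hs => ?_).symm
  rw [Measure.map_apply (fullEquiv n).symm.measurable (MeasurableSet.univ_pi hs)]
  have h1 : (fullEquiv n).symm ⁻¹' Set.univ.pi s =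
      Set.univ.pi fun i : {i : Fin (k + 2) // 0 ≤ i} => s i.1 := by
    ext y
    simp only [Set.mem_preimage, Set.mem_univ_pi]
    exact ⟨fun h i => h i.1, fun h i => h ⟨i, Fin.zero_le i⟩⟩
  rw [h1, tailMeasure, Measure.pi_pi]
  exact Fintype.prod_equiv (Equiv.subtypeUnivEquiv fun i => Fin.zero_le i) _ _ fun i => rfl

instance [∀ i, IsFiniteMeasure (volume.restrict (Ω i))] (j : Fin (k + 2)) :
    IsFiniteMeasure (tailMeasure Ω j) := by
  unfold tailMeasure; infer_instance

/-- The elementary tensors of functions of the last variables. -/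
def tailPure (j : Fin (k + 2)) :
    MultilinearMap ℝ (fun i : {i : Fin (k + 2) // j ≤ i} => Lp ℝ 2 (volume.restrict (Ω i)))
      (Lp ℝ 2 (tailMeasure Ω j)) :=
  pureTensor fun i : {i : Fin (k + 2) // j ≤ i} => volume.restrict (Ω i)

variable [∀ i, IsFiniteMeasure (volume.restrict (Ω i))]

/-- Functions of `(x_j, …)` as a Hilbert tensor product. -/
def tailTensor (j : Fin (k + 1)) :
    HilbertTensor (Lp ℝ 2 (volume.restrict (Ω j.castSucc))) (Lp ℝ 2 (tailMeasure Ω j.succ))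
      (Lp ℝ 2 (tailMeasure Ω j.castSucc)) :=
  lpTensor (tailEquiv n j) (measurePreserving_tailEquiv Ω j)

theorem tailPure_castSucc (j : Fin (k + 1))
    (u : (i : {i : Fin (k + 2) // j.castSucc ≤ i}) → Lp ℝ 2 (volume.restrict (Ω i))) :
    tailPure Ω j.castSucc u = (tailTensor Ω j).tmul (u ⟨j.castSucc, le_rfl⟩)
      (tailPure Ω j.succ fun i => u ⟨i.1, j.castSucc_lt_succ.le.trans i.2⟩) := by
  refine Lp.ext ?_
  have h1 := coeFn_pureTensor (μ := fun i : {i : Fin (k + 2) // j.castSucc ≤ i} =>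
    volume.restrict (Ω i)) u
  have h2 := coeFn_lpTensor_tmul (measurePreserving_tailEquiv Ω j) (u ⟨j.castSucc, le_rfl⟩)
      (tailPure Ω j.succ fun i => u ⟨i.1, j.castSucc_lt_succ.le.trans i.2⟩)
  have h3 := mul_prod_congr_ae (measurePreserving_tailEquiv Ω j)
    (ae_eq_refl (u ⟨j.castSucc, le_rfl⟩))
    (coeFn_pureTensor (μ := fun i : {i : Fin (k + 2) // j.succ ≤ i} =>
      volume.restrict (Ω i)) fun i => u ⟨i.1, j.castSucc_lt_succ.le.trans i.2⟩)
  refine h1.trans (.trans ?_ (h2.trans h3).symm)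
  refine ae_of_all _ fun y => ?_
  dsimp only
  rw [prod_tail_eq]
  rfl

end Tails

/-! ### Spaces of square integrable functions have infinite dimension -/

theorem not_finiteDimensional_of_disjoint {X : Type*} [MeasurableSpace X] {μ : Measure X}
    [IsFiniteMeasure μ] (U : ℕ → Set X) (hU : ∀ i, MeasurableSet (U i)) (hμ : ∀ i, μ (U i) ≠ 0)
    (hd : Pairwise (Function.onFun Disjoint U)) : ¬ FiniteDimensional ℝ (Lp ℝ 2 μ) := by
  intro hfd
  set v : ℕ → Lp ℝ 2 μ := fun i => indicatorConstLp 2 (hU i) (measure_ne_top μ _) 1 with hv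
  have hli : LinearIndependent ℝ v := by
    refine linearIndependent_of_ne_zero_of_inner_eq_zero (fun i h => ?_) fun i j hij => ?_
    · have h1 : ‖v i‖ = 0 := by rw [h, norm_zero]
      rw [hv, norm_indicatorConstLp two_ne_zero ENNReal.ofNat_ne_top] at h1
      simp only [norm_one, one_mul] at h1
      rw [Real.rpow_eq_zero measureReal_nonneg (by norm_num)] at h1
      exact hμ i ((measureReal_eq_zero_iff (measure_ne_top μ _)).1 h1)
    · change ⟪v i, v j⟫ = 0
      rw [inner_lp_eq_integral]
      refine integral_eq_zero_of_ae ?_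
      filter_upwards [indicatorConstLp_coeFn (p := 2) (hs := hU i) (hμs := measure_ne_top μ _)
        (c := (1 : ℝ)), indicatorConstLp_coeFn (p := 2) (hs := hU j)
        (hμs := measure_ne_top μ _) (c := (1 : ℝ))] with x h1 h2
      rw [hv, h1, h2]
      by_cases hx : x ∈ U i
      · simp [Set.disjoint_left.1 (hd hij) hx]
      · simp [hx]
  exact not_finite_iff_infinite.2 inferInstance (LinearIndependent.finite hli)

/-- A nonempty open set in positive dimension is infinite, so it contains infinitely many disjoint
nonempty open sets; each of them has positive Lebesgue measure. -/
theorem not_finiteDimensional_lp_restrict {d : ℕ} (hd : 0 < d) {Ω : Set (E d)} (hΩ : IsOpen Ω)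
    (hne : Ω.Nonempty) [IsFiniteMeasure (volume.restrict Ω)] :
    ¬ FiniteDimensional ℝ (Lp ℝ 2 (volume.restrict Ω)) := by
  have : Nontrivial (E d) := by
    have : Nonempty (Fin d) := ⟨⟨0, hd⟩⟩
    infer_instance
  have hinf : Infinite Ω := by
    obtain ⟨x, hx⟩ := hne
    exact (infinite_of_mem_nhds x (hΩ.mem_nhds hx)).to_subtype
  obtain ⟨U, hU1, hU2, hU3⟩ := exists_seq_infinite_isOpen_pairwise_disjoint Ω
  have hopen : ∀ i, IsOpen (Subtype.val '' U i) := fun i => hΩ.isOpenMap_subtype_val _ (hU2 i)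
  refine not_finiteDimensional_of_disjoint (fun i => Subtype.val '' U i)
    (fun i => (hopen i).measurableSet) (fun i => ?_) fun i j hij =>
      (Set.disjoint_image_iff Subtype.val_injective).2 (hU3 hij)
  rw [Measure.restrict_apply (hopen i).measurableSet,
    Set.inter_eq_left.2 (by rintro _ ⟨x, _, rfl⟩; exact x.2)]
  exact ((hopen i).measure_pos volume ((hU1 i).nonempty.image _)).ne'

/-- Tensoring with fixed unit vectors in the other variables embeds one factor isometrically. -/
theorem not_finiteDimensional_lp_pi {ι : Type*} [Fintype ι] {X : ι → Type*}
    [∀ i, MeasurableSpace (X i)] {μ : (i : ι) → Measure (X i)} [∀ i, SigmaFinite (μ i)]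
    [Nonempty ι] (h : ∀ i, ¬ FiniteDimensional ℝ (Lp ℝ 2 (μ i))) :
    ¬ FiniteDimensional ℝ (Lp ℝ 2 (Measure.pi μ)) := by
  classical
  intro hfd
  have hx : ∀ i, ∃ x : Lp ℝ 2 (μ i), ‖x‖ = 1 := fun i => by
    obtain ⟨x, _, hx⟩ := exists_unit_mem_orthogonal (h i) ⊥
    exact ⟨x, hx⟩
  choose x hx using hx
  obtain ⟨i⟩ := ‹Nonempty ι›
  refine h i (FiniteDimensional.of_injective ((pureTensor μ).toLinearMap x i) ?_)
  rw [← LinearMap.ker_eq_bot, LinearMap.ker_eq_bot']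
  intro a ha
  rw [← norm_eq_zero, ← sq_eq_zero_iff, ← real_inner_self_eq_norm_sq,
    MultilinearMap.toLinearMap_apply, inner_pureTensor,
    Fintype.prod_eq_mul_prod_compl i, Finset.prod_eq_one (s := {i}ᶜ)] at ha
  · simpa using ha
  · intro j hj
    rw [Function.update_of_ne (by simpa using hj), real_inner_self_eq_norm_sq, hx]
    norm_num

/-! ### The truncation error of the tensor train decomposition -/

/-- A nested sum over chains of indices, evaluated from the last index. -/
theorem sum_piFinset_chain {K : ℕ} (R : Fin (K + 1) → ℕ) (m : Fin K → ℕ → ℕ → ℝ) (v : ℕ → ℝ)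
    (c : Fin (K + 1) → ℕ → ℝ)
    (hc : ∀ (j : Fin K) (a : ℕ),
      c j.castSucc a = ∑ b ∈ Finset.range (R j.succ), m j a b * c j.succ b) :
    ∑ α ∈ Fintype.piFinset fun j => Finset.range (R j),
      v (α 0) * ((∏ j : Fin K, m j (α j.castSucc) (α j.succ)) * c (Fin.last K) (α (Fin.last K))) =
      ∑ a ∈ Finset.range (R 0), v a * c 0 a := by
  -- The row `m 0 a` of the first matrix takes the role of v for the remaining chain.
  induction K generalizing v with
  | zero =>
    refine Finset.sum_bij' (fun α _ => α 0) (fun a _ => fun _ => a) ?_ ?_ ?_ ?_ ?_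
    · intro α hα
      exact Fintype.mem_piFinset.1 hα 0
    · intro a ha
      refine Fintype.mem_piFinset.2 fun j => ?_
      rw [Fin.fin_one_eq_zero j]
      exact ha
    · intro α _
      ext j
      rw [Fin.fin_one_eq_zero j]
    · intro a _
      rfl
    · intro α _
      simp
  | succ K ih =>
    have hsplit : ∑ α ∈ Fintype.piFinset fun j => Finset.range (R j),
        v (α 0) * ((∏ j : Fin (K + 1), m j (α j.castSucc) (α j.succ)) *
          c (Fin.last (K + 1)) (α (Fin.last (K + 1)))) =
        ∑ x ∈ Finset.range (R 0) ×ˢ Fintype.piFinset fun j : Fin (K + 1) => Finset.range (R j.succ),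
          v x.1 * (m 0 x.1 (x.2 0) * ((∏ j : Fin K, m j.succ (x.2 j.castSucc) (x.2 j.succ)) *
            c (Fin.last K).succ (x.2 (Fin.last K)))) := by
      refine Finset.sum_bij' (fun α _ => (α 0, fun j => α j.succ))
        (fun x _ => Fin.cons x.1 x.2) ?_ ?_ ?_ ?_ ?_
      · intro α hα
        have h := Fintype.mem_piFinset.1 hα
        exact Finset.mem_product.2 ⟨h 0, Fintype.mem_piFinset.2 fun j => h j.succ⟩
      · intro x hx
        obtain ⟨h1, h2⟩ := Finset.mem_product.1 hx
        refine Fintype.mem_piFinset.2 fun j => ?_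
        refine Fin.cases ?_ (fun j => ?_) j
        · exact h1
        · exact Fintype.mem_piFinset.1 h2 j
      · intro α _
        exact Fin.cons_self_tail α
      · intro x _
        rfl
      · intro α _
        rw [Fin.prod_univ_succ, mul_assoc]
        rfl
    rw [hsplit, Finset.sum_product]
    refine Finset.sum_congr rfl fun a _ => ?_
    dsimp only
    rw [← Finset.mul_sum]
    congr 1
    have h0 := hc 0 a
    rw [Fin.castSucc_zero] at h0
    rw [h0]
    exact ih (fun j => R j.succ) (fun j => m j.succ) (m 0 a) (fun j => c j.succ)
      (fun j a => hc j.succ a)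

section Abstract

variable {A B C : Type*} [NormedAddCommGroup A] [InnerProductSpace ℝ A]
    [NormedAddCommGroup B] [InnerProductSpace ℝ B]
    [NormedAddCommGroup C] [InnerProductSpace ℝ C]
    (H : HilbertTensor A B C) {φ : ℕ → A} (hφ : Orthonormal ℝ φ)

include hφ in
theorem HilbertTensor.norm_sum_range_tmul (q : ℕ) (b : ℕ → B) (D : PiLp 2 fun _ : Fin q => B)
    (hD : ∀ i : Fin q, D i = b i) : ‖∑ β ∈ Finset.range q, H.tmul (φ β) (b β)‖ = ‖D‖ := by
  refine (sq_eq_sq₀ (norm_nonneg _) (norm_nonneg _)).1 ?_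
  rw [H.norm_sum_tmul_sq _ hφ, PiLp.norm_sq_eq_of_L2, Finset.sum_range]
  exact Finset.sum_congr rfl fun i _ => by rw [hD i]

include hφ in
theorem HilbertTensor.norm_sub_op_le [CompleteSpace B] [CompleteSpace C] (q : ℕ) (g g' : C)
    (D D' : PiLp 2 fun _ : Fin q => B) (hD : ∀ i : Fin q, D i = H.op g (φ i))
    (hD' : ∀ i : Fin q, D' i = H.op g' (φ i)) : ‖D - D'‖ ≤ ‖g - g'‖ := by
  refine (sq_le_sq₀ (norm_nonneg _) (norm_nonneg _)).1 ?_
  refine le_trans (le_of_eq ?_) (H.sum_norm_op_sq_le (Finset.range q) hφ (g - g'))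
  rw [PiLp.norm_sq_eq_of_L2, Finset.sum_range]
  exact Finset.sum_congr rfl fun i _ => by
    rw [PiLp.sub_apply, hD i, hD' i, map_sub, _root_.sub_apply]

omit [InnerProductSpace ℝ B] in
theorem norm_piLp_of_eq_one {q : ℕ} (hq : q = 1) (D : PiLp 2 fun _ : Fin q => B) (i : Fin q) :
    ‖D‖ = ‖D i‖ := by
  subst hq
  refine (sq_eq_sq₀ (norm_nonneg _) (norm_nonneg _)).1 ?_
  rw [PiLp.norm_sq_eq_of_L2, Fin.sum_univ_one, Fin.fin_one_eq_zero i]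

end Abstract

/-! ### Existence of the decomposition, addition of the step errors, and bounds for each of them -/

section TT

variable {k : ℕ} {n : Fin (k + 2) → ℕ} {Ω : (i : Fin (k + 2)) → Set (E (n i))}
  {f : ((i : Fin (k + 2)) → E (n i)) → ℝ} {r : Fin (k + 1) → ℕ}

theorem memLp_comp_fullEquiv_symm (hf : MemLp f 2 (prodMeasure Ω)) :
    MemLp (fun y : Tail n 0 => f fun i => y ⟨i, Fin.zero_le i⟩) 2 (tailMeasure Ω 0) :=
  hf.comp_measurePreserving ((measurePreserving_fullEquiv Ω).symm (fullEquiv n))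

theorem TTDecomposition.memLp_g (T : TTDecomposition Ω f r) (hf : MemLp f 2 (prodMeasure Ω))
    (j : Fin (k + 2)) (α : ℕ) : MemLp (T.g j α) 2 (tailMeasure Ω j) := by
  refine Fin.cases ?_ (fun j => ?_) j
  · rw [show T.g 0 α = _ from funext (T.g_zero α)]
    exact memLp_comp_fullEquiv_symm hf
  · rw [show T.g j.succ α = _ from funext (T.g_succ j α)]
    exact ((T.isSVD j).memLp_right α).const_mul _

variable [∀ i, IsFiniteMeasure (volume.restrict (Ω i))]

theorem nonempty_ttDecomposition (hr : ∀ j, 0 < r j) (hf : MemLp f 2 (prodMeasure Ω))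
    (hΩ : ∀ i, ¬ FiniteDimensional ℝ (Lp ℝ 2 (volume.restrict (Ω i)))) :
    Nonempty (TTDecomposition Ω f r) := by
  have hp : ∀ j, 0 < extRank r j := fun j => Fin.cases Nat.one_pos hr j
  have hB : ∀ j : Fin (k + 1), ¬ FiniteDimensional ℝ (Lp ℝ 2 (tailMeasure Ω j.succ)) := by
    intro j
    have : Nonempty {i : Fin (k + 2) // j.succ ≤ i} := ⟨⟨j.succ, le_rfl⟩⟩
    exact not_finiteDimensional_lp_pi fun i => hΩ i
  let G (j : Fin (k + 2)) : Type := {g : ℕ → Tail n j → ℝ // ∀ α, MemLp (g α) 2 (tailMeasure Ω j)}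
  -- A decomposition is chosen in advance for every square integrable input of step j; the actual
  -- inputs are then generated by recursion on j.
  have hsvd (j : Fin (k + 1)) (g : G j.castSucc) := exists_isSVD (p := extRank r j.castSucc)
    (measurePreserving_tailEquiv Ω j) (hΩ j.castSucc) (hB j) (hp _) fun i _ => g.2 i
  choose σ φ ψ h using hsvd
  let g (j : Fin (k + 2)) : G j := Fin.induction (motive := G)
    ⟨fun _ y => f fun i => y ⟨i, Fin.zero_le i⟩, fun _ => memLp_comp_fullEquiv_symm hf⟩
    (fun j g => ⟨fun α y => σ j g α * ψ j g α y, fun α => ((h j g).memLp_right α).const_mul _⟩) j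
  exact ⟨{
    g := fun j => (g j).1
    σ := fun j => σ j (g j.castSucc)
    φ := fun j => φ j (g j.castSucc)
    ψ := fun j => ψ j (g j.castSucc)
    g_zero := fun _ _ => rfl
    g_succ := fun _ _ _ => rfl
    isSVD := fun j => h j (g j.castSucc) }⟩

namespace TTDecomposition

variable (T : TTDecomposition Ω f r) (hf : MemLp f 2 (prodMeasure Ω))

/-- The function that is decomposed in step `j`. -/
def vec (j : Fin (k + 2)) : PiLp 2 fun _ : Fin (extRank r j) => Lp ℝ 2 (tailMeasure Ω j) :=
  vecLp _ (T.g j) fun α _ => T.memLp_g hf j α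

/-- The left singular functions. -/
def left (j : Fin (k + 1)) (α : ℕ) :
    PiLp 2 fun _ : Fin (extRank r j.castSucc) => Lp ℝ 2 (volume.restrict (Ω j.castSucc)) :=
  vecLp _ (fun i x => T.φ j i x α) fun i hi => (T.isSVD j).memLp_left i hi α

/-- The right singular functions. -/
def right (j : Fin (k + 1)) (α : ℕ) : Lp ℝ 2 (tailMeasure Ω j.succ) :=
  ((T.isSVD j).memLp_right α).toLp (T.ψ j α)

theorem svd (j : Fin (k + 1)) :
    ((tailTensor Ω j).pi _).SVD (T.vec hf j.castSucc) (T.σ j) (T.left j) (T.right j) :=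
  IsSVD.svd (measurePreserving_tailEquiv Ω j) (T.isSVD j) fun α _ => T.memLp_g hf j.castSucc α

/-- The error of the truncation in step `j`. -/
def stepError (j : Fin (k + 1)) : ℝ :=
  ‖T.vec hf j.castSucc - ∑ α ∈ Finset.range (extRank r j.succ),
    T.σ j α • ((tailTensor Ω j).pi _).tmul (T.left j α) (T.right j α)‖

omit [∀ i, IsFiniteMeasure (volume.restrict (Ω i))] in
theorem vec_succ_apply (j : Fin (k + 1)) (i : Fin (extRank r j.succ)) :
    T.vec hf j.succ i = T.σ j i • T.right j i := by
  rw [vec, vecLp_apply, right, ← MemLp.toLp_const_smul]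
  exact MemLp.toLp_congr _ _ (ae_of_all _ fun y => T.g_succ j i y)

/-- The truncated tensor train from step `j` on. -/
def reconstr (j : Fin (k + 2)) : ℕ → Tail n j → ℝ :=
  Fin.reverseInduction (motive := fun j => ℕ → Tail n j → ℝ) (T.g (Fin.last (k + 1)))
    (fun j R α y => ∑ β ∈ Finset.range (extRank r j.succ), T.φ j α (Tail.head j y) β * R β (Tail.rest j y)) j

omit [∀ i, IsFiniteMeasure (volume.restrict (Ω i))] in
theorem reconstr_last : T.reconstr (Fin.last (k + 1)) = T.g (Fin.last (k + 1)) :=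
  Fin.reverseInduction_last ..

omit [∀ i, IsFiniteMeasure (volume.restrict (Ω i))] in
theorem reconstr_castSucc (j : Fin (k + 1)) (α : ℕ) (y : Tail n j.castSucc) :
    T.reconstr j.castSucc α y =
      ∑ β ∈ Finset.range (extRank r j.succ), T.φ j α (Tail.head j y) β * T.reconstr j.succ β (Tail.rest j y) := by
  rw [reconstr, Fin.reverseInduction_castSucc]
  rfl

omit [∀ i, IsFiniteMeasure (volume.restrict (Ω i))] in
theorem approx_eq_reconstr (x : (i : Fin (k + 2)) → E (n i)) :
    T.approx x = T.reconstr 0 0 fun i => x i := by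
  have h := sum_piFinset_chain (extRank r)
    (fun j a b => T.φ j a (x j.castSucc) b) (fun _ => 1)
    (fun j a => T.reconstr j a fun i => x i) fun j a => by
      rw [reconstr_castSucc]
      rfl
  simp only [one_mul, reconstr_last] at h
  rw [approx, h]
  simp [extRank]

omit [∀ i, IsFiniteMeasure (volume.restrict (Ω i))] in
include hf in
theorem memLp_reconstr (j : Fin (k + 2)) :
    ∀ α < extRank r j, MemLp (T.reconstr j α) 2 (tailMeasure Ω j) := by
  refine Fin.reverseInduction (fun α _ => ?_) (fun j ih α hα => ?_) j
  · rw [reconstr_last]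
    exact T.memLp_g hf _ α
  · rw [show T.reconstr j.castSucc α = _ from funext (T.reconstr_castSucc j α)]
    exact memLp_finsetSum _ fun β hβ => memLp_mul_prod (measurePreserving_tailEquiv Ω j)
      ((T.isSVD j).memLp_left α hα β) (ih β (Finset.mem_range.1 hβ))

/-- Backward induction. The difference in step j is the truncation error of that step plus ∑ φ_j(β)
⊗ D_β, where D_β are the differences in step j + 1; orthonormality of the φ_j makes the norm of this
sum equal to that of D. -/
theorem norm_vec_sub_reconstr_le {δ : ℝ} (hδ : ∀ j, T.stepError hf j ≤ δ) (j : Fin (k + 2)) :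
    ‖T.vec hf j - vecLp _ (T.reconstr j) (T.memLp_reconstr hf j)‖ ≤ ((k + 1 - j : ℕ) : ℝ) * δ := by
  refine Fin.reverseInduction ?_ (fun j ih => ?_) j
  · have : T.vec hf (Fin.last (k + 1)) =
        vecLp _ (T.reconstr (Fin.last (k + 1))) (T.memLp_reconstr hf _) := by
      unfold vec
      congr 1
      rw [reconstr_last]
    rw [this]
    simp
  · set D : ℕ → Lp ℝ 2 (tailMeasure Ω j.succ) := fun β =>
      if hβ : β < extRank r j.succ then (T.memLp_reconstr hf j.succ β hβ).toLp _ else 0 with hD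
    set H := (tailTensor Ω j).pi (extRank r j.castSucc)
    have h1 : vecLp _ (T.reconstr j.castSucc) (T.memLp_reconstr hf j.castSucc) =
        ∑ β ∈ Finset.range (extRank r j.succ), H.tmul (T.left j β) (D β) := by
      ext1 i
      rw [sum_apply_piLp, vecLp_apply]
      have h2 : ∀ β, MemLp (fun y : Tail n j.castSucc => if β < extRank r j.succ then
          T.φ j i (Tail.head j y) β * T.reconstr j.succ β (Tail.rest j y) else 0) 2
            (tailMeasure Ω j.castSucc) := by
        intro β
        by_cases hβ : β < extRank r j.succ
        · simp only [hβ, if_true]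
          exact memLp_mul_prod (measurePreserving_tailEquiv Ω j)
            ((T.isSVD j).memLp_left i i.2 β) (T.memLp_reconstr hf j.succ β hβ)
        · simp [hβ]
      have h3 := toLp_finset_sum (Finset.range (extRank r j.succ)) h2
      have h4 : (T.memLp_reconstr hf j.castSucc i i.2).toLp _ =
          (memLp_finsetSum (Finset.range (extRank r j.succ)) fun β _ => h2 β).toLp _ := by
        refine MemLp.toLp_congr _ _ (ae_of_all _ fun y => ?_)
        rw [reconstr_castSucc]
        exact Finset.sum_congr rfl fun β hβ => (if_pos (Finset.mem_range.1 hβ)).symm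
      rw [h4, h3]
      refine Finset.sum_congr rfl fun β hβ => ?_
      have hβ' := Finset.mem_range.1 hβ
      rw [HilbertTensor.pi_tmul_apply, left, vecLp_apply, hD]
      simp only [hβ', dif_pos]
      rw [tailTensor, lpTensor_tmul_toLp]
      refine MemLp.toLp_congr _ _ (ae_of_all _ fun y => ?_)
      simp only [if_true]
      rfl
    have h6 := H.norm_sum_range_tmul (T.svd hf j).left (extRank r j.succ)
      (fun β => T.σ j β • T.right j β - D β)
      (T.vec hf j.succ - vecLp _ (T.reconstr j.succ) (T.memLp_reconstr hf j.succ)) fun i => by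
        rw [PiLp.sub_apply, vec_succ_apply, vecLp_apply, hD]
        simp only [i.2, dif_pos]
    have h7 : T.vec hf j.castSucc - ∑ β ∈ Finset.range (extRank r j.succ), H.tmul (T.left j β) (D β) =
        (T.vec hf j.castSucc - ∑ α ∈ Finset.range (extRank r j.succ),
          T.σ j α • H.tmul (T.left j α) (T.right j α)) +
        ∑ β ∈ Finset.range (extRank r j.succ), H.tmul (T.left j β) (T.σ j β • T.right j β - D β) := by
      simp only [map_sub, map_smul, Finset.sum_sub_distrib]
      abel
    rw [h1, h7]
    refine (norm_add_le _ _).trans ?_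
    rw [h6]
    have h8 : ((k + 1 - (j.castSucc : ℕ) : ℕ) : ℝ) = ((k + 1 - (j.succ : ℕ) : ℕ) : ℝ) + 1 := by
      have := j.2
      rw [← Nat.cast_succ]
      congr 1
      simp
      omega
    have h9 := hδ j
    unfold stepError at h9
    have h10 : (((k + 1 - (j.succ : ℕ) : ℕ) : ℝ) + 1) * δ = ((k + 1 - (j.succ : ℕ) : ℕ) : ℝ) * δ + δ := by
      ring
    rw [h8, h10, add_comm]
    exact add_le_add ih h9

include hf in
theorem eLpNorm_sub_approx_le {δ : ℝ} (hδ : ∀ j, T.stepError hf j ≤ δ) :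
    eLpNorm (f - T.approx) 2 (prodMeasure Ω) ≤ ENNReal.ofReal ((k + 1 : ℕ) * δ) := by
  have h := T.norm_vec_sub_reconstr_le hf hδ 0
  have hm : MemLp (T.reconstr 0 0) 2 (tailMeasure Ω 0) := T.memLp_reconstr hf 0 0 Nat.one_pos
  have h1 : f - T.approx = (T.g 0 0 - T.reconstr 0 0) ∘ fullEquiv n := by
    ext x
    rw [Pi.sub_apply, approx_eq_reconstr, Function.comp_apply, Pi.sub_apply, T.g_zero]
    rfl
  rw [h1, eLpNorm_comp_measurePreserving ((T.memLp_g hf 0 0).1.sub hm.1)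
    (measurePreserving_fullEquiv Ω)]
  rw [norm_piLp_of_eq_one (q := extRank r 0) rfl _ ⟨0, Nat.one_pos⟩, PiLp.sub_apply, vec, vecLp_apply, vecLp_apply,
    ← MemLp.toLp_sub, Lp.norm_toLp] at h
  rw [← ENNReal.ofReal_toReal ((T.memLp_g hf 0 0).sub hm).2.ne]
  exact ENNReal.ofReal_le_ofReal (by simpa using h)

/-- Bound of the truncation error in step `J` by the error of an approximation of `f` in a space
`X 0` that is mapped to a space `X (J + 1)` of dimension at most `r J` by contractions. -/
theorem stepError_le (J : Fin (k + 1))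
    (X : (j : Fin (k + 2)) → Submodule ℝ (Lp ℝ 2 (tailMeasure Ω j)))
    (hX : ∀ j : Fin (k + 1), j ≤ J → ∀ h ∈ X j.castSucc, ∀ a, (tailTensor Ω j).op h a ∈ X j.succ)
    [FiniteDimensional ℝ (X J.succ)] (hr : Module.finrank ℝ (X J.succ) ≤ extRank r J.succ)
    (h : Lp ℝ 2 (tailMeasure Ω 0)) (hh : h ∈ X 0) :
    T.stepError hf J ≤ ‖(memLp_comp_fullEquiv_symm hf).toLp _ - h‖ := by
  -- The approximant h undergoes the same contractions with left singular functions as f. They do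
  -- not increase norms, so H approximates the function of step j as well as h approximates f.
  have key : ∀ j : Fin (k + 2), j ≤ J.castSucc →
      ∃ H : PiLp 2 fun _ : Fin (extRank r j) => Lp ℝ 2 (tailMeasure Ω j),
        (∀ i, H i ∈ X j) ∧
        ‖T.vec hf j - H‖ ≤ ‖(memLp_comp_fullEquiv_symm hf).toLp _ - h‖ := by
    intro j
    refine Fin.induction (fun _ => ?_) (fun j ih hj => ?_) j
    · refine ⟨WithLp.toLp 2 fun _ => h, fun _ => hh, ?_⟩
      rw [norm_piLp_of_eq_one (q := extRank r 0) rfl _ ⟨0, Nat.one_pos⟩, PiLp.sub_apply, vec, vecLp_apply]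
      refine le_of_eq ?_
      congr 2
      exact MemLp.toLp_congr _ _ (ae_of_all _ fun y => T.g_zero _ y)
    · have hj' : j ≤ J := by
        have := Fin.le_def.1 hj
        simp at this
        exact Fin.le_def.2 (by omega)
      obtain ⟨H, hH, hle⟩ := ih (Fin.castSucc_le_castSucc_iff.2 hj')
      refine ⟨WithLp.toLp 2 fun β => ((tailTensor Ω j).pi _).op H (T.left j β), fun β => ?_, ?_⟩
      · change ((tailTensor Ω j).pi _).op H (T.left j β) ∈ X j.succ
        rw [HilbertTensor.pi_op]
        exact Submodule.sum_mem _ fun i _ => hX j hj' _ (hH i) _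
      · refine (((tailTensor Ω j).pi _).norm_sub_op_le (T.svd hf j).left (extRank r j.succ)
          (T.vec hf j.castSucc) H _ _ (fun i => ?_) fun i => rfl).trans hle
        exact (T.vec_succ_apply hf j i).trans ((T.svd hf j).op_left i).symm
  obtain ⟨H, hH, hle⟩ := key J.castSucc le_rfl
  -- All contractions of H lie in a space of dimension at most the rank, so H is an admissible
  -- competitor for the truncated decomposition.
  have hop : ∀ a, ((tailTensor Ω J).pi _).op H a ∈ X J.succ := fun a => by
    rw [HilbertTensor.pi_op]
    exact Submodule.sum_mem _ fun i _ => hX J le_rfl _ (hH i) _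
  have h1 := (T.svd hf J).norm_sub_truncation_le (X J.succ) hr hop
  exact h1.trans hle

end TTDecomposition

end TT

/-! ### Polynomial approximation in Sobolev spaces -/

section Fourier

variable {d : ℕ}

theorem continuous_fourierInv_of_integrable {G : E d → ℂ} (hG : Integrable G) :
    Continuous (𝓕⁻ G) := by
  rw [Real.fourierInv_eq_fourier_comp_neg]
  exact VectorFourier.fourierIntegral_continuous Real.continuous_fourierChar
    (by exact continuous_inner) hG.comp_neg

/-- On integrable functions the inverse Fourier transform of `L²` is the usual integral. -/
theorem fourierInv_lp_ae_eq (G : Lp ℂ 2 (volume : Measure (E d))) (hG : Integrable G) :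
    (𝓕⁻ G : Lp ℂ 2 (volume : Measure (E d))) =ᵐ[volume] 𝓕⁻ (G : E d → ℂ) := by
  refine ae_eq_of_integral_contDiff_smul_eq ((Lp.memLp _).locallyIntegrable one_le_two)
    (continuous_fourierInv_of_integrable hG).locallyIntegrable fun g hg1 hg2 => ?_
  have hg2' : HasCompactSupport (Complex.ofRealCLM ∘ g) := hg2.comp_left (map_zero _)
  -- A real test function is regarded as a Schwartz function: the L² transform is moved onto it
  -- through tempered distributions, the integral transform through Fubini's theorem.
  let φ : SchwartzMap (E d) ℂ := hg2'.toSchwartzMap (Complex.ofRealCLM.contDiff.comp hg1)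
  have hφ : ∀ x, φ x = (g x : ℂ) := fun x => rfl
  have h1 : ∫ x, g x • (𝓕⁻ G : Lp ℂ 2 (volume : Measure (E d))) x =
      Lp.toTemperedDistribution (𝓕⁻ G : Lp ℂ 2 (volume : Measure (E d))) φ := by
    rw [Lp.toTemperedDistribution_apply]
    rfl
  have h2 : ∫ x, g x • (𝓕⁻ (G : E d → ℂ)) x = ∫ x, φ x • (𝓕⁻ (G : E d → ℂ)) x := rfl
  rw [h1, h2, ← Lp.fourierInv_toTemperedDistribution_eq,
    TemperedDistribution.fourierInv_apply, Lp.toTemperedDistribution_apply]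
  have hfl := VectorFourier.integral_fourierIntegral_smul_eq_flip (μ := volume) (ν := volume)
    (L := -innerₗ (E d)) (f := φ) (g := (G : E d → ℂ)) Real.continuous_fourierChar
    (by exact continuous_inner.neg) φ.integrable hG
  have e1 : ∀ f : E d → ℂ, ∀ x, VectorFourier.fourierIntegral Real.fourierChar volume
      (-innerₗ (E d)) f x = 𝓕⁻ f x := by
    intro f x
    rw [Real.fourierInv_eq, VectorFourier.fourierIntegral]
    simp
  have e2 : (-innerₗ (E d)).flip = -innerₗ (E d) := by
    ext x y
    simp [real_inner_comm]
  rw [e2] at hfl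
  simp only [e1] at hfl
  rw [SchwartzMap.fourierInv_coe]
  exact hfl

end Fourier

/-! ### Polynomials on bounded sets and Taylor polynomials of the exponential -/

section Poly

variable {d : ℕ}

/-- The monomial `x^γ`. -/
def monomialFun {D : ℕ} (γ : Fin d → Fin D) (x : E d) : ℝ := ∏ i, x i ^ (γ i : ℕ)

theorem continuous_monomialFun {D : ℕ} (γ : Fin d → Fin D) :
    Continuous (monomialFun γ) := by
  unfold monomialFun
  fun_prop

theorem memLp_of_continuous {Ω : Set (E d)} (hΩ : Bornology.IsBounded Ω) {p : E d → ℝ}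
    (hp : Continuous p) : MemLp p 2 (volume.restrict Ω) := by
  have hc := hΩ.isCompact_closure
  obtain ⟨C, hC⟩ := hc.exists_bound_of_continuousOn hp.continuousOn
  have : IsFiniteMeasure (volume.restrict (closure Ω)) :=
    ⟨by rw [Measure.restrict_apply_univ]; exact hc.measure_lt_top⟩
  have h : MemLp p 2 (volume.restrict (closure Ω)) :=
    MemLp.of_bound hp.aestronglyMeasurable C
      ((ae_restrict_iff' isClosed_closure.measurableSet).2 (ae_of_all _ hC))
  exact h.mono_measure (Measure.restrict_mono subset_closure le_rfl)

/-- The polynomials with degrees less than `D`, as functions on `Ω`. -/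
def polySpace {Ω : Set (E d)} (hΩ : Bornology.IsBounded Ω) (D : ℕ) :
    Submodule ℝ (Lp ℝ 2 (volume.restrict Ω)) :=
  Submodule.span ℝ (Set.range fun γ : Fin d → Fin D =>
    (memLp_of_continuous hΩ (continuous_monomialFun γ)).toLp (monomialFun γ))

instance {Ω : Set (E d)} (hΩ : Bornology.IsBounded Ω) (D : ℕ) :
    FiniteDimensional ℝ (polySpace hΩ D) :=
  FiniteDimensional.span_of_finite ℝ (Set.finite_range _)

theorem finrank_polySpace_le {Ω : Set (E d)} (hΩ : Bornology.IsBounded Ω) (D : ℕ) :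
    Module.finrank ℝ (polySpace hΩ D) ≤ D ^ d := by
  refine (finrank_range_le_card (R := ℝ) _).trans ?_
  simp

theorem toLp_mem_polySpace {Ω : Set (E d)} (hΩ : Bornology.IsBounded Ω) {D : ℕ} {p : E d → ℝ}
    (hp : p ∈ Submodule.span ℝ (Set.range fun γ : Fin d → Fin D => monomialFun γ))
    (hp2 : MemLp p 2 (volume.restrict Ω)) : hp2.toLp p ∈ polySpace hΩ D := by
  obtain ⟨c, hc⟩ := (Submodule.mem_span_range_iff_exists_fun ℝ).1 hp
  have h1 : hp2.toLp p = ∑ γ, c γ • (memLp_of_continuous hΩ (continuous_monomialFun γ)).toLp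
      (monomialFun γ) := by
    simp_rw [← MemLp.toLp_const_smul]
    rw [← toLp_finset_sum]
    refine MemLp.toLp_congr _ _ (ae_of_all _ fun x => ?_)
    rw [← hc]
    simp
  rw [h1]
  exact Submodule.sum_mem _ fun γ _ => Submodule.smul_mem _ _ (Submodule.subset_span ⟨γ, rfl⟩)

/-- Collecting equal coordinates gives a monomial whose exponents, the fibre sizes of g, are at most
l < D. -/
theorem prod_coord_mem_span {D l : ℕ} (hl : l < D) (g : Fin l → Fin d) :
    (fun x : E d => ∏ j, x (g j)) ∈
      Submodule.span ℝ (Set.range fun γ : Fin d → Fin D => monomialFun γ) := by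
  classical
  refine Submodule.subset_span ⟨fun i => ⟨(Finset.univ.filter fun j => g j = i).card, ?_⟩, ?_⟩
  · refine lt_of_le_of_lt (Finset.card_le_univ _) (by simpa using hl)
  · ext x
    simp only [monomialFun]
    rw [← Finset.prod_fiberwise_of_maps_to (s := Finset.univ) (t := Finset.univ)
      (g := g) (fun _ _ => Finset.mem_univ _)]
    refine Finset.prod_congr rfl fun i _ => ?_
    rw [Finset.prod_congr rfl fun j hj => by rw [(Finset.mem_filter.1 hj).2], Finset.prod_const]

/-- Integrals of Taylor polynomials of `exp (2πi ⟨ξ, x⟩)` are polynomials in `x`. -/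
theorem taylor_integral_mem_span {K : Set (E d)} (hK : IsCompact K) {F : E d → ℂ}
    (hF : IntegrableOn F K) (D : ℕ) :
    (fun x : E d => (∫ ξ in K, (∑ l ∈ Finset.range D,
      (2 * Real.pi * ⟪ξ, x⟫ * Complex.I : ℂ) ^ l / l.factorial) * F ξ).re) ∈
      Submodule.span ℝ (Set.range fun γ : Fin d → Fin D => monomialFun γ) := by
  have hint : ∀ l : ℕ, ∀ g : Fin l → Fin d, IntegrableOn (fun ξ : E d =>
      ((2 * Real.pi * Complex.I : ℂ) ^ l / l.factorial * ∏ j, ((ξ (g j) : ℝ) : ℂ)) * F ξ) K := by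
    intro l g
    refine hF.continuousOn_mul (Continuous.continuousOn ?_) hK
    fun_prop
  have hx : (fun x : E d => (∫ ξ in K, (∑ l ∈ Finset.range D,
      (2 * Real.pi * ⟪ξ, x⟫ * Complex.I : ℂ) ^ l / l.factorial) * F ξ).re) =
      ∑ l ∈ Finset.range D, ∑ g : Fin l → Fin d,
        (∫ ξ in K, ((2 * Real.pi * Complex.I : ℂ) ^ l / l.factorial *
          ∏ j, ((ξ (g j) : ℝ) : ℂ)) * F ξ).re • fun x : E d => ∏ j, x (g j) := by
    ext x
    have e1 : ∀ ξ : E d, (∑ l ∈ Finset.range D,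
        (2 * Real.pi * ⟪ξ, x⟫ * Complex.I : ℂ) ^ l / l.factorial) * F ξ =
        ∑ l ∈ Finset.range D, ∑ g : Fin l → Fin d, ((∏ j, x (g j) : ℝ) : ℂ) *
          (((2 * Real.pi * Complex.I : ℂ) ^ l / l.factorial *
            ∏ j, ((ξ (g j) : ℝ) : ℂ)) * F ξ) := by
      intro ξ
      rw [Finset.sum_mul]
      refine Finset.sum_congr rfl fun l _ => ?_
      -- Expanding the power over all maps g separates the variables ξ and x, so that the integral
      -- over ξ only produces coefficients.
      have e2 : ((⟪ξ, x⟫ : ℝ) : ℂ) ^ l = ∑ g : Fin l → Fin d,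
          (∏ j, ((ξ (g j) : ℝ) : ℂ)) * ((∏ j, x (g j) : ℝ) : ℂ) := by
        have : ((⟪ξ, x⟫ : ℝ) : ℂ) = ∑ i, ((ξ i : ℝ) : ℂ) * ((x i : ℝ) : ℂ) := by
          rw [PiLp.inner_apply]
          push_cast
          refine Finset.sum_congr rfl fun i _ => ?_
          simp [mul_comm]
        rw [this, Fintype.sum_pow]
        refine Finset.sum_congr rfl fun g _ => ?_
        rw [Finset.prod_mul_distrib]
        push_cast
        rfl
      rw [show (2 * Real.pi * ((⟪ξ, x⟫ : ℝ) : ℂ) * Complex.I : ℂ) =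
        (2 * Real.pi * Complex.I) * ((⟪ξ, x⟫ : ℝ) : ℂ) by ring, mul_pow, e2, Finset.mul_sum,
        Finset.sum_div, Finset.sum_mul]
      exact Finset.sum_congr rfl fun g _ => by ring
    simp_rw [e1]
    rw [integral_finsetSum _ fun l _ => integrable_finsetSum _ fun g _ =>
      (hint l g).const_mul _, Complex.re_sum, Finset.sum_apply]
    refine Finset.sum_congr rfl fun l _ => ?_
    rw [integral_finsetSum _ fun g _ => (hint l g).const_mul _, Complex.re_sum, Finset.sum_apply]
    refine Finset.sum_congr rfl fun g _ => ?_
    rw [integral_const_mul, Complex.re_ofReal_mul, Pi.smul_apply, smul_eq_mul, mul_comm]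
  rw [hx]
  exact Submodule.sum_mem _ fun l hl => Submodule.sum_mem _ fun g _ =>
    Submodule.smul_mem _ _ (prod_coord_mem_span (Finset.mem_range.1 hl) g)

/-- The Taylor remainder is at most 2‖z‖^D / D!, and D^D / D! ≤ e^D. One factor e^{-D} coming from
e^{-2D} absorbs this, the other one remains. -/
theorem norm_exp_sub_taylor_le {z : ℂ} {D : ℕ} (hz : ‖z‖ ≤ Real.exp (-2) * D) :
    ‖Complex.exp z - ∑ l ∈ Finset.range D, z ^ l / l.factorial‖ ≤ 2 * Real.exp (-D) := by
  have he : Real.exp (-2) ≤ 1 / 2 := by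
    have h1 := Real.add_one_le_exp (2 : ℝ)
    rw [Real.exp_neg, inv_le_comm₀ (Real.exp_pos _) (by norm_num)]
    linarith
  have hD : (0 : ℝ) ≤ D := Nat.cast_nonneg D
  have h1 : ‖z‖ / (D.succ : ℝ) ≤ 1 / 2 := by
    rw [div_le_iff₀ (by positivity)]
    push_cast
    nlinarith
  refine (Complex.exp_bound' h1).trans ?_
  have h2 : ‖z‖ ^ D / D.factorial ≤ Real.exp (-D) := by
    calc ‖z‖ ^ D / D.factorial ≤ (Real.exp (-2) * D) ^ D / D.factorial := by gcongr
      _ = Real.exp (-2) ^ D * ((D : ℝ) ^ D / D.factorial) := by rw [mul_pow]; ring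
      _ ≤ Real.exp (-2) ^ D * Real.exp D := by
          gcongr
          exact Real.pow_div_factorial_le_exp _ hD D
      _ = Real.exp (-D) := by
          rw [← Real.exp_nat_mul, ← Real.exp_add]
          congr 1
          ring
  linarith

end Poly

/-! ### Rate of polynomial approximation from a frequency cut-off -/

section Sobolev

variable {d : ℕ}

/-- The Fourier transform of a real valued function. -/
abbrev realFourier (U : Lp ℝ 2 (volume : Measure (E d))) : Lp ℂ 2 (volume : Measure (E d)) :=
  𝓕 (Complex.ofRealCLM.compLp U)

theorem sobolevENormRn_eq_eLpNorm (s : ℝ) (U : Lp ℝ 2 (volume : Measure (E d))) :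
    sobolevENormRn s U =
      eLpNorm (fun ξ => ((1 + ‖ξ‖ ^ 2) ^ (s / 2) : ℝ) • realFourier U ξ) 2 volume := by
  rw [sobolevENormRn, eLpNorm_eq_lintegral_rpow_enorm_toReal two_ne_zero ENNReal.ofNat_ne_top]
  simp only [ENNReal.toReal_ofNat]
  congr 1
  refine lintegral_congr fun ξ => ?_
  have h1 : (0 : ℝ) ≤ 1 + ‖ξ‖ ^ 2 := by positivity
  rw [enorm_smul, ENNReal.mul_rpow_of_nonneg _ _ (by norm_num), Real.enorm_of_nonneg (by positivity),
    ENNReal.ofReal_rpow_of_nonneg (by positivity) (by norm_num), ← Real.rpow_mul h1]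
  norm_num

theorem aestronglyMeasurable_weight_smul (s : ℝ) (G : Lp ℂ 2 (volume : Measure (E d))) :
    AEStronglyMeasurable (fun ξ => ((1 + ‖ξ‖ ^ 2) ^ (s / 2) : ℝ) • G ξ) volume := by
  have h : Continuous fun ξ : E d => (1 + ‖ξ‖ ^ 2) ^ (s / 2) :=
    Continuous.rpow_const (by fun_prop) fun ξ => Or.inl (by positivity)
  exact h.aestronglyMeasurable.smul (Lp.aestronglyMeasurable G)

/-- The high frequencies of a function in `H^s`. -/
theorem eLpNorm_indicator_compl_le {s R : ℝ} (hs : 0 ≤ s) (hR : 0 ≤ R)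
    (U : Lp ℝ 2 (volume : Measure (E d))) :
    eLpNorm ((Metric.closedBall 0 R)ᶜ.indicator (realFourier U)) 2 volume ≤
      ENNReal.ofReal ((1 + R ^ 2) ^ (-(s / 2))) * sobolevENormRn s U := by
  rw [sobolevENormRn_eq_eLpNorm]
  refine eLpNorm_le_mul_eLpNorm_of_ae_le_mul (ae_of_all _ fun ξ => ?_) 2
  have h0 : (0 : ℝ) < 1 + R ^ 2 := by positivity
  by_cases hξ : ξ ∈ (Metric.closedBall (0 : E d) R)ᶜ
  · rw [Set.indicator_of_mem hξ, norm_smul, Real.norm_of_nonneg (by positivity), ← mul_assoc]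
    refine le_mul_of_one_le_left (norm_nonneg _) ?_
    have h1 : R < ‖ξ‖ := by simpa using hξ
    rw [Real.rpow_neg h0.le, ← div_eq_inv_mul, le_div_iff₀ (by positivity), one_mul]
    refine Real.rpow_le_rpow h0.le ?_ (by positivity)
    gcongr
  · rw [Set.indicator_of_notMem hξ, norm_zero]
    positivity

theorem eLpNorm_realFourier_le {s : ℝ} (hs : 0 ≤ s) (U : Lp ℝ 2 (volume : Measure (E d))) :
    eLpNorm (realFourier U) 2 volume ≤ sobolevENormRn s U := by
  rw [sobolevENormRn_eq_eLpNorm]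
  refine eLpNorm_mono fun ξ => ?_
  rw [norm_smul, Real.norm_of_nonneg (by positivity)]
  refine le_mul_of_one_le_left (norm_nonneg _) (Real.one_le_rpow ?_ (by positivity))
  nlinarith [sq_nonneg ‖ξ‖]

theorem integrableOn_closedBall (R : ℝ) (F : Lp ℂ 2 (volume : Measure (E d))) :
    IntegrableOn F (Metric.closedBall 0 R) volume := by
  have : IsFiniteMeasure (volume.restrict (Metric.closedBall (0 : E d) R)) :=
    ⟨by rw [Measure.restrict_apply_univ]; exact measure_closedBall_lt_top⟩
  exact ((Lp.memLp F).restrict _).integrable one_le_two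

theorem integral_norm_closedBall_le (R : ℝ) (F : Lp ℂ 2 (volume : Measure (E d))) :
    ∫ ξ in Metric.closedBall 0 R, ‖F ξ‖ ≤
      √(volume (Metric.closedBall (0 : E d) R)).toReal * ‖F‖ := by
  have hfin : volume (Metric.closedBall (0 : E d) R) ≠ ∞ := measure_closedBall_lt_top.ne
  have h1 := eLpNorm_le_eLpNorm_mul_rpow_measure_univ (p := 1) (q := 2) one_le_two
    ((Lp.aestronglyMeasurable F).restrict (s := Metric.closedBall (0 : E d) R))
  rw [Measure.restrict_apply_univ] at h1
  have h2 : eLpNorm F 2 (volume.restrict (Metric.closedBall (0 : E d) R)) ≤ eLpNorm F 2 volume :=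
    eLpNorm_mono_measure _ Measure.restrict_le_self
  have h3 := h1.trans (mul_le_mul_left h2 _)
  rw [integral_norm_eq_lintegral_enorm (Lp.aestronglyMeasurable F).restrict,
    ← eLpNorm_one_eq_lintegral_enorm]
  refine (ENNReal.toReal_mono (ENNReal.mul_ne_top (Lp.eLpNorm_ne_top F)
    (ENNReal.rpow_ne_top_of_nonneg (by norm_num) hfin)) h3).trans (le_of_eq ?_)
  rw [ENNReal.toReal_mul, ← ENNReal.toReal_rpow, ← Lp.norm_def, mul_comm, Real.sqrt_eq_rpow]
  norm_num

/-- Low frequencies are approximated by polynomials uniformly on bounded sets. -/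
theorem norm_fourierInv_sub_taylor_le {D : ℕ} {R ρ : ℝ} (hR : 0 ≤ R)
    (hRρ : 2 * Real.pi * R * ρ ≤ Real.exp (-2) * D) (F : Lp ℂ 2 (volume : Measure (E d)))
    {x : E d} (hx : ‖x‖ ≤ ρ) :
    ‖𝓕⁻ ((Metric.closedBall 0 R).indicator F) x -
      ∫ ξ in Metric.closedBall 0 R, (∑ l ∈ Finset.range D,
        (2 * Real.pi * ⟪ξ, x⟫ * Complex.I : ℂ) ^ l / l.factorial) * F ξ‖ ≤
      2 * Real.exp (-D) * (√(volume (Metric.closedBall (0 : E d) R)).toReal * ‖F‖) := by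
  set K := Metric.closedBall (0 : E d) R
  have hK : IsCompact K := isCompact_closedBall 0 R
  have hF := integrableOn_closedBall R F
  have e1 : 𝓕⁻ (K.indicator F) x =
      ∫ ξ in K, Complex.exp (2 * Real.pi * ⟪ξ, x⟫ * Complex.I) * F ξ := by
    rw [Real.fourierInv_eq', ← integral_indicator Metric.isClosed_closedBall.measurableSet]
    refine integral_congr_ae (ae_of_all _ fun ξ => ?_)
    by_cases hξ : ξ ∈ K
    · simp [K, Set.indicator_of_mem, hξ]
    · simp [K, Set.indicator_of_notMem, hξ]
  have hi1 : IntegrableOn (fun ξ => Complex.exp (2 * Real.pi * ⟪ξ, x⟫ * Complex.I) * F ξ) K :=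
    hF.continuousOn_mul (Continuous.continuousOn (by fun_prop)) hK
  have hi2 : IntegrableOn (fun ξ => (∑ l ∈ Finset.range D,
        (2 * Real.pi * ⟪ξ, x⟫ * Complex.I : ℂ) ^ l / l.factorial) * F ξ) K :=
    hF.continuousOn_mul (Continuous.continuousOn (by fun_prop)) hK
  rw [e1, ← integral_sub hi1 hi2]
  calc _ ≤ ∫ ξ in K, 2 * Real.exp (-D) * ‖F ξ‖ := by
        refine norm_integral_le_of_norm_le (hF.norm.const_mul _) ?_
        refine (ae_restrict_iff' Metric.isClosed_closedBall.measurableSet).2 (ae_of_all _ ?_)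
        intro ξ hξ
        rw [← sub_mul, norm_mul]
        refine mul_le_mul_of_nonneg_right (norm_exp_sub_taylor_le ?_) (norm_nonneg _)
        have h1 : ‖ξ‖ ≤ R := by simpa using hξ
        have h2 : |⟪ξ, x⟫| ≤ R * ρ := (abs_real_inner_le_norm ξ x).trans
          (mul_le_mul h1 hx (norm_nonneg _) hR)
        have h3 : ‖(2 * Real.pi * ⟪ξ, x⟫ * Complex.I : ℂ)‖ = 2 * Real.pi * |⟪ξ, x⟫| := by
          simp [abs_of_pos Real.pi_pos]
        rw [h3]
        refine le_trans ?_ hRρ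
        nlinarith [Real.pi_pos, mul_le_mul_of_nonneg_left h2 (by positivity : 0 ≤ 2 * Real.pi)]
    _ = 2 * Real.exp (-D) * ∫ ξ in K, ‖F ξ‖ := integral_const_mul _ _
    _ ≤ _ := by
        gcongr
        exact integral_norm_closedBall_le R F

theorem fourierInv_congr_ae {F G : E d → ℂ} (h : F =ᵐ[volume] G) (x : E d) :
    𝓕⁻ F x = 𝓕⁻ G x := by
  rw [Real.fourierInv_eq, Real.fourierInv_eq]
  refine integral_congr_ae ?_
  filter_upwards [h] with ξ hξ
  rw [hξ]

theorem continuous_of_mem_span_monomialFun {D : ℕ} {p : E d → ℝ}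
    (hp : p ∈ Submodule.span ℝ (Set.range fun γ : Fin d → Fin D => monomialFun γ)) :
    Continuous p := by
  obtain ⟨c, rfl⟩ := (Submodule.mem_span_range_iff_exists_fun ℝ).1 hp
  have h : Continuous fun x => ∑ γ, (c γ • monomialFun γ) x :=
    continuous_finsetSum _ fun γ _ => (continuous_monomialFun γ).const_smul (c γ)
  exact h.congr fun x => (Finset.sum_apply x _ _).symm

/-- Approximation by polynomials of degree less than `D`, where the frequencies are cut at `R`. -/
theorem exists_poly_approx_of_cutoff {Ω : Set (E d)} (hΩo : IsOpen Ω)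
    (hΩ : Bornology.IsBounded Ω) {s R ρ : ℝ} (hs : 0 ≤ s) (hR : 0 ≤ R) {D : ℕ}
    (hρ : ∀ x ∈ Ω, ‖x‖ ≤ ρ) (hRρ : 2 * Real.pi * R * ρ ≤ Real.exp (-2) * D)
    (U : Lp ℝ 2 (volume : Measure (E d))) (hU : sobolevENormRn s U ≠ ∞) :
    ∃ q ∈ polySpace hΩ D, ‖((Lp.memLp U).restrict Ω).toLp U - q‖ ≤
      ((1 + R ^ 2) ^ (-(s / 2)) + 2 * Real.exp (-D) *
        √(volume (Metric.closedBall (0 : E d) R)).toReal * √(volume Ω).toReal) *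
          (sobolevENormRn s U).toReal := by
  set F := realFourier U with hF
  set K := Metric.closedBall (0 : E d) R with hKdef
  set N := (sobolevENormRn s U).toReal
  have hN : 0 ≤ N := ENNReal.toReal_nonneg
  have hK : IsCompact K := isCompact_closedBall 0 R
  have hKm : MeasurableSet K := Metric.isClosed_closedBall.measurableSet
  have hvol : volume Ω ≠ ∞ := hΩ.measure_lt_top.ne
  have hlow := (Lp.memLp F).indicator hKm
  have hhigh := (Lp.memLp F).indicator hKm.compl
  set L : Lp ℂ 2 (volume : Measure (E d)) := hlow.toLp _
  set H : Lp ℂ 2 (volume : Measure (E d)) := hhigh.toLp _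
  have hFLH : F = L + H := by
    rw [← MemLp.toLp_add]
    refine Lp.ext ?_
    filter_upwards [(hlow.add hhigh).coeFn_toLp] with ξ hξ
    rw [hξ, Set.indicator_self_add_compl]
  have hFN : ‖F‖ ≤ N := ENNReal.toReal_mono hU (eLpNorm_realFourier_le hs U)
  have hHN : ‖𝓕⁻ H‖ ≤ (1 + R ^ 2) ^ (-(s / 2)) * N := by
    have h1 : ‖𝓕⁻ H‖ = ‖H‖ := by
      rw [← Lp.norm_fourier_eq (𝓕⁻ H), FourierTransform.fourier_fourierInv_eq]
    rw [h1, Lp.norm_toLp]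
    refine (ENNReal.toReal_mono (ENNReal.mul_ne_top ENNReal.ofReal_ne_top hU)
      (eLpNorm_indicator_compl_le hs hR U)).trans (le_of_eq ?_)
    rw [ENNReal.toReal_mul, ENNReal.toReal_ofReal (by positivity)]
  -- The exponential in the inverse transform of the low frequencies is replaced by its Taylor
  -- polynomial; as U is real, the real part suffices.
  set p : E d → ℝ := fun x => (∫ ξ in K, (∑ l ∈ Finset.range D,
      (2 * Real.pi * ⟪ξ, x⟫ * Complex.I : ℂ) ^ l / l.factorial) * F ξ).re with hp
  have hpspan := taylor_integral_mem_span hK (integrableOn_closedBall R F) D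
  have hpm : MemLp p 2 (volume.restrict Ω) :=
    memLp_of_continuous hΩ (continuous_of_mem_span_monomialFun hpspan)
  refine ⟨hpm.toLp p, toLp_mem_polySpace hΩ hpspan hpm, ?_⟩
  set δ := 2 * Real.exp (-D) * (√(volume K).toReal * ‖F‖) with hδ
  have hδ0 : 0 ≤ δ := by positivity
  have hLint : Integrable L := by
    refine (Integrable.congr ?_ hlow.coeFn_toLp.symm)
    exact (integrable_indicator_iff hKm).2 (integrableOn_closedBall R F)
  -- The low frequencies are approximated uniformly, with error δ; the high frequencies enter as an
  -- L² function.
  have hpt : ∀ᵐ x ∂volume.restrict Ω, ‖U x - p x‖ ≤ ‖(𝓕⁻ H : Lp ℂ 2 volume) x‖ + δ := by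
    have e1 : ∀ᵐ x ∂(volume : Measure (E d)), ((U x : ℝ) : ℂ) =
        𝓕⁻ (K.indicator F) x + (𝓕⁻ H : Lp ℂ 2 volume) x := by
      have e2 : Complex.ofRealCLM.compLp U = 𝓕⁻ L + 𝓕⁻ H := by
        rw [← FourierTransform.fourierInv_add, ← hFLH, hF,
          FourierTransform.fourierInv_fourier_eq]
      have e3 := Complex.ofRealCLM.coeFn_compLp U
      rw [e2] at e3
      filter_upwards [e3, Lp.coeFn_add (𝓕⁻ L) (𝓕⁻ H), fourierInv_lp_ae_eq L hLint] with x h1 h2 h3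
      rw [h2, Pi.add_apply, h3, fourierInv_congr_ae hlow.coeFn_toLp] at h1
      exact h1.symm
    filter_upwards [ae_restrict_of_ae e1, ae_restrict_mem hΩo.measurableSet] with x hx hxΩ
    have h4 := norm_fourierInv_sub_taylor_le hR hRρ F (hρ x hxΩ)
    have h5 : U x - p x = (((𝓕⁻ (K.indicator F) x - ∫ ξ in K, (∑ l ∈ Finset.range D,
        (2 * Real.pi * ⟪ξ, x⟫ * Complex.I : ℂ) ^ l / l.factorial) * F ξ)) +
        (𝓕⁻ H : Lp ℂ 2 volume) x).re := by
      have h6 : U x = (𝓕⁻ (K.indicator F) x + (𝓕⁻ H : Lp ℂ 2 volume) x).re := by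
        rw [← hx, Complex.ofReal_re]
      rw [h6, hp]
      simp only [Complex.add_re, Complex.sub_re]
      ring
    rw [h5, Real.norm_eq_abs]
    refine (Complex.abs_re_le_norm _).trans ((norm_add_le _ _).trans ?_)
    rw [add_comm]
    gcongr
  rw [← MemLp.toLp_sub, Lp.norm_toLp]
  have hfin : IsFiniteMeasure (volume.restrict Ω) :=
    ⟨by rw [Measure.restrict_apply_univ]; exact hΩ.measure_lt_top⟩
  have hH2 : MemLp (fun x => ‖(𝓕⁻ H : Lp ℂ 2 volume) x‖) 2 (volume.restrict Ω) :=
    ((Lp.memLp (𝓕⁻ H)).restrict Ω).norm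
  have hle : eLpNorm (⇑U - p) 2 (volume.restrict Ω) ≤
      eLpNorm (𝓕⁻ H : Lp ℂ 2 volume) 2 volume +
        ENNReal.ofReal δ * volume Ω ^ (1 / 2 : ℝ) := by
    calc _ ≤ eLpNorm ((fun x => ‖(𝓕⁻ H : Lp ℂ 2 volume) x‖) + fun _ => δ) 2 (volume.restrict Ω) := by
          refine eLpNorm_mono_ae ?_
          filter_upwards [hpt] with x hx
          refine hx.trans (le_abs_self _)
      _ ≤ _ := eLpNorm_add_le hH2.1 aestronglyMeasurable_const one_le_two
      _ ≤ _ := by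
          refine add_le_add ?_ (le_of_eq ?_)
          · rw [eLpNorm_norm]
            exact eLpNorm_mono_measure _ Measure.restrict_le_self
          · rw [eLpNorm_const' _ two_ne_zero ENNReal.ofNat_ne_top, Measure.restrict_apply_univ,
              Real.enorm_of_nonneg hδ0]
            norm_num
  have h7 := ENNReal.toReal_mono (ENNReal.add_ne_top.2 ⟨Lp.eLpNorm_ne_top _,
    ENNReal.mul_ne_top ENNReal.ofReal_ne_top (ENNReal.rpow_ne_top_of_nonneg (by norm_num) hvol)⟩) hle
  rw [ENNReal.toReal_add (Lp.eLpNorm_ne_top _) (ENNReal.mul_ne_top ENNReal.ofReal_ne_top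
    (ENNReal.rpow_ne_top_of_nonneg (by norm_num) hvol)), ENNReal.toReal_mul,
    ENNReal.toReal_ofReal hδ0, ← ENNReal.toReal_rpow, ← Lp.norm_def, ← Real.sqrt_eq_rpow] at h7
  refine h7.trans ?_
  rw [add_mul]
  refine add_le_add hHN ?_
  calc δ * √(volume Ω).toReal = 2 * Real.exp (-D) * √(volume K).toReal * √(volume Ω).toReal * ‖F‖ := by
        rw [hδ]; ring
    _ ≤ _ := by gcongr

/-- The cut-off is R = κ D, proportional to the degree: the high frequencies then contribute
O(D^{-s}), while the Taylor error, e^{-D} times a power of D, is negligible. Writing D + 1 includes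
the zero space D = 0. No regularity of the boundary is needed, as the functions are restrictions
from the whole space. -/
theorem exists_poly_approx {Ω : Set (E d)} (hΩo : IsOpen Ω) (hΩ : Bornology.IsBounded Ω)
    {s : ℝ} (hs : 0 ≤ s) : ∃ C : ℝ, 0 ≤ C ∧ ∀ (D : ℕ) (U : Lp ℝ 2 (volume : Measure (E d))),
      sobolevENormRn s U ≠ ∞ → ∃ q ∈ polySpace hΩ D,
        ‖((Lp.memLp U).restrict Ω).toLp U - q‖ ≤
          C * ((D : ℝ) + 1) ^ (-s) * (sobolevENormRn s U).toReal := by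
  obtain ⟨ρ, hρ0, hρ⟩ : ∃ ρ : ℝ, 0 < ρ ∧ ∀ x ∈ Ω, ‖x‖ ≤ ρ := hΩ.exists_pos_norm_le
  -- This makes 2π R ρ = e^{-2} D, the limit allowed by the Taylor estimate.
  set κ := Real.exp (-2) / (2 * Real.pi * ρ) with hκ
  have hκ0 : 0 < κ := by positivity
  -- Chosen so that c (D + 1)² ≤ 1 + (κ D)².
  set c := min 1 (κ ^ 2) / 2 with hc
  have hc0 : 0 < c := by positivity
  -- With this integer M ≥ s + d, the bound (D + 1)^M ≤ M! e^{D+1} shows that e^{-D} (D + 1)^d is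
  -- O((D + 1)^{-s}).
  set M := ⌈s⌉₊ + d with hM
  set v := (volume (Metric.ball (0 : E d) 1)).toReal
  set C₂ := 2 * (M.factorial * Real.exp 1) * √(κ ^ d * v) * √(volume Ω).toReal with hC₂
  refine ⟨c ^ (-(s / 2)) + C₂, by positivity, fun D U hU => ?_⟩
  have hD : (0 : ℝ) ≤ D := Nat.cast_nonneg D
  have hRρ : 2 * Real.pi * (κ * D) * ρ ≤ Real.exp (-2) * D := by
    rw [hκ]
    refine le_of_eq ?_
    field_simp
  obtain ⟨q, hq, hle⟩ := exists_poly_approx_of_cutoff hΩo hΩ hs (by positivity : 0 ≤ κ * D) hρ hRρ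
    U hU
  refine ⟨q, hq, hle.trans (mul_le_mul_of_nonneg_right ?_ ENNReal.toReal_nonneg)⟩
  rw [add_mul]
  refine add_le_add ?_ ?_
  · have h1 : c * ((D : ℝ) + 1) ^ 2 ≤ 1 + (κ * D) ^ 2 := by
      have h2 : min 1 (κ ^ 2) ≤ 1 := min_le_left _ _
      have h3 : min 1 (κ ^ 2) ≤ κ ^ 2 := min_le_right _ _
      have h4 : ((D : ℝ) + 1) ^ 2 ≤ 2 * (1 + D ^ 2) := by nlinarith [sq_nonneg ((D : ℝ) - 1)]
      calc c * ((D : ℝ) + 1) ^ 2 ≤ c * (2 * (1 + D ^ 2)) := by gcongr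
        _ = min 1 (κ ^ 2) + min 1 (κ ^ 2) * D ^ 2 := by rw [hc]; ring
        _ ≤ 1 + κ ^ 2 * D ^ 2 := by gcongr
        _ = _ := by ring
    calc (1 + (κ * D) ^ 2) ^ (-(s / 2)) ≤ (c * ((D : ℝ) + 1) ^ 2) ^ (-(s / 2)) :=
          Real.rpow_le_rpow_of_nonpos (by positivity) h1 (by linarith)
      _ = c ^ (-(s / 2)) * ((D : ℝ) + 1) ^ (-s) := by
          rw [Real.mul_rpow hc0.le (by positivity), ← Real.rpow_natCast ((D : ℝ) + 1) 2,
            ← Real.rpow_mul (by positivity)]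
          congr 2
          push_cast
          ring
  · have hvol : (volume (Metric.closedBall (0 : E d) (κ * D))).toReal = (κ * D) ^ d * v := by
      rw [Measure.addHaar_closedBall _ _ (by positivity), ENNReal.toReal_mul,
        ENNReal.toReal_ofReal (by positivity), finrank_euclideanSpace_fin]
    have h1 : √((κ * D) ^ d * v) ≤ √(κ ^ d * v) * ((D : ℝ) + 1) ^ d := by
      rw [← Real.sqrt_sq (by positivity : (0 : ℝ) ≤ ((D : ℝ) + 1) ^ d),
        ← Real.sqrt_mul (by positivity)]
      refine Real.sqrt_le_sqrt ?_
      have h2 : (D : ℝ) ^ d ≤ (((D : ℝ) + 1) ^ d) ^ 2 := by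
        calc (D : ℝ) ^ d ≤ ((D : ℝ) + 1) ^ d := by gcongr; linarith
          _ ≤ _ := le_self_pow₀ (one_le_pow₀ (by linarith)) two_ne_zero
      calc (κ * D) ^ d * v = κ ^ d * v * (D : ℝ) ^ d := by rw [mul_pow]; ring
        _ ≤ _ := by gcongr
    have h3 : Real.exp (-D) * ((D : ℝ) + 1) ^ d ≤
        M.factorial * Real.exp 1 * ((D : ℝ) + 1) ^ (-s) := by
      have h4 := Real.pow_div_factorial_le_exp ((D : ℝ) + 1) (by positivity) M
      rw [div_le_iff₀ (by positivity), Real.exp_add] at h4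
      have h5 : ((D : ℝ) + 1) ^ d ≤ ((D : ℝ) + 1) ^ M * ((D : ℝ) + 1) ^ (-s) := by
        rw [hM, pow_add, mul_comm (((D : ℝ) + 1) ^ ⌈s⌉₊), mul_assoc]
        refine le_mul_of_one_le_right (by positivity) ?_
        rw [← Real.rpow_natCast, ← Real.rpow_add (by positivity)]
        exact Real.one_le_rpow (by linarith) (by linarith [Nat.le_ceil s])
      calc _ ≤ Real.exp (-D) * ((Real.exp D * Real.exp 1 * M.factorial) *
            ((D : ℝ) + 1) ^ (-s)) := by
            refine mul_le_mul_of_nonneg_left (h5.trans ?_) (Real.exp_pos _).le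
            exact mul_le_mul_of_nonneg_right h4 (by positivity)
        _ = (Real.exp (-D) * Real.exp D) * (M.factorial * Real.exp 1 * ((D : ℝ) + 1) ^ (-s)) := by
            ring
        _ = _ := by rw [← Real.exp_add, neg_add_cancel, Real.exp_zero, one_mul]
    rw [hvol]
    calc _ ≤ 2 * Real.exp (-D) * (√(κ ^ d * v) * ((D : ℝ) + 1) ^ d) * √(volume Ω).toReal := by gcongr
      _ = 2 * √(κ ^ d * v) * √(volume Ω).toReal * (Real.exp (-D) * ((D : ℝ) + 1) ^ d) := by ring
      _ ≤ 2 * √(κ ^ d * v) * √(volume Ω).toReal *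
          (M.factorial * Real.exp 1 * ((D : ℝ) + 1) ^ (-s)) := by gcongr
      _ = _ := by rw [hC₂]; ring

end Sobolev

/-! ### Sobolev spaces on domains as spaces with a scalar product -/

section Polarization

/-- A seminorm that satisfies the parallelogram inequality comes from a bilinear form. -/
theorem exists_bilinForm_of_parallelogram {V : Type*} [AddCommGroup V] [Module ℝ V]
    (q : Seminorm ℝ V)
    (h : ∀ x y, q (x + y) ^ 2 + q (x - y) ^ 2 ≤ 2 * (q x ^ 2 + q y ^ 2)) :
    ∃ B : V →ₗ[ℝ] V →ₗ[ℝ] ℝ, ∀ x y, B x y = (q (x + y) ^ 2 - q (x - y) ^ 2) / 4 := by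
  have h' : ∀ x y, q (x + y) ^ 2 + q (x - y) ^ 2 = 2 * (q x ^ 2 + q y ^ 2) := by
    intro x y
    refine le_antisymm (h x y) ?_
    -- The reverse inequality is the given one for x + y and x - y.
    have h1 := h (x + y) (x - y)
    have e1 : x + y + (x - y) = (2 : ℝ) • x := by rw [two_smul]; abel
    have e2 : x + y - (x - y) = (2 : ℝ) • y := by rw [two_smul]; abel
    rw [e1, e2, map_smul_eq_mul, map_smul_eq_mul, Real.norm_of_nonneg zero_le_two] at h1
    nlinarith
  let _ : SeminormedAddCommGroup V := q.toAddGroupSeminorm.toSeminormedAddCommGroup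
  let _ : NormedSpace ℝ V := ⟨fun a b => (map_smul_eq_mul q a b).le⟩
  -- The seminorm may have a kernel (functions vanishing almost everywhere on Ω), so the Jordan-von
  -- Neumann theorem is applied to the quotient by it.
  let _ : InnerProductSpace ℝ (SeparationQuotient V) := InnerProductSpace.ofNorm ℝ (by
    intro x y
    obtain ⟨x, rfl⟩ := SeparationQuotient.surjective_mk x
    obtain ⟨y, rfl⟩ := SeparationQuotient.surjective_mk y
    rw [← SeparationQuotient.mk_add, ← SeparationQuotient.mk_sub]
    simp only [SeparationQuotient.norm_mk, ← sq]
    exact h' x y)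
  let π : V →ₗ[ℝ] SeparationQuotient V := (SeparationQuotient.mkCLM ℝ V).toLinearMap
  refine ⟨(innerₗ (SeparationQuotient V)).compl₁₂ π π, fun x y => ?_⟩
  rw [LinearMap.compl₁₂_apply, innerₗ_apply_apply,
    ← RCLike.re_to_real (x := ⟪π x, π y⟫),
    re_inner_eq_norm_add_mul_self_sub_norm_sub_mul_self_div_four, ← map_add, ← map_sub]
  simp only [← sq]
  rfl

end Polarization

section Domain

variable {d : ℕ} {s : ℝ} {Ω : Set (E d)}

/-- The norm of `H^s(ℝⁿ)` comes from a linear map into a Hilbert space. -/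
theorem exists_sobolevENormRn_eq {U V : Lp ℝ 2 (volume : Measure (E d))}
    (hU : sobolevENormRn s U ≠ ∞) (hV : sobolevENormRn s V ≠ ∞) :
    ∃ a b : Lp ℂ 2 (volume : Measure (E d)),
      ∀ c c' : ℝ, sobolevENormRn s (c • U + c' • V) = ‖c • a + c' • b‖ₑ := by
  have hm : ∀ {W : Lp ℝ 2 (volume : Measure (E d))}, sobolevENormRn s W ≠ ∞ →
      MemLp (fun ξ => ((1 + ‖ξ‖ ^ 2) ^ (s / 2) : ℝ) • realFourier W ξ) 2 volume := by
    intro W hW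
    refine ⟨aestronglyMeasurable_weight_smul s _, ?_⟩
    rw [← sobolevENormRn_eq_eLpNorm]
    exact hW.lt_top
  refine ⟨(hm hU).toLp _, (hm hV).toLp _, fun c c' => ?_⟩
  rw [sobolevENormRn_eq_eLpNorm, Lp.enorm_def]
  refine eLpNorm_congr_ae ?_
  have e : realFourier (c • U + c' • V) = c • realFourier U + c' • realFourier V := by
    have e1 : Complex.ofRealCLM.compLp (c • U + c' • V) =
        c • Complex.ofRealCLM.compLp U + c' • Complex.ofRealCLM.compLp V := by
      change Complex.ofRealCLM.compLpₗ 2 volume (c • U + c' • V) = _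
      rw [map_add, map_smul, map_smul]
      rfl
    rw [realFourier, e1, FourierTransform.fourier_add]
    simp only [← algebraMap_smul ℂ c, ← algebraMap_smul ℂ c', FourierTransform.fourier_smul]
  rw [e]
  filter_upwards [Lp.coeFn_add (c • realFourier U) (c' • realFourier V),
    Lp.coeFn_smul c (realFourier U), Lp.coeFn_smul c' (realFourier V),
    Lp.coeFn_add (c • (hm hU).toLp _) (c' • (hm hV).toLp _),
    Lp.coeFn_smul c ((hm hU).toLp _), Lp.coeFn_smul c' ((hm hV).toLp _),
    (hm hU).coeFn_toLp, (hm hV).coeFn_toLp] with ξ h1 h2 h3 h4 h5 h6 h7 h8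
  rw [h1, h4, Pi.add_apply, Pi.add_apply, h2, h3, h5, h6, Pi.smul_apply, Pi.smul_apply,
    Pi.smul_apply, Pi.smul_apply, h7, h8, smul_add, smul_comm _ c, smul_comm _ c']

theorem exists_extension {u : E d → ℝ} (hu : MemH s Ω u) {t : ℝ}
    (ht : (sobolevENorm s Ω u).toReal < t) :
    ∃ U : Lp ℝ 2 (volume : Measure (E d)), U =ᵐ[volume.restrict Ω] u ∧
      sobolevENormRn s U ≠ ∞ ∧ (sobolevENormRn s U).toReal < t := by
  have h1 : sobolevENorm s Ω u < ENNReal.ofReal t :=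
    (ENNReal.lt_ofReal_iff_toReal_lt hu.ne).2 ht
  obtain ⟨U, h2⟩ := iInf_lt_iff.1 h1
  obtain ⟨hU, h3⟩ := iInf_lt_iff.1 h2
  exact ⟨U, hU, h3.ne_top, (ENNReal.lt_ofReal_iff_toReal_lt h3.ne_top).1 h3⟩

/-- Nearly optimal extensions of u and v, fixed once, bound the norms of all linear combinations by
those in a Hilbert space. As the slack tends to 0, the triangle inequality, homogeneity and the
parallelogram inequality pass to the quotient norm. -/
theorem exists_sobolevENorm_le {u v : E d → ℝ} (hu : MemH s Ω u) (hv : MemH s Ω v) {t t' : ℝ}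
    (ht : (sobolevENorm s Ω u).toReal < t) (ht' : (sobolevENorm s Ω v).toReal < t') :
    ∃ a b : Lp ℂ 2 (volume : Measure (E d)), ‖a‖ < t ∧ ‖b‖ < t' ∧
      ∀ c c' : ℝ, sobolevENorm s Ω (c • u + c' • v) ≤ ‖c • a + c' • b‖ₑ := by
  obtain ⟨U, hU, hU1, hU2⟩ := exists_extension hu ht
  obtain ⟨V, hV, hV1, hV2⟩ := exists_extension hv ht'
  obtain ⟨a, b, hab⟩ := exists_sobolevENormRn_eq hU1 hV1
  refine ⟨a, b, ?_, ?_, fun c c' => ?_⟩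
  · have := hab 1 0
    simp only [one_smul, zero_smul, add_zero] at this
    rwa [this, toReal_enorm] at hU2
  · have := hab 0 1
    simp only [one_smul, zero_smul, zero_add] at this
    rwa [this, toReal_enorm] at hV2
  · rw [← hab]
    refine iInf₂_le (c • U + c' • V) ?_
    have e1 := ae_restrict_of_ae (s := Ω) (Lp.coeFn_add (c • U) (c' • V))
    have e2 := ae_restrict_of_ae (s := Ω) (Lp.coeFn_smul c U)
    have e3 := ae_restrict_of_ae (s := Ω) (Lp.coeFn_smul c' V)
    filter_upwards [e1, e2, e3, hU, hV] with x h1 h2 h3 h4 h5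
    rw [h1, Pi.add_apply, h2, h3, Pi.smul_apply, Pi.smul_apply, h4, h5]
    rfl

theorem MemH.lincomb {u v : E d → ℝ} (hu : MemH s Ω u) (hv : MemH s Ω v) (c c' : ℝ) :
    MemH s Ω (c • u + c' • v) := by
  obtain ⟨a, b, -, -, h⟩ := exists_sobolevENorm_le hu hv (lt_add_one _) (lt_add_one _)
  exact (h c c').trans_lt enorm_lt_top

theorem sobolevENorm_zero : sobolevENorm s Ω 0 = 0 := by
  refine le_antisymm ?_ bot_le
  refine (iInf₂_le (0 : Lp ℝ 2 (volume : Measure (E d)))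
    (ae_restrict_of_ae (Lp.coeFn_zero ℝ 2 volume))).trans ?_
  rw [sobolevENormRn_eq_eLpNorm]
  have e : realFourier (0 : Lp ℝ 2 (volume : Measure (E d))) = 0 := by
    have : Complex.ofRealCLM.compLp (0 : Lp ℝ 2 (volume : Measure (E d))) = 0 :=
      map_zero (Complex.ofRealCLM.compLpₗ 2 volume)
    rw [realFourier, this, FourierTransform.fourier_zero]
  rw [e, eLpNorm_congr_ae (g := fun _ => (0 : ℂ)) ?_]
  · simp
  · filter_upwards [Lp.coeFn_zero ℂ 2 (volume : Measure (E d))] with ξ h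
    rw [h, Pi.zero_apply, smul_zero]

/-- The space `H^s(Ω)`. -/
def sobolevSpace (s : ℝ) (Ω : Set (E d)) : Submodule ℝ (E d → ℝ) where
  carrier := {u | MemH s Ω u}
  add_mem' {u v} hu hv := by simpa using MemH.lincomb hu hv 1 1
  zero_mem' := by
    change sobolevENorm s Ω 0 < ∞
    rw [sobolevENorm_zero]
    exact ENNReal.zero_lt_top
  smul_mem' c u hu := by simpa using MemH.lincomb hu hu c 0

theorem toReal_sobolevENorm_lincomb_le {u v : E d → ℝ} {c c' : ℝ}
    {a b : Lp ℂ 2 (volume : Measure (E d))}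
    (h : sobolevENorm s Ω (c • u + c' • v) ≤ ‖c • a + c' • b‖ₑ) :
    (sobolevENorm s Ω (c • u + c' • v)).toReal ≤ ‖c • a + c' • b‖ := by
  rw [← toReal_enorm]
  exact ENNReal.toReal_mono enorm_ne_top h

/-- The norm of `H^s(Ω)`. -/
def sobolevSeminorm (s : ℝ) (Ω : Set (E d)) : Seminorm ℝ (sobolevSpace s Ω) :=
  Seminorm.ofSMulLE (fun u => (sobolevENorm s Ω u).toReal)
    (by simp [sobolevENorm_zero])
    (by
      intro u v
      refine le_of_forall_pos_le_add fun δ hδ => ?_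
      obtain ⟨a, b, ha, hb, h⟩ := exists_sobolevENorm_le u.2 v.2
        (lt_add_of_pos_right _ (half_pos hδ)) (lt_add_of_pos_right _ (half_pos hδ))
      have h1 := toReal_sobolevENorm_lincomb_le (h 1 1)
      simp only [one_smul] at h1
      have h2 := norm_add_le a b
      rw [Submodule.coe_add]
      linarith)
    (by
      intro c u
      refine le_of_forall_pos_le_add fun δ hδ => ?_
      have hc : 0 < ‖c‖ + 1 := by positivity
      obtain ⟨a, b, ha, hb, h⟩ := exists_sobolevENorm_le u.2 u.2
        (lt_add_of_pos_right _ (div_pos hδ hc)) (lt_add_of_pos_right _ (div_pos hδ hc))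
      have h1 := toReal_sobolevENorm_lincomb_le (h c 0)
      simp only [zero_smul, add_zero, norm_smul] at h1
      rw [Submodule.coe_smul]
      refine h1.trans ((mul_le_mul_of_nonneg_left ha.le (norm_nonneg c)).trans ?_)
      rw [mul_add]
      gcongr
      rw [← mul_div_assoc, div_le_iff₀ hc]
      nlinarith)

theorem sobolevSeminorm_apply (u : sobolevSpace s Ω) :
    sobolevSeminorm s Ω u = (sobolevENorm s Ω u).toReal := rfl

theorem sobolevSeminorm_parallelogram (u v : sobolevSpace s Ω) :
    sobolevSeminorm s Ω (u + v) ^ 2 + sobolevSeminorm s Ω (u - v) ^ 2 ≤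
      2 * (sobolevSeminorm s Ω u ^ 2 + sobolevSeminorm s Ω v ^ 2) := by
  set x := sobolevSeminorm s Ω u with hx
  set y := sobolevSeminorm s Ω v with hy
  have hlim : Tendsto (fun δ : ℝ => 2 * ((x + δ) ^ 2 + (y + δ) ^ 2)) (𝓝[>] 0)
      (𝓝 (2 * (x ^ 2 + y ^ 2))) := by
    refine tendsto_nhdsWithin_of_tendsto_nhds ?_
    have : Continuous fun δ : ℝ => 2 * ((x + δ) ^ 2 + (y + δ) ^ 2) := by fun_prop
    simpa using this.tendsto 0
  refine ge_of_tendsto hlim ?_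
  filter_upwards [self_mem_nhdsWithin] with δ hδ
  obtain ⟨a, b, ha, hb, h⟩ := exists_sobolevENorm_le u.2 v.2
    (lt_add_of_pos_right _ hδ) (lt_add_of_pos_right _ hδ)
  have h1 := toReal_sobolevENorm_lincomb_le (h 1 1)
  have h2 := toReal_sobolevENorm_lincomb_le (h 1 (-1))
  simp only [one_smul, neg_smul, ← sub_eq_add_neg] at h1 h2
  have h3 := parallelogram_law_with_norm_mul ℂ a b
  rw [sobolevSeminorm_apply, sobolevSeminorm_apply, Submodule.coe_add, Submodule.coe_sub]
  rw [← sobolevSeminorm_apply, ← hx] at ha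
  rw [← sobolevSeminorm_apply, ← hy] at hb
  calc _ ≤ ‖a + b‖ ^ 2 + ‖a - b‖ ^ 2 := by gcongr
    _ = 2 * (‖a‖ ^ 2 + ‖b‖ ^ 2) := by simp only [sq]; exact h3
    _ ≤ _ := by gcongr

theorem exists_sobolevForm (s : ℝ) (Ω : Set (E d)) :
    ∃ B : sobolevSpace s Ω →ₗ[ℝ] sobolevSpace s Ω →ₗ[ℝ] ℝ,
      ∀ u v, B u v = sobolevInner s Ω u v := by
  obtain ⟨B, hB⟩ := exists_bilinForm_of_parallelogram (sobolevSeminorm s Ω)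
    sobolevSeminorm_parallelogram
  exact ⟨B, fun u v => by rw [hB]; rfl⟩

/-- The scalar product of `H^s(Ω)` as a bilinear form. -/
def sobolevForm (s : ℝ) (Ω : Set (E d)) : sobolevSpace s Ω →ₗ[ℝ] sobolevSpace s Ω →ₗ[ℝ] ℝ :=
  (exists_sobolevForm s Ω).choose

theorem sobolevForm_apply (u v : sobolevSpace s Ω) :
    sobolevForm s Ω u v = sobolevInner s Ω u v :=
  (exists_sobolevForm s Ω).choose_spec u v

theorem sobolevForm_comm (u v : sobolevSpace s Ω) :
    sobolevForm s Ω u v = sobolevForm s Ω v u := by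
  have e : sobolevENorm s Ω ((u : E d → ℝ) - v) = sobolevENorm s Ω ((v : E d → ℝ) - u) := by
    have := map_sub_rev (sobolevSeminorm s Ω) u v
    rw [sobolevSeminorm_apply, sobolevSeminorm_apply,
      ENNReal.toReal_eq_toReal_iff' (u - v).2.ne (v - u).2.ne] at this
    exact this
  rw [sobolevForm_apply, sobolevForm_apply, sobolevInner, sobolevInner, e, add_comm]

theorem sobolevForm_self (u : sobolevSpace s Ω) :
    sobolevForm s Ω u u = sobolevSeminorm s Ω u ^ 2 := by
  have h1 : sobolevSeminorm s Ω (u + u) = 2 * sobolevSeminorm s Ω u := by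
    rw [← two_smul ℝ, map_smul_eq_mul, Real.norm_of_nonneg zero_le_two]
  have h2 : sobolevSeminorm s Ω (u - u) = 0 := by rw [sub_self, map_zero]
  rw [sobolevSeminorm_apply, Submodule.coe_add] at h1
  rw [sobolevSeminorm_apply, Submodule.coe_sub] at h2
  rw [sobolevForm_apply, sobolevInner, h1, h2]
  ring

theorem MemH.memLp {u : E d → ℝ} (hu : MemH s Ω u) : MemLp u 2 (volume.restrict Ω) := by
  obtain ⟨U, hU, -, -⟩ := exists_extension hu (lt_add_one _)
  exact (memLp_congr_ae hU).1 ((Lp.memLp U).restrict Ω)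

/-- The embedding of `H^s(Ω)` into `L²(Ω)`. -/
def sobolevToLp (s : ℝ) (Ω : Set (E d)) :
    sobolevSpace s Ω →ₗ[ℝ] Lp ℝ 2 (volume.restrict Ω) where
  toFun u := (MemH.memLp u.2).toLp u
  map_add' _ _ := rfl
  map_smul' _ _ := rfl

/-- Polynomial approximation of the elements of `H^s(Ω)` in `L²(Ω)`. -/
theorem exists_norm_sub_starProjection_le (hΩo : IsOpen Ω) (hΩ : Bornology.IsBounded Ω)
    (hs : 0 ≤ s) : ∃ C ≥ 0, ∀ (D : ℕ) (u : sobolevSpace s Ω),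
      ‖sobolevToLp s Ω u - (polySpace hΩ D).starProjection (sobolevToLp s Ω u)‖ ≤
        C * ((D : ℝ) + 1) ^ (-s) * sobolevSeminorm s Ω u := by
  obtain ⟨C, hC, h⟩ := exists_poly_approx hΩo hΩ hs
  refine ⟨C, hC, fun D u => ?_⟩
  set c := C * ((D : ℝ) + 1) ^ (-s) with hc
  have hc0 : 0 ≤ c := by positivity
  have hlim : Tendsto (fun δ : ℝ => c * (sobolevSeminorm s Ω u + δ)) (𝓝[>] 0)
      (𝓝 (c * sobolevSeminorm s Ω u)) := by
    refine tendsto_nhdsWithin_of_tendsto_nhds ?_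
    have : Continuous fun δ : ℝ => c * (sobolevSeminorm s Ω u + δ) := by fun_prop
    simpa using this.tendsto 0
  refine ge_of_tendsto hlim ?_
  filter_upwards [self_mem_nhdsWithin] with δ hδ
  obtain ⟨U, hU, hU1, hU2⟩ := exists_extension u.2 (lt_add_of_pos_right _ hδ)
  obtain ⟨q, hq, hle⟩ := h D U hU1
  have e : ((Lp.memLp U).restrict Ω).toLp U = sobolevToLp s Ω u := MemLp.toLp_congr _ (MemH.memLp u.2) hU
  rw [e] at hle
  have hmin : ‖sobolevToLp s Ω u - (polySpace hΩ D).starProjection (sobolevToLp s Ω u)‖ ≤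
      ‖sobolevToLp s Ω u - q‖ := by
    rw [Submodule.starProjection_minimal]
    exact ciInf_le ⟨0, by rintro _ ⟨y, rfl⟩; exact norm_nonneg _⟩ (⟨q, hq⟩ : polySpace hΩ D)
  refine hmin.trans (hle.trans (mul_le_mul_of_nonneg_left ?_ hc0))
  exact hU2.le

end Domain

/-! ### Tensor products of bounded operators -/

section Gram

variable {ι κ : Type*}

theorem posSemidef_gram [Fintype κ] {V : Type*} [AddCommGroup V] [Module ℝ V]
    (B : V →ₗ[ℝ] V →ₗ[ℝ] ℝ) (hs : ∀ x y, B x y = B y x) (hB : ∀ x, 0 ≤ B x x) (u : κ → V) :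
    (Matrix.of fun k l => B (u k) (u l)).PosSemidef := by
  refine Matrix.posSemidef_iff_dotProduct_mulVec.2 ⟨Matrix.IsHermitian.ext fun k l => hs _ _,
    fun x => ?_⟩
  have h : star x ⬝ᵥ ((Matrix.of fun k l => B (u k) (u l)).mulVec x) =
      B (∑ k, x k • u k) (∑ k, x k • u k) := by
    simp only [dotProduct, Matrix.mulVec, Matrix.of_apply, map_sum, map_smul,
      LinearMap.coe_sum, Finset.sum_apply, LinearMap.smul_apply, smul_eq_mul, Finset.mul_sum,
      Pi.star_apply, star_trivial]
    rw [Finset.sum_comm]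
    refine Finset.sum_congr rfl fun k _ => Finset.sum_congr rfl fun l _ => ?_
    rw [hs]
    ring
  rw [h]
  exact hB _

/-- Entrywise products of positive semidefinite matrices are monotone. -/
theorem posSemidef_prod_sub_prod (t : Finset ι) (D G : ι → Matrix κ κ ℝ)
    (hD : ∀ i, (D i).PosSemidef) (hG : ∀ i, (G i - D i).PosSemidef) [Finite κ] :
    (Matrix.of fun k l => ∏ i ∈ t, D i k l).PosSemidef ∧
      (Matrix.of fun k l => ∏ i ∈ t, G i k l - ∏ i ∈ t, D i k l).PosSemidef := by
  classical
  have := Fintype.ofFinite κ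
  induction t using Finset.induction_on with
  | empty =>
    refine ⟨?_, ?_⟩
    · convert Matrix.posSemidef_vecMulVec_self_star (fun _ : κ => (1 : ℝ)) using 1
      ext k l
      simp [Matrix.vecMulVec_apply]
    · convert Matrix.PosSemidef.zero (n := κ) (R := ℝ) using 1
      ext k l
      simp
  | insert a t ha ih =>
    obtain ⟨h1, h2⟩ := ih
    simp only [Finset.prod_insert ha]
    refine ⟨(hD a).hadamard h1, ?_⟩
    -- With ΠG written as ΠD + (ΠG - ΠD), the difference is (G_a - D_a) ∘ ΠG + D_a ∘ (ΠG - ΠD), and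
    -- entrywise products of positive semidefinite matrices are positive semidefinite by Schur's
    -- theorem.
    have e : (Matrix.of fun k l => G a k l * ∏ i ∈ t, G i k l - D a k l * ∏ i ∈ t, D i k l) =
        (G a - D a).hadamard ((Matrix.of fun k l => ∏ i ∈ t, D i k l) +
          Matrix.of fun k l => ∏ i ∈ t, G i k l - ∏ i ∈ t, D i k l) +
        (D a).hadamard (Matrix.of fun k l => ∏ i ∈ t, G i k l - ∏ i ∈ t, D i k l) := by
      ext k l
      simp only [Matrix.of_apply, Matrix.add_apply, Matrix.hadamard_apply, Matrix.sub_apply]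
      ring
    rw [e]
    exact ((hG a).hadamard (h1.add h2)).add ((hD a).hadamard h2)

theorem sum_prod_le_sum_prod [Fintype ι] [Fintype κ] (D G : ι → Matrix κ κ ℝ)
    (hD : ∀ i, (D i).PosSemidef) (hG : ∀ i, (G i - D i).PosSemidef) :
    ∑ k, ∑ l, ∏ i, D i k l ≤ ∑ k, ∑ l, ∏ i, G i k l := by
  have h := (Matrix.posSemidef_iff_dotProduct_mulVec.1
    (posSemidef_prod_sub_prod Finset.univ D G hD hG).2).2 fun _ => 1
  simp only [dotProduct, Matrix.mulVec, Matrix.of_apply, Pi.star_apply, star_one, one_mul,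
    mul_one, Finset.sum_sub_distrib] at h
  linarith

/-- A tensor product of bounded operators is bounded by the product of the bounds. -/
theorem norm_sum_pureTensor_sq_le [Fintype ι] [Fintype κ] {X : ι → Type*}
    [∀ i, MeasurableSpace (X i)] {μ : (i : ι) → Measure (X i)} [∀ i, SigmaFinite (μ i)]
    {V : ι → Type*} [∀ i, AddCommGroup (V i)] [∀ i, Module ℝ (V i)]
    (B : (i : ι) → V i →ₗ[ℝ] V i →ₗ[ℝ] ℝ) (hs : ∀ i x y, B i x y = B i y x)
    (T : (i : ι) → V i →ₗ[ℝ] Lp ℝ 2 (μ i)) (c : ι → ℝ)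
    (hT : ∀ i x, ‖T i x‖ ^ 2 ≤ c i ^ 2 * B i x x) (u : κ → (i : ι) → V i) :
    ‖∑ k, pureTensor μ fun i => T i (u k i)‖ ^ 2 ≤
      (∏ i, c i) ^ 2 * ∑ k, ∑ l, ∏ i, B i (u k i) (u l i) := by
  -- In each variable the Gram matrix of the images is dominated by c² times that of the arguments;
  -- the squared norms of both tensors are sums of all entries of the entrywise products.
  have h := sum_prod_le_sum_prod (fun i => Matrix.of fun k l => ⟪T i (u k i), T i (u l i)⟫)
    (fun i => Matrix.of fun k l => c i ^ 2 * B i (u k i) (u l i))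
    (fun i => by
      refine posSemidef_gram ((innerₗ (Lp ℝ 2 (μ i))).compl₁₂ (T i) (T i))
        (fun x y => real_inner_comm (T i y) (T i x)) (fun x => ?_) fun k => u k i
      exact real_inner_self_nonneg (x := T i x))
    (fun i => by
      refine posSemidef_gram (c i ^ 2 • B i - (innerₗ (Lp ℝ 2 (μ i))).compl₁₂ (T i) (T i))
        (fun x y => ?_) (fun x => ?_) fun k => u k i
      · simp only [LinearMap.sub_apply, LinearMap.smul_apply, LinearMap.compl₁₂_apply,
          innerₗ_apply_apply]
        rw [hs, real_inner_comm]
      · simp only [LinearMap.sub_apply, LinearMap.smul_apply, LinearMap.compl₁₂_apply,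
          innerₗ_apply_apply, real_inner_self_eq_norm_sq, smul_eq_mul]
        linarith [hT i x])
  rw [← real_inner_self_eq_norm_sq, sum_inner]
  simp only [inner_sum, inner_pureTensor]
  refine h.trans_eq ?_
  simp only [Matrix.of_apply, Finset.prod_mul_distrib, Finset.prod_pow, Finset.mul_sum]

end Gram

/-! ### Dimension counts for spaces of tensors -/

section Span

/-- The span of the values of a multilinear map on a product of finite dimensional spaces. -/
theorem exists_span_image_le {ι : Type*} [Fintype ι] {V : ι → Type*}
    [∀ i, AddCommGroup (V i)] [∀ i, Module ℝ (V i)] {M : Type*} [AddCommGroup M] [Module ℝ M]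
    (f : MultilinearMap ℝ V M) (W : (i : ι) → Submodule ℝ (V i))
    [∀ i, FiniteDimensional ℝ (W i)] :
    ∃ b : ((i : ι) → Fin (Module.finrank ℝ (W i))) → M,
      ∀ u, (∀ i, u i ∈ W i) → f u ∈ Submodule.span ℝ (Set.range b) := by
  classical
  let e := fun i => Module.finBasis ℝ (W i)
  refine ⟨fun γ => f fun i => e i (γ i), fun u hu => ?_⟩
  have h : u = fun i => ∑ γ, (e i).repr ⟨u i, hu i⟩ γ • (e i γ : V i) := by
    funext i
    have := congrArg Subtype.val ((e i).sum_repr ⟨u i, hu i⟩)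
    rw [Submodule.coe_sum] at this
    exact this.symm
  rw [h, f.map_sum]
  refine Submodule.sum_mem _ fun γ _ => ?_
  rw [f.map_smul_univ (fun i => (e i).repr ⟨u i, hu i⟩ (γ i)) fun i => (e i (γ i) : V i)]
  exact Submodule.smul_mem _ _ (Submodule.subset_span ⟨γ, rfl⟩)

/-- Repeated use of (2^a - 1)(2^b - 1) ≤ 2^{a+b} - 1. The empty product 1 would exceed the bound
when L = 0. -/
theorem prod_two_pow_sub_one_le {ι : Type*} (t : Finset ι) (ht : t.Nonempty) (l : ι → ℕ) {L : ℕ}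
    (h : ∑ i ∈ t, l i ≤ L) : ∏ i ∈ t, (2 ^ l i - 1) ≤ 2 ^ L - 1 := by
  classical
  have key : ∏ i ∈ t, (2 ^ l i - 1) ≤ 2 ^ (∑ i ∈ t, l i) - 1 := by
    induction ht using Finset.Nonempty.cons_induction with
    | singleton a => simp
    | cons a t ha ht ih =>
      rw [Finset.prod_cons, Finset.sum_cons, pow_add]
      have ih' := ih ((Finset.sum_le_sum_of_subset (Finset.subset_cons ha)).trans h)
      have h1 : 1 ≤ 2 ^ l a := Nat.one_le_two_pow
      have h2 : 1 ≤ 2 ^ ∑ i ∈ t, l i := Nat.one_le_two_pow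
      refine (Nat.mul_le_mul_left _ ih').trans ?_
      obtain ⟨x, hx⟩ := Nat.exists_eq_add_of_le h1
      obtain ⟨y, hy⟩ := Nat.exists_eq_add_of_le h2
      rw [hx, hy]
      have : (1 + x) * (1 + y) = 1 + (x + y + x * y) := by ring
      rw [this]
      simp only [Nat.add_sub_cancel_left]
      omega
  exact key.trans (Nat.sub_le_sub_right (Nat.pow_le_pow_right two_pos h) 1)

end Span

/-! ### Polynomial spaces at dyadic levels -/

section Level

variable {d : ℕ} {s : ℝ} {Ω : Set (E d)}

theorem polySpace_mono (hΩ : Bornology.IsBounded Ω) : Monotone (polySpace hΩ) := by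
  intro D D' h
  refine Submodule.span_le.2 ?_
  rintro _ ⟨γ, rfl⟩
  exact Submodule.subset_span ⟨fun i => Fin.castLE h (γ i), rfl⟩

/-- The polynomials of level `l`, a space of dimension less than `2 ^ l`. -/
def levelSpace (hΩ : Bornology.IsBounded Ω) (l : ℕ) : Submodule ℝ (Lp ℝ 2 (volume.restrict Ω)) :=
  polySpace hΩ (⌈(2 : ℝ) ^ ((l : ℝ) / d)⌉₊ - 1)

instance (hΩ : Bornology.IsBounded Ω) (l : ℕ) : FiniteDimensional ℝ (levelSpace hΩ l) := by
  unfold levelSpace; infer_instance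

theorem levelSpace_mono (hΩ : Bornology.IsBounded Ω) : Monotone (levelSpace hΩ) := by
  intro l l' h
  refine polySpace_mono hΩ (Nat.sub_le_sub_right (Nat.ceil_mono ?_) 1)
  refine Real.rpow_le_rpow_of_exponent_le one_le_two ?_
  gcongr

/-- Subtracting 1 from the ceiling puts the degree bound strictly below 2^{l/d}, hence the dimension
strictly below 2^l. Level 0 is thus the zero space, which allows L = 0 even for the smallest ranks.
-/
theorem finrank_levelSpace_le (hd : 0 < d) (hΩ : Bornology.IsBounded Ω) (l : ℕ) :
    Module.finrank ℝ (levelSpace hΩ l) ≤ 2 ^ l - 1 := by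
  refine (finrank_polySpace_le hΩ _).trans (Nat.le_sub_one_of_lt ?_)
  set x : ℝ := (2 : ℝ) ^ ((l : ℝ) / d) with hx
  have hx0 : 0 < x := by positivity
  have h1 : ((⌈x⌉₊ - 1 : ℕ) : ℝ) < x := by
    rw [Nat.cast_sub (Nat.one_le_ceil_iff.2 hx0), Nat.cast_one]
    linarith [Nat.ceil_lt_add_one hx0.le]
  have h2 : x ^ d = 2 ^ l := by
    rw [hx, ← Real.rpow_natCast, ← Real.rpow_mul zero_le_two,
      div_mul_cancel₀ _ (Nat.cast_ne_zero.2 hd.ne'), Real.rpow_natCast]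
  have h3 : ((⌈x⌉₊ - 1 : ℕ) : ℝ) ^ d < 2 ^ l := by
    rw [← h2]
    exact pow_lt_pow_left₀ h1 (Nat.cast_nonneg _) hd.ne'
  exact_mod_cast h3

/-- Here D + 1 = ⌈2^{l/d}⌉, so that (D + 1)^{-s} ≤ 2^{-sl/d}. -/
theorem exists_norm_sub_level_le (hd : 0 < d) (hΩo : IsOpen Ω) (hΩ : Bornology.IsBounded Ω)
    (hs : 0 ≤ s) : ∃ C ≥ 0, ∀ (l : ℕ) (u : sobolevSpace s Ω),
      ‖sobolevToLp s Ω u - (levelSpace hΩ l).starProjection (sobolevToLp s Ω u)‖ ≤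
        C * (2 : ℝ) ^ (-(s / d) * l) * sobolevSeminorm s Ω u := by
  obtain ⟨C, hC, h⟩ := exists_norm_sub_starProjection_le hΩo hΩ hs
  refine ⟨C, hC, fun l u => (h _ u).trans ?_⟩
  refine mul_le_mul_of_nonneg_right (mul_le_mul_of_nonneg_left ?_ hC) (apply_nonneg _ _)
  set x : ℝ := (2 : ℝ) ^ ((l : ℝ) / d) with hx
  have hx0 : 0 < x := by positivity
  have h1 : x ≤ ((⌈x⌉₊ - 1 : ℕ) : ℝ) + 1 := by
    rw [Nat.cast_sub (Nat.one_le_ceil_iff.2 hx0), Nat.cast_one, sub_add_cancel]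
    exact Nat.le_ceil x
  refine (Real.rpow_le_rpow_of_nonpos hx0 h1 (by linarith)).trans_eq ?_
  rw [hx, ← Real.rpow_mul zero_le_two]
  congr 1
  field_simp

/-- The projection to level `l - 1`; from level `L + 2` on the identity. -/
def levelOp (hΩ : Bornology.IsBounded Ω) (L l : ℕ) :
    Lp ℝ 2 (volume.restrict Ω) →ₗ[ℝ] Lp ℝ 2 (volume.restrict Ω) :=
  if l = 0 then 0 else if l ≤ L + 1 then (levelSpace hΩ (l - 1)).starProjection.toLinearMap
    else LinearMap.id

/-- The part of a function at level `l`; level `L + 1` contains everything beyond level `L`. -/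
def levelPart (hΩ : Bornology.IsBounded Ω) (L l : ℕ) :
    Lp ℝ 2 (volume.restrict Ω) →ₗ[ℝ] Lp ℝ 2 (volume.restrict Ω) :=
  levelOp hΩ L (l + 1) - levelOp hΩ L l

theorem sum_levelPart (hΩ : Bornology.IsBounded Ω) (L : ℕ) (x : Lp ℝ 2 (volume.restrict Ω)) :
    ∑ l ∈ Finset.range (L + 2), levelPart hΩ L l x = x := by
  have h := Finset.sum_range_sub (fun l => levelOp hΩ L l x) (L + 2)
  simp only [levelPart, LinearMap.sub_apply]
  rw [h]
  simp [levelOp]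

theorem levelPart_mem (hΩ : Bornology.IsBounded Ω) {L l : ℕ} (hl : l ≤ L)
    (x : Lp ℝ 2 (volume.restrict Ω)) : levelPart hΩ L l x ∈ levelSpace hΩ l := by
  rw [levelPart, LinearMap.sub_apply]
  refine Submodule.sub_mem _ ?_ ?_
  · rw [levelOp, if_neg (by omega), if_pos (by omega)]
    exact Submodule.starProjection_apply_mem _ _
  · rw [levelOp]
    split_ifs with h
    · simp
    · exact levelSpace_mono hΩ (by omega) (Submodule.starProjection_apply_mem _ _)
    · omega

/-- Both operators of the difference are compared with the identity, whence the factor 2; the shift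
to level l - 1 in `levelOp` costs the factor 2^{s/d}. -/
theorem exists_norm_levelPart_le (hd : 0 < d) (hΩo : IsOpen Ω) (hΩ : Bornology.IsBounded Ω)
    (hs : 0 ≤ s) : ∃ C ≥ 0, ∀ (L l : ℕ) (u : sobolevSpace s Ω),
      ‖levelPart hΩ L l (sobolevToLp s Ω u)‖ ^ 2 ≤
        (C * (2 : ℝ) ^ (-(s / d) * l)) ^ 2 * sobolevForm s Ω u u := by
  obtain ⟨C, hC, h⟩ := exists_norm_sub_level_le hd hΩo hΩ hs
  have ha : 0 ≤ s / d := by positivity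
  set a := s / d
  refine ⟨2 * (C * (2 : ℝ) ^ a), by positivity, fun L l u => ?_⟩
  set x := sobolevToLp s Ω u
  set q := sobolevSeminorm s Ω u with hq
  have hq0 : 0 ≤ q := apply_nonneg _ _
  have key : ∀ l : ℕ, ‖x - levelOp hΩ L l x‖ ≤ C * (2 : ℝ) ^ a * (2 : ℝ) ^ (-a * l) * q := by
    intro l
    rw [levelOp]
    split_ifs with h1 h2
    · subst h1
      have hbot : levelSpace hΩ 0 = ⊥ := by
        rw [← Submodule.finrank_eq_zero (R := ℝ)]
        exact Nat.le_zero.1 (finrank_levelSpace_le hd hΩ 0)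
      have h3 := h 0 u
      have h4 := (Submodule.eq_bot_iff _).1 hbot _
        (Submodule.starProjection_apply_mem (levelSpace hΩ 0) (sobolevToLp s Ω u))
      simp only [h4, sub_zero, Nat.cast_zero, mul_zero, Real.rpow_zero, mul_one] at h3
      simp only [LinearMap.zero_apply, sub_zero, Nat.cast_zero, mul_zero, Real.rpow_zero, mul_one]
      refine h3.trans (mul_le_mul_of_nonneg_right ?_ hq0)
      exact le_mul_of_one_le_right hC (Real.one_le_rpow one_le_two ha)
    · refine (h (l - 1) u).trans_eq ?_
      rw [mul_assoc C ((2 : ℝ) ^ a), ← Real.rpow_add two_pos, Nat.cast_sub (by omega : 1 ≤ l)]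
      congr 3
      push_cast
      ring
    · simp only [LinearMap.id_apply, sub_self, norm_zero]
      positivity
  have h1 := key l
  have h2 := key (l + 1)
  have h3 : (2 : ℝ) ^ (-a * (l + 1 : ℕ)) ≤ (2 : ℝ) ^ (-a * l) := by
    refine Real.rpow_le_rpow_of_exponent_le one_le_two ?_
    push_cast
    linarith
  rw [sobolevForm_self, ← hq, ← mul_pow]
  refine pow_le_pow_left₀ (norm_nonneg _) ?_ 2
  rw [levelPart, LinearMap.sub_apply, ← sub_sub_sub_cancel_left _ _ x]
  refine (norm_sub_le _ _).trans ?_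
  calc _ ≤ C * (2 : ℝ) ^ a * (2 : ℝ) ^ (-a * l) * q + C * (2 : ℝ) ^ a * (2 : ℝ) ^ (-a * l) * q := by
        refine add_le_add h1 (h2.trans ?_)
        gcongr
    _ = _ := by ring

end Level

/-! ### Approximation in Hilbert tensor products of Sobolev spaces -/

section Levels

variable {k : ℕ} {n : Fin (k + 2) → ℕ} {Ω : (i : Fin (k + 2)) → Set (E (n i))}
  {s : Fin (k + 2) → ℝ} {κ : Type*} [Fintype κ]

/-- The tensor `∑ₖ ⊗ᵢ u_{k,i}` as a function. -/
def tensorLp (u : κ → (i : Fin (k + 2)) → sobolevSpace (s i) (Ω i)) :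
    Lp ℝ 2 (tailMeasure Ω 0) :=
  ∑ κ, tailPure Ω 0 fun i => sobolevToLp (s i) (Ω i) (u κ i)

/-- The part of the tensor `∑ₖ ⊗ᵢ u_{k,i}`, `i ≥ j`, that has level `l i` in the variable `i`. -/
def tensorPart (hΩb : ∀ i, Bornology.IsBounded (Ω i)) (L : ℕ)
    (u : κ → (i : Fin (k + 2)) → sobolevSpace (s i) (Ω i)) (j : Fin (k + 2))
    (l : Fin (k + 2) → ℕ) : Lp ℝ 2 (tailMeasure Ω j) :=
  ∑ κ, tailPure Ω j fun i => levelPart (hΩb i) L (l i) (sobolevToLp (s i) (Ω i) (u κ i))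

/-- The levels up to `L + 1`. -/
def levelBox (k L : ℕ) : Finset (Fin (k + 2) → ℕ) :=
  Fintype.piFinset fun _ => Finset.range (L + 2)

theorem card_levelBox (k L : ℕ) : (levelBox k L).card = (L + 2) ^ (k + 2) := by
  simp [levelBox]

theorem sum_tensorPart (hΩb : ∀ i, Bornology.IsBounded (Ω i)) (L : ℕ)
    (u : κ → (i : Fin (k + 2)) → sobolevSpace (s i) (Ω i)) :
    ∑ l ∈ levelBox k L, tensorPart hΩb L u 0 l = tensorLp u := by
  simp only [tensorPart, tensorLp]
  rw [Finset.sum_comm]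
  refine Finset.sum_congr rfl fun κ _ => ?_
  have h := (tailPure Ω 0).map_sum_finset
    (fun i l => levelPart (hΩb i) L l (sobolevToLp (s i) (Ω i) (u κ i)))
    fun _ => Finset.range (L + 2)
  simp only [sum_levelPart] at h
  rw [h]
  refine Finset.sum_nbij' (fun l i => l i) (fun l i => l ⟨i, Fin.zero_le i⟩) ?_ ?_ ?_ ?_ ?_
  · intro l hl
    exact Fintype.mem_piFinset.2 fun i => Fintype.mem_piFinset.1 hl i
  · intro l hl
    exact Fintype.mem_piFinset.2 fun i => Fintype.mem_piFinset.1 hl ⟨i, Fin.zero_le i⟩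
  · intro l _
    rfl
  · intro l _
    rfl
  · intro l _
    rfl

/-- The square of the norm of a tensor in the Hilbert tensor product of the Sobolev spaces. -/
def tensorNormSq (u : κ → (i : Fin (k + 2)) → sobolevSpace (s i) (Ω i)) : ℝ :=
  ∑ a, ∑ b, ∏ i, sobolevForm (s i) (Ω i) (u a i) (u b i)

theorem exists_norm_tensorPart_le (hn : ∀ i, 0 < n i) (hΩ : ∀ i, IsOpen (Ω i))
    (hΩb : ∀ i, Bornology.IsBounded (Ω i)) (hs : ∀ i, 0 ≤ s i) :
    ∃ C ≥ 0, ∀ (L N : ℕ) (u : Fin N → (i : Fin (k + 2)) → sobolevSpace (s i) (Ω i))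
      (l : Fin (k + 2) → ℕ),
      ‖tensorPart hΩb L u 0 l‖ ≤
        C * (2 : ℝ) ^ (-∑ i, s i / n i * l i) * √(tensorNormSq u) := by
  choose c hc h using fun i => exists_norm_levelPart_le (hn i) (hΩ i) (hΩb i) (hs i)
  refine ⟨∏ i, c i, Finset.prod_nonneg fun i _ => hc i, fun L N u l => ?_⟩
  have h1 := norm_sum_pureTensor_sq_le (ι := {i : Fin (k + 2) // 0 ≤ i})
    (μ := fun i => volume.restrict (Ω i)) (fun i => sobolevForm (s i) (Ω i))
    (fun i => sobolevForm_comm)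
    (fun i => (levelPart (hΩb i) L (l i)).comp (sobolevToLp (s i) (Ω i)))
    (fun i => c i * (2 : ℝ) ^ (-(s i / n i) * l i)) (fun i x => h i L (l i) x)
    (fun a i => u a i)
  have e : ∀ g : Fin (k + 2) → ℝ, ∏ i : {i : Fin (k + 2) // 0 ≤ i}, g i = ∏ i, g i := fun g =>
    Fintype.prod_equiv (Equiv.subtypeUnivEquiv fun i => Fin.zero_le i) _ _ fun i => rfl
  rw [e fun i => c i * (2 : ℝ) ^ (-(s i / n i) * l i), Finset.prod_mul_distrib,
    ← Real.rpow_sum_of_pos two_pos] at h1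
  have e' : ∀ a b, ∏ i : {i : Fin (k + 2) // 0 ≤ i}, sobolevForm (s i) (Ω i) (u a i) (u b i) =
      ∏ i, sobolevForm (s i) (Ω i) (u a i) (u b i) := fun a b =>
    e fun i => sobolevForm (s i) (Ω i) (u a i) (u b i)
  simp only [e', neg_mul, Finset.sum_neg_distrib] at h1
  have h2 : 0 ≤ (∏ i, c i) * (2 : ℝ) ^ (-∑ i, s i / n i * l i) :=
    mul_nonneg (Finset.prod_nonneg fun i _ => hc i) (by positivity)
  have h3 := Real.sqrt_le_sqrt h1
  rw [Real.sqrt_sq (norm_nonneg _), Real.sqrt_mul (sq_nonneg _), Real.sqrt_sq h2] at h3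
  exact h3

/-- All discarded parts are estimated by the largest bound among them; their number, at most (L +
2)^{k+2}, is one source of the logarithmic factor. -/
theorem exists_norm_sub_sum_tensorPart_le (hn : ∀ i, 0 < n i) (hΩ : ∀ i, IsOpen (Ω i))
    (hΩb : ∀ i, Bornology.IsBounded (Ω i)) (hs : ∀ i, 0 ≤ s i) :
    ∃ C ≥ 0, ∀ (L N : ℕ) (u : Fin N → (i : Fin (k + 2)) → sobolevSpace (s i) (Ω i))
      (S : Finset (Fin (k + 2) → ℕ)) (e : ℝ), S ⊆ levelBox k L →
      (∀ l ∈ levelBox k L, l ∉ S → e ≤ ∑ i, s i / n i * l i) →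
      ‖tensorLp u - ∑ l ∈ S, tensorPart hΩb L u 0 l‖ ≤
        C * ((L : ℝ) + 2) ^ (k + 2) * (2 : ℝ) ^ (-e) * √(tensorNormSq u) := by
  obtain ⟨C, hC, h⟩ := exists_norm_tensorPart_le hn hΩ hΩb hs
  refine ⟨C, hC, fun L N u S e hS he => ?_⟩
  rw [← sum_tensorPart hΩb L u, ← Finset.sum_sdiff hS, add_sub_cancel_right]
  refine (norm_sum_le_of_le (f := tensorPart hΩb L u 0)
    (n := fun _ => C * (2 : ℝ) ^ (-e) * √(tensorNormSq u)) _ fun l hl => ?_).trans ?_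
  · rw [Finset.mem_sdiff] at hl
    refine (h L N u l).trans ?_
    gcongr
    · exact one_le_two
    · exact he l hl.1 hl.2
  · rw [Finset.sum_const, nsmul_eq_mul]
    have h1 : (((levelBox k L) \ S).card : ℝ) ≤ ((L : ℝ) + 2) ^ (k + 2) := by
      have := (Finset.card_le_card (Finset.sdiff_subset (s := levelBox k L) (t := S))).trans_eq
        (card_levelBox k L)
      exact_mod_cast this
    calc _ ≤ ((L : ℝ) + 2) ^ (k + 2) * (C * (2 : ℝ) ^ (-e) * √(tensorNormSq u)) := by gcongr
      _ = _ := by ring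

/-- The tensors whose factors have the levels `l i` for the variables after `J`, `l ∈ S`. -/
def tailSpan (hΩb : ∀ i, Bornology.IsBounded (Ω i)) (S : Finset (Fin (k + 2) → ℕ))
    (J : Fin (k + 1)) (j : Fin (k + 2)) : Submodule ℝ (Lp ℝ 2 (tailMeasure Ω j)) :=
  Submodule.span ℝ {h | ∃ l ∈ S, ∃ u : (i : {i // j ≤ i}) → Lp ℝ 2 (volume.restrict (Ω i)),
    (∀ i : {i // j ≤ i}, J.succ ≤ i.1 → u i ∈ levelSpace (hΩb i) (l i)) ∧ tailPure Ω j u = h}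

/-- Contracting an elementary tensor replaces its first factor by a scalar and leaves the levels of
the others unchanged, so these spaces form a family as required by `stepError_le`. -/
theorem op_mem_tailSpan [∀ i, IsFiniteMeasure (volume.restrict (Ω i))]
    (hΩb : ∀ i, Bornology.IsBounded (Ω i)) (S : Finset (Fin (k + 2) → ℕ))
    (J j : Fin (k + 1)) (h : Lp ℝ 2 (tailMeasure Ω j.castSucc))
    (hh : h ∈ tailSpan hΩb S J j.castSucc) (a : Lp ℝ 2 (volume.restrict (Ω j.castSucc))) :
    (tailTensor Ω j).op h a ∈ tailSpan hΩb S J j.succ := by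
  refine Submodule.span_induction (p := fun h _ => (tailTensor Ω j).op h a ∈ tailSpan hΩb S J j.succ)
    ?_ ?_ ?_ ?_ hh
  · rintro _ ⟨l, hl, u, hu, rfl⟩
    rw [tailPure_castSucc, HilbertTensor.op_tmul]
    exact Submodule.smul_mem _ _ (Submodule.subset_span
      ⟨l, hl, _, fun i hi => hu ⟨i.1, j.castSucc_lt_succ.le.trans i.2⟩ hi, rfl⟩)
  · rw [map_zero]
    exact Submodule.zero_mem _
  · intro x y _ _ hx hy
    rw [map_add, _root_.add_apply]
    exact Submodule.add_mem _ hx hy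
  · intro c x _ hx
    rw [map_smul, _root_.smul_apply]
    exact Submodule.smul_mem _ _ hx

/-- Past J every remaining factor is restricted to its level, so each l ∈ S contributes at most ∏
(2^{l_i} - 1) ≤ 2^L - 1 dimensions. -/
theorem tailSpan_finrank_le (hn : ∀ i, 0 < n i) (hΩb : ∀ i, Bornology.IsBounded (Ω i))
    (S : Finset (Fin (k + 2) → ℕ)) (J : Fin (k + 1)) {L : ℕ}
    (hS : ∀ l ∈ S, ∑ i : {i // J.succ ≤ i}, l i ≤ L) :
    FiniteDimensional ℝ (tailSpan hΩb S J J.succ) ∧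
      Module.finrank ℝ (tailSpan hΩb S J J.succ) ≤ S.card * (2 ^ L - 1) := by
  choose b hb using fun l : S => exists_span_image_le (tailPure Ω J.succ)
    fun i => levelSpace (hΩb i) (l.1 i)
  let B : (Σ l : S, (i : {i // J.succ ≤ i}) → Fin (Module.finrank ℝ
      (levelSpace (hΩb i) (l.1 i)))) → Lp ℝ 2 (tailMeasure Ω J.succ) := fun γ => b γ.1 γ.2
  have hle : tailSpan hΩb S J J.succ ≤ Submodule.span ℝ (Set.range B) := by
    refine Submodule.span_le.2 ?_
    rintro _ ⟨l, hl, u, hu, rfl⟩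
    refine Submodule.span_mono ?_ (hb ⟨l, hl⟩ u fun i => hu i i.2)
    rintro _ ⟨γ, rfl⟩
    exact ⟨⟨⟨l, hl⟩, γ⟩, rfl⟩
  have hfd : FiniteDimensional ℝ (Submodule.span ℝ (Set.range B)) :=
    FiniteDimensional.span_of_finite ℝ (Set.finite_range B)
  refine ⟨Submodule.finiteDimensional_of_le hle, ?_⟩
  refine (Submodule.finrank_mono hle).trans ((finrank_range_le_card (R := ℝ) B).trans ?_)
  rw [Fintype.card_sigma]
  calc _ ≤ ∑ _l : S, (2 ^ L - 1) := by
        refine Finset.sum_le_sum fun l _ => ?_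
        rw [Fintype.card_pi]
        simp only [Fintype.card_fin]
        refine (Finset.prod_le_prod' fun (i : {i // J.succ ≤ i}) _ =>
          finrank_levelSpace_le (hn i) (hΩb i) (l.1 i)).trans ?_
        exact prod_two_pow_sub_one_le _ ⟨⟨J.succ, le_rfl⟩, Finset.mem_univ _⟩ _ (hS l.1 l.2)
    _ = _ := by simp

/-- The bound on the sum forces each l_i ≤ L after J, which excludes the infinite dimensional
remainder kept at level L + 1. -/
theorem tensorPart_mem_tailSpan (hΩb : ∀ i, Bornology.IsBounded (Ω i))
    (S : Finset (Fin (k + 2) → ℕ)) (J : Fin (k + 1)) {L : ℕ}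
    (hS : ∀ l ∈ S, ∑ i : {i // J.succ ≤ i}, l i ≤ L)
    (u : κ → (i : Fin (k + 2)) → sobolevSpace (s i) (Ω i)) (j : Fin (k + 2))
    {l : Fin (k + 2) → ℕ} (hl : l ∈ S) :
    tensorPart hΩb L u j l ∈ tailSpan hΩb S J j := by
  refine Submodule.sum_mem _ fun a _ => Submodule.subset_span ⟨l, hl, _, fun i hi => ?_, rfl⟩
  refine levelPart_mem _ (le_trans ?_ (hS l hl)) _
  exact Finset.single_le_sum (f := fun i : {i // J.succ ≤ i} => l i) (fun _ _ => Nat.zero_le _)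
    (Finset.mem_univ ⟨i.1, hi⟩)

theorem iInf_mul_le_sum {a : Fin (k + 2) → ℝ} (J : Fin (k + 1)) {l : Fin (k + 2) → ℕ} {L : ℕ}
    (ha : ∀ i, 0 ≤ a i) (hl : L ≤ ∑ i : {i // J.succ ≤ i}, l i) :
    (⨅ i : {i // J.castSucc < i}, a i) * L ≤ ∑ i : {i // J.succ ≤ i}, a i * l i := by
  have h0 : 0 ≤ ⨅ i : {i // J.castSucc < i}, a i := Real.iInf_nonneg fun i => ha i
  calc (⨅ i : {i // J.castSucc < i}, a i) * L
      ≤ (⨅ i : {i // J.castSucc < i}, a i) * (∑ i : {i // J.succ ≤ i}, l i : ℕ) := by gcongr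
    _ = ∑ i : {i // J.succ ≤ i}, (⨅ i : {i // J.castSucc < i}, a i) * l i := by
        rw [Nat.cast_sum, Finset.mul_sum]
    _ ≤ _ := by
        refine Finset.sum_le_sum fun i _ => mul_le_mul_of_nonneg_right ?_ (Nat.cast_nonneg _)
        exact ciInf_le (f := fun i : {i // J.castSucc < i} => a i) (Set.finite_range _).bddBelow
          ⟨i.1, Fin.castSucc_lt_iff_succ_le.2 i.2⟩

end Levels

/-! ### The truncation errors of the tensor train decomposition -/

/-- The space of contractions of a tensor whose first factors are in `W`. -/
theorem HilbertTensor.op_mem_map {A B C : Type*} [NormedAddCommGroup A] [InnerProductSpace ℝ A]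
    [CompleteSpace A] [NormedAddCommGroup B] [InnerProductSpace ℝ B] [CompleteSpace B]
    [NormedAddCommGroup C] [InnerProductSpace ℝ C] [CompleteSpace C] (H : HilbertTensor A B C)
    (W : Submodule ℝ A) [FiniteDimensional ℝ W] {h : C}
    (hh : h ∈ Submodule.span ℝ {h | ∃ w ∈ W, ∃ b, H.tmul w b = h}) (a : A) :
    H.op h a ∈ W.map (H.op h).toLinearMap := by
  -- The operator annihilates the complement of W, so its range is the image of W.
  have hz : ∀ b ∈ Wᗮ, H.op h b = 0 := by
    intro b hb
    refine Submodule.span_induction (p := fun h _ => H.op h b = 0) ?_ ?_ ?_ ?_ hh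
    · rintro _ ⟨w, hw, v, rfl⟩
      rw [H.op_tmul, Submodule.inner_right_of_mem_orthogonal hw hb, zero_smul]
    · rw [map_zero]
      rfl
    · intro x y _ _ hx hy
      rw [map_add, _root_.add_apply, hx, hy, add_zero]
    · intro c x _ hx
      rw [map_smul, _root_.smul_apply, hx, smul_zero]
  refine ⟨W.starProjection a, Submodule.starProjection_apply_mem _ _, ?_⟩
  have h1 := hz _ (Submodule.sub_starProjection_mem_orthogonal (K := W) a)
  rw [map_sub, sub_eq_zero] at h1
  exact h1.symm

section Step

variable {k : ℕ} {n : Fin (k + 2) → ℕ} {Ω : (i : Fin (k + 2)) → Set (E (n i))}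
  {s : Fin (k + 2) → ℝ} {f : ((i : Fin (k + 2)) → E (n i)) → ℝ} {r : Fin (k + 1) → ℕ}
  [∀ i, IsFiniteMeasure (volume.restrict (Ω i))]

theorem exists_pi_castSucc_succ {F : Fin (k + 2) → Type*} [∀ j, Inhabited (F j)] (J : Fin (k + 1))
    (x : F J.castSucc) (y : F J.succ) : ∃ X : (j : Fin (k + 2)) → F j, X J.castSucc = x ∧ X J.succ = y := by
  classical
  refine ⟨Function.update (Function.update (fun j => default) J.castSucc x) J.succ y, ?_, ?_⟩
  · rw [Function.update_of_ne (Fin.castSucc_lt_succ).ne, Function.update_self]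
  · rw [Function.update_self]

/-- In the first step f itself is decomposed, so only the contractions of the single approximant
matter, and its span can serve as the first space of the family. -/
theorem TTDecomposition.stepError_zero_le (T : TTDecomposition Ω f r)
    (hf : MemLp f 2 (prodMeasure Ω)) (J : Fin (k + 1)) (hJ : J = 0)
    (Y : Submodule ℝ (Lp ℝ 2 (tailMeasure Ω J.succ)))
    [FiniteDimensional ℝ Y] (hr : Module.finrank ℝ Y ≤ r J)
    (h : (j : Fin (k + 2)) → Lp ℝ 2 (tailMeasure Ω j))
    (hh : ∀ a, (tailTensor Ω J).op (h J.castSucc) a ∈ Y) :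
    T.stepError hf J ≤ ‖(memLp_comp_fullEquiv_symm hf).toLp _ - h 0‖ := by
  obtain ⟨X, h1, h2⟩ := exists_pi_castSucc_succ (F := fun j => Submodule ℝ (Lp ℝ 2 (tailMeasure Ω j))) J
    (Submodule.span ℝ {h J.castSucc}) Y
  have hfd : FiniteDimensional ℝ (X J.succ) := by rwa [h2]
  refine T.stepError_le hf J X ?_ (by rw [h2]; exact hr) (h 0) ?_
  · intro j hj x hx a
    obtain rfl : j = J := by subst hJ; exact Fin.le_zero_iff.1 hj
    rw [h1] at hx
    obtain ⟨c, rfl⟩ := Submodule.mem_span_singleton.1 hx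
    rw [map_smul, _root_.smul_apply, h2]
    exact Submodule.smul_mem _ _ (hh a)
  · have : ∀ j, j = J.castSucc → h j ∈ X j := by
      rintro j rfl
      rw [h1]
      exact Submodule.mem_span_singleton_self _
    exact this 0 (by rw [hJ, Fin.castSucc_zero])

/-- The error of the truncation in step `J`, if the rank is large enough for level `L`. -/
theorem exists_stepError_le (hn : ∀ i, 0 < n i) (hΩ : ∀ i, IsOpen (Ω i))
    (hΩb : ∀ i, Bornology.IsBounded (Ω i)) (hs : ∀ i, 0 ≤ s i) :
    ∃ C ≥ 0, ∀ (f : ((i : Fin (k + 2)) → E (n i)) → ℝ) (r : Fin (k + 1) → ℕ)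
      (T : TTDecomposition Ω f r) (hf : MemLp f 2 (prodMeasure Ω))
      (N : ℕ) (u : Fin N → (i : Fin (k + 2)) → sobolevSpace (s i) (Ω i))
      (L : ℕ) (J : Fin (k + 1)), ((L + 2) ^ (k + 2) + 1) * (2 ^ L - 1) ≤ r J →
      T.stepError hf J ≤ ‖(memLp_comp_fullEquiv_symm hf).toLp _ - tensorLp u‖ +
        C * ((L : ℝ) + 2) ^ (k + 2) * (2 : ℝ) ^ (-(rate n s J * L)) * √(tensorNormSq u) := by
  classical
  obtain ⟨C, hC, hC'⟩ := exists_norm_sub_sum_tensorPart_le hn hΩ hΩb hs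
  refine ⟨C, hC, fun f r T hf N u L J hr => ?_⟩
  have ha : ∀ i, 0 ≤ s i / n i := fun i => div_nonneg (hs i) (Nat.cast_nonneg _)
  set S := (levelBox k L).filter fun l => ∑ i : {i // J.succ ≤ i}, l i ≤ L with hS
  have hSsub : S ⊆ levelBox k L := Finset.filter_subset _ _
  have hS' : ∀ l ∈ S, ∑ i : {i // J.succ ≤ i}, l i ≤ L := fun l hl => (Finset.mem_filter.1 hl).2
  obtain ⟨hfd, hfr⟩ := tailSpan_finrank_le hn hΩb S J hS'
  have hfr' : Module.finrank ℝ (tailSpan hΩb S J J.succ) ≤ (L + 2) ^ (k + 2) * (2 ^ L - 1) := by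
    refine hfr.trans (Nat.mul_le_mul_right _ ?_)
    rw [← card_levelBox]
    exact Finset.card_le_card hSsub
  by_cases hJ : J = 0
  · set S₂ := (levelBox k L).filter fun l => l J.castSucc ≤ L with hS₂
    have hsub : S ∪ S₂ ⊆ levelBox k L := Finset.union_subset hSsub (Finset.filter_subset _ _)
    have herr := hC' L N u (S ∪ S₂) (rate n s J * L) hsub ?_
    · set h₁ := fun j => ∑ l ∈ S, tensorPart hΩb L u j l with hh₁
      set h₂ := fun j => ∑ l ∈ S₂ \ S, tensorPart hΩb L u j l with hh₂
      have hsum : ∑ l ∈ S ∪ S₂, tensorPart hΩb L u 0 l = h₁ 0 + h₂ 0 := by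
        rw [← Finset.union_sdiff_self_eq_union, Finset.sum_union Finset.disjoint_sdiff]
      have hh₂W : h₂ J.castSucc ∈ Submodule.span ℝ {h | ∃ w ∈ levelSpace (hΩb J.castSucc) L,
          ∃ b, (tailTensor Ω J).tmul w b = h} := by
        refine Submodule.sum_mem _ fun l hl => Submodule.sum_mem _ fun b _ =>
          Submodule.subset_span ⟨_, ?_, _, (tailPure_castSucc Ω J _).symm⟩
        have hl0 := (Finset.mem_filter.1 (Finset.mem_sdiff.1 hl).1).2
        exact levelSpace_mono (hΩb J.castSucc) hl0 (levelPart_mem (hΩb J.castSucc) hl0 _)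
      set Z := (levelSpace (hΩb J.castSucc) L).map
        ((tailTensor Ω J).op (h₂ J.castSucc)).toLinearMap with hZ
      have hZfd : FiniteDimensional ℝ Z := Module.Finite.map _ _
      have hY : Module.finrank ℝ ↥(tailSpan hΩb S J J.succ ⊔ Z) ≤ r J := by
        refine (Submodule.finrank_add_le_finrank_add_finrank _ _).trans (le_trans ?_ hr)
        rw [add_mul, one_mul]
        exact add_le_add hfr' ((Submodule.finrank_map_le _ _).trans
          (finrank_levelSpace_le (hn _) (hΩb _) L))
      refine (T.stepError_zero_le hf J hJ (tailSpan hΩb S J J.succ ⊔ Z) hY (fun j => h₁ j + h₂ j)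
        fun a => ?_).trans ?_
      · rw [map_add, _root_.add_apply]
        refine Submodule.add_mem_sup ?_ ((tailTensor Ω J).op_mem_map _ hh₂W a)
        refine op_mem_tailSpan hΩb S J J _ ?_ a
        exact Submodule.sum_mem _ fun l hl => tensorPart_mem_tailSpan hΩb S J hS' u _ hl
      · rw [← hsum]
        exact (norm_sub_le_norm_sub_add_norm_sub _ (tensorLp u) _).trans (add_le_add le_rfl herr)
    · intro l hl hlS
      -- A discarded l violates both conditions, so the decay in the first variable and that in the
      -- later ones multiply; this gives the two summands of β_1.
      have h1 : ¬ ∑ i : {i // J.succ ≤ i}, l i ≤ L := fun h =>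
        hlS (Finset.mem_union_left _ (Finset.mem_filter.2 ⟨hl, h⟩))
      have h2 : ¬ l J.castSucc ≤ L := fun h =>
        hlS (Finset.mem_union_right _ (Finset.mem_filter.2 ⟨hl, h⟩))
      have h3 := iInf_mul_le_sum J ha (not_le.1 h1).le
      rw [← Fintype.sum_subtype_add_sum_subtype (fun i => J.succ ≤ i), rate,
        if_pos hJ, add_mul, add_comm]
      refine add_le_add h3 (le_trans ?_ (Finset.single_le_sum
        (f := fun i : {i : Fin (k + 2) // ¬ J.succ ≤ i} => s i / n i * l i)
        (fun i _ => mul_nonneg (ha i) (Nat.cast_nonneg _))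
        (Finset.mem_univ ⟨J.castSucc, not_le.2 Fin.castSucc_lt_succ⟩)))
      have h4 : (L : ℝ) ≤ l J.castSucc := by exact_mod_cast (not_le.1 h2).le
      have h5 : (0 : Fin (k + 2)) = J.castSucc := by rw [hJ, Fin.castSucc_zero]
      dsimp only
      rw [← h5] at h4 ⊢
      exact mul_le_mul_of_nonneg_left h4 (ha 0)
  · have herr := hC' L N u S (rate n s J * L) hSsub ?_
    · refine (T.stepError_le hf J (tailSpan hΩb S J) (fun j _ h hh a =>
        op_mem_tailSpan hΩb S J j h hh a) (hfr'.trans (le_trans ?_ hr))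
        (∑ l ∈ S, tensorPart hΩb L u 0 l)
        (Submodule.sum_mem _ fun l hl => tensorPart_mem_tailSpan hΩb S J hS' u 0 hl)).trans ?_
      · rw [add_mul]
        exact Nat.le_add_right _ _
      · exact (norm_sub_le_norm_sub_add_norm_sub _ (tensorLp u) _).trans (add_le_add le_rfl herr)
    · intro l hl hlS
      have h1 : ¬ ∑ i : {i // J.succ ≤ i}, l i ≤ L := fun h =>
        hlS (Finset.mem_filter.2 ⟨hl, h⟩)
      have h3 := iInf_mul_le_sum J ha (not_le.1 h1).le
      rw [← Fintype.sum_subtype_add_sum_subtype (fun i => J.succ ≤ i), rate, if_neg hJ, zero_add]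
      refine h3.trans (le_add_of_nonneg_right (Finset.sum_nonneg fun i _ => ?_))
      exact mul_nonneg (ha i) (Nat.cast_nonneg _)

end Step

/-! ### From algebraic tensors to the Hilbert tensor product -/

section Limit

variable {k : ℕ} {n : Fin (k + 2) → ℕ} {Ω : (i : Fin (k + 2)) → Set (E (n i))}
  {s : Fin (k + 2) → ℝ} {f : ((i : Fin (k + 2)) → E (n i)) → ℝ} {M : ℝ}

/-- The factors of a tensor as elements of the Sobolev spaces. -/
def TensorSum.factors (A : TensorSum n) (hA : ∀ a i, MemH (s i) (Ω i) (A.term a i))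
    (a : Fin A.size) (i : Fin (k + 2)) : sobolevSpace (s i) (Ω i) :=
  ⟨A.term a i, hA a i⟩

theorem TensorSum.tensorNormSq_factors (A : TensorSum n)
    (hA : ∀ a i, MemH (s i) (Ω i) (A.term a i)) :
    tensorNormSq (A.factors hA) = A.inner Ω s A := by
  simp only [tensorNormSq, sobolevForm_apply]
  rfl

theorem TensorSum.coeFn_tensorLp_factors (A : TensorSum n)
    (hA : ∀ a i, MemH (s i) (Ω i) (A.term a i)) :
    tensorLp (A.factors hA) =ᵐ[tailMeasure Ω 0] fun y => A.toFun fun i => y ⟨i, Fin.zero_le i⟩ := by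
  have h1 := Lp.coeFn_finsetSum (μ := tailMeasure Ω 0) (p := 2) (s := Finset.univ)
    (f := fun a => tailPure Ω 0 fun i => sobolevToLp (s i) (Ω i) (A.factors hA a i))
  have h2 : ∀ a, (tailPure Ω 0 fun i => sobolevToLp (s i) (Ω i) (A.factors hA a i))
      =ᵐ[tailMeasure Ω 0] fun y => ∏ i, A.term a i (y ⟨i, Fin.zero_le i⟩) := by
    intro a
    refine (coeFn_pureTensor_toLp (μ := fun i : {i : Fin (k + 2) // 0 ≤ i} =>
      volume.restrict (Ω i)) (u := fun i => A.term a i) fun i => (hA a i).memLp).trans ?_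
    refine ae_of_all _ fun y => ?_
    exact Fintype.prod_equiv (Equiv.subtypeUnivEquiv fun i => Fin.zero_le i) _ _ fun i => rfl
  filter_upwards [h1, ae_all_iff.2 h2] with y h3 h4
  refine h3.trans ?_
  simp only [Finset.sum_apply, h4]
  rfl

theorem TensorSum.norm_sub_tensorLp_factors (A : TensorSum n)
    (hA : ∀ a i, MemH (s i) (Ω i) (A.term a i)) (hf : MemLp f 2 (prodMeasure Ω)) :
    ‖(memLp_comp_fullEquiv_symm hf).toLp _ - tensorLp (A.factors hA)‖ =
      (eLpNorm (f - A.toFun) 2 (prodMeasure Ω)).toReal := by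
  set g := (memLp_comp_fullEquiv_symm hf).toLp _ - tensorLp (A.factors hA) with hg
  rw [Lp.norm_def]
  congr 1
  rw [← eLpNorm_comp_measurePreserving (Lp.aestronglyMeasurable g) (measurePreserving_fullEquiv Ω)]
  refine eLpNorm_congr_ae ?_
  have h1 : g =ᵐ[tailMeasure Ω 0] fun y => (f - A.toFun) fun i => y ⟨i, Fin.zero_le i⟩ := by
    filter_upwards [Lp.coeFn_sub ((memLp_comp_fullEquiv_symm hf).toLp _)
      (tensorLp (A.factors hA)), (memLp_comp_fullEquiv_symm hf).coeFn_toLp,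
      A.coeFn_tensorLp_factors hA] with y e1 e2 e3
    rw [hg, e1, Pi.sub_apply, e2, e3, Pi.sub_apply]
  exact (measurePreserving_fullEquiv Ω).quasiMeasurePreserving.ae_eq_comp h1

/-- The error of the truncation in step `J` for a function in the Hilbert tensor product. -/
theorem exists_stepError_le_mul_norm (hn : ∀ i, 0 < n i) (hΩ : ∀ i, IsOpen (Ω i))
    (hΩb : ∀ i, Bornology.IsBounded (Ω i)) (hs : ∀ i, 0 ≤ s i)
    [∀ i, IsFiniteMeasure (volume.restrict (Ω i))] :
    ∃ C ≥ 0, ∀ (f : ((i : Fin (k + 2)) → E (n i)) → ℝ) (M : ℝ), HasMixedSobolevNorm Ω s f M →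
      ∀ (r : Fin (k + 1) → ℕ) (T : TTDecomposition Ω f r) (hf : MemLp f 2 (prodMeasure Ω))
      (L : ℕ) (J : Fin (k + 1)), ((L + 2) ^ (k + 2) + 1) * (2 ^ L - 1) ≤ r J →
      T.stepError hf J ≤ C * ((L : ℝ) + 2) ^ (k + 2) * (2 : ℝ) ^ (-(rate n s J * L)) * M := by
  obtain ⟨C, hC, h⟩ := exists_stepError_le hn hΩ hΩb hs
  refine ⟨C, hC, fun f M ⟨_, A, hA, _, hlim, hM⟩ r T hf L J hr => ?_⟩
  have hlim' : Tendsto (fun ν => (eLpNorm (f - (A ν).toFun) 2 (prodMeasure Ω)).toReal) atTop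
      (𝓝 0) := by
    simpa [Function.comp_def] using (ENNReal.tendsto_toReal ENNReal.zero_ne_top).comp hlim
  have h1 := hlim'.add (hM.const_mul
    (C * ((L : ℝ) + 2) ^ (k + 2) * (2 : ℝ) ^ (-(rate n s J * L))))
  rw [zero_add] at h1
  -- The decomposition of f stays fixed while the algebraic tensors vary: their L² distance to f
  -- tends to 0 and their tensor norms tend to M.
  refine ge_of_tendsto' h1 fun ν => ?_
  have h2 := h f r T hf _ ((A ν).factors (hA ν)) L J hr
  rwa [TensorSum.tensorNormSq_factors, TensorSum.norm_sub_tensorLp_factors _ _ hf] at h2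

theorem HasMixedSobolevNorm.nonneg (h : HasMixedSobolevNorm Ω s f M) : 0 ≤ M := by
  obtain ⟨_, A, _, _, _, hM⟩ := h
  exact ge_of_tendsto' hM fun ν => Real.sqrt_nonneg _

end Limit

/-! ### The choice of the ranks -/

section Ranks

theorem half_le_of_floor_le {x : ℝ} (hx : 1 ≤ x) {r : ℕ} (hr : ⌊x⌋₊ ≤ r) : x / 2 ≤ r := by
  have h1 : (1 : ℝ) ≤ ⌊x⌋₊ := by exact_mod_cast Nat.one_le_floor_iff x |>.2 hx
  have h2 := Nat.lt_floor_add_one x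
  have h3 : (⌊x⌋₊ : ℝ) ≤ r := by exact_mod_cast hr
  linarith

theorem le_two_mul_of_le_ceil {x : ℝ} (hx : 1 ≤ x) {r : ℕ} (hr : r ≤ ⌈x⌉₊) : (r : ℝ) ≤ 2 * x := by
  have h2 := Nat.ceil_lt_add_one (zero_le_one.trans hx)
  have h3 : (r : ℝ) ≤ ⌈x⌉₊ := by exact_mod_cast hr
  linarith

theorem one_le_rpow_neg_inv {ε β : ℝ} (hε : 0 < ε) (hε1 : ε < 1) (hβ : 0 < β) :
    1 ≤ ε ^ (-1 / β) :=
  Real.one_le_rpow_of_pos_of_le_one_of_nonpos hε hε1.le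
    (div_nonpos_of_nonpos_of_nonneg (by norm_num) hβ.le)

/-- The level that a given rank allows. -/
theorem exists_level (m r : ℕ) : ∃ L : ℕ, ((L + 2) ^ m + 1) * (2 ^ L - 1) ≤ r ∧
    r < ((L + 3) ^ m + 1) * (2 ^ (L + 1) - 1) := by
  have hex : ∃ L : ℕ, r < ((L + 2) ^ m + 1) * (2 ^ L - 1) := by
    refine ⟨r + 1, ?_⟩
    have h1 : r + 1 < 2 ^ (r + 1) := Nat.lt_two_pow_self
    calc r < 1 * (2 ^ (r + 1) - 1) := by omega
      _ ≤ _ := Nat.mul_le_mul_right _ (Nat.le_add_left _ _)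
  classical
  -- At L = 0 the factor 2^L - 1 vanishes, so L = 0 is admissible for every r.
  have h0 : Nat.find hex ≠ 0 := by
    intro h
    have := Nat.find_spec hex
    rw [h] at this
    simp at this
  obtain ⟨L, hL⟩ := Nat.exists_eq_succ_of_ne_zero h0
  refine ⟨L, not_lt.1 (Nat.find_min hex (by omega)), ?_⟩
  have := Nat.find_spec hex
  rw [hL] at this
  exact this

/-- Put x = ε^{-1/β}. Since 2^L = O(x), L is of the order |log ε| at most. By the maximality of L, x
= O(L^m 2^L), so 2^{-βL} is at most ε up to (1 + |log ε|)^{mβ}; the factor (L + 2)^m adds m to this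
exponent. -/
theorem exists_level_error_le (m : ℕ) {β : ℝ} (hβ : 0 < β) :
    ∃ C ≥ 0, ∃ p : ℕ, ∀ ε : ℝ, 0 < ε → ε < 1 → ∀ r : ℕ, ⌊ε ^ (-1 / β)⌋₊ ≤ r →
      r ≤ ⌈ε ^ (-1 / β)⌉₊ → ∃ L : ℕ, ((L + 2) ^ m + 1) * (2 ^ L - 1) ≤ r ∧
        ((L : ℝ) + 2) ^ m * (2 : ℝ) ^ (-(β * L)) ≤ C * ε * (1 + |Real.log ε|) ^ p := by
  have hlog2 : 0 < Real.log 2 := Real.log_pos one_lt_two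
  -- From 2^L ≤ 4x one gets L ≤ 2 + |log ε| / (β log 2), and 3 more are needed for L + 3.
  set c := 5 + 1 / (β * Real.log 2) with hc
  have hc0 : 0 < c := by positivity
  set p := ⌈(m : ℝ) + m * β⌉₊ with hp
  refine ⟨c ^ m * (8 * c ^ m) ^ β, by positivity, p, fun ε hε hε1 r hr hr' => ?_⟩
  set x := ε ^ (-1 / β) with hx
  have hx1 : 1 ≤ x := one_le_rpow_neg_inv hε hε1 hβ
  have hx0 : 0 < x := by linarith
  have hrx := half_le_of_floor_le hx1 hr
  have hrx' := le_two_mul_of_le_ceil hx1 hr'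
  obtain ⟨L, hL, hL'⟩ := exists_level m r
  refine ⟨L, hL, ?_⟩
  set ℓ := 1 + |Real.log ε| with hℓ
  have hℓ1 : 1 ≤ ℓ := by rw [hℓ]; linarith [abs_nonneg (Real.log ε)]
  have h2L : (1 : ℝ) ≤ 2 ^ L := one_le_pow₀ one_le_two
  have hLc : (L : ℝ) + 3 ≤ c * ℓ := by
    have h1 : (2 : ℝ) ^ L ≤ 4 * x := by
      have h2 : 2 ^ L - 1 ≤ r := le_trans (Nat.le_mul_of_pos_left _ (Nat.succ_pos _)) hL
      have h3 : 2 ^ L ≤ r + 1 := by omega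
      have h4 : (2 : ℝ) ^ L ≤ r + 1 := by exact_mod_cast h3
      linarith
    have h2 := Real.log_le_log (by positivity) h1
    rw [Real.log_pow, Real.log_mul (by norm_num) hx0.ne', hx, Real.log_rpow hε,
      show (4 : ℝ) = 2 ^ 2 by norm_num, Real.log_pow] at h2
    have h3 : -1 / β * Real.log ε = |Real.log ε| / β := by
      rw [abs_of_nonpos (Real.log_nonpos hε.le hε1.le)]
      ring
    rw [h3] at h2
    have h4 : (L : ℝ) ≤ 2 + |Real.log ε| / (β * Real.log 2) := by
      rw [← sub_nonneg] at h2 ⊢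
      have : 2 + |Real.log ε| / (β * Real.log 2) - (L : ℝ) =
          ((2 : ℕ) * Real.log 2 + |Real.log ε| / β - L * Real.log 2) / Real.log 2 := by
        field_simp
        push_cast
        ring
      rw [this]
      exact div_nonneg h2 hlog2.le
    have h5 : |Real.log ε| / (β * Real.log 2) = 1 / (β * Real.log 2) * |Real.log ε| := by ring
    rw [h5] at h4
    have h6 : 0 ≤ 1 / (β * Real.log 2) := by positivity
    rw [hc, hℓ]
    nlinarith [abs_nonneg (Real.log ε)]
  have hL3 : (0 : ℝ) < (L : ℝ) + 3 := by positivity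
  have h1 : x ≤ 8 * (c * ℓ) ^ m * 2 ^ L := by
    have h2 : (r : ℝ) ≤ (((L : ℝ) + 3) ^ m + 1) * 2 ^ (L + 1) := by
      have h3 : r ≤ ((L + 3) ^ m + 1) * 2 ^ (L + 1) :=
        hL'.le.trans (Nat.mul_le_mul_left _ (Nat.sub_le _ _))
      exact_mod_cast h3
    have h3 : 1 ≤ ((L : ℝ) + 3) ^ m := one_le_pow₀ (by linarith [Nat.cast_nonneg (α := ℝ) L])
    calc x ≤ 2 * r := by linarith
      _ ≤ 2 * ((((L : ℝ) + 3) ^ m + ((L : ℝ) + 3) ^ m) * 2 ^ (L + 1)) := by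
          refine mul_le_mul_of_nonneg_left (h2.trans ?_) zero_le_two
          gcongr
      _ = 8 * ((L : ℝ) + 3) ^ m * 2 ^ L := by ring
      _ ≤ _ := by gcongr
  have h2 : (2 : ℝ) ^ (-(β * L)) ≤ (8 * (c * ℓ) ^ m) ^ β * ε := by
    have h3 := Real.rpow_le_rpow hx0.le h1 hβ.le
    have h4 : x ^ β = ε⁻¹ := by
      rw [hx, ← Real.rpow_mul hε.le, div_mul_cancel₀ _ hβ.ne', Real.rpow_neg_one]
    rw [Real.mul_rpow (by positivity) (by positivity), h4] at h3
    have h5 : (2 : ℝ) ^ (-(β * L)) = (((2 : ℝ) ^ L) ^ β)⁻¹ := by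
      rw [Real.rpow_neg zero_le_two, ← Real.rpow_natCast, ← Real.rpow_mul zero_le_two, mul_comm]
    rw [h5, inv_le_iff_one_le_mul₀ (by positivity)]
    calc (1 : ℝ) = ε⁻¹ * ε := (inv_mul_cancel₀ hε.ne').symm
      _ ≤ (8 * (c * ℓ) ^ m) ^ β * ((2 : ℝ) ^ L) ^ β * ε := by gcongr
      _ = _ := by ring
  have h3 : ℓ ^ m * (ℓ ^ m) ^ β ≤ ℓ ^ p := by
    rw [← Real.rpow_natCast ℓ m, ← Real.rpow_mul (by linarith), ← Real.rpow_add (by linarith),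
      ← Real.rpow_natCast ℓ p]
    exact Real.rpow_le_rpow_of_exponent_le hℓ1 (Nat.le_ceil _)
  calc ((L : ℝ) + 2) ^ m * (2 : ℝ) ^ (-(β * L))
      ≤ (c * ℓ) ^ m * ((8 * (c * ℓ) ^ m) ^ β * ε) := by
        gcongr
        linarith
    _ = c ^ m * (8 * c ^ m) ^ β * ε * (ℓ ^ m * (ℓ ^ m) ^ β) := by
        rw [mul_pow, ← mul_assoc 8, Real.mul_rpow (by positivity) (by positivity)]
        ring
    _ ≤ _ := by gcongr

end Ranks

/-! ### Positivity of the rates and the storage cost -/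

section Rate

variable {k : ℕ} {n : Fin (k + 2) → ℕ} {s : Fin (k + 2) → ℝ}

theorem rate_pos (hn : ∀ i, 0 < n i) (hs : ∀ i, 0 < s i) (j : Fin (k + 1)) : 0 < rate n s j := by
  have ha : ∀ i, 0 < s i / n i := fun i => div_pos (hs i) (Nat.cast_pos.2 (hn i))
  have : Nonempty {i : Fin (k + 2) // j.castSucc < i} := ⟨⟨j.succ, Fin.castSucc_lt_succ⟩⟩
  obtain ⟨i, hi⟩ := exists_eq_ciInf_of_finite
    (f := fun i : {i : Fin (k + 2) // j.castSucc < i} => s i / n i)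
  refine add_pos_of_nonneg_of_pos ?_ ?_
  · split_ifs
    · exact (ha 0).le
    · exact le_rfl
  · rw [← hi]
    exact ha i

/-- Rounding a number x ≥ 1 changes it by a factor between 1/2 and 2, hence a product of two by a
factor between 1/4 and 4. The last bound estimates each of the k + 1 summands by ε^{-2 / min β_j}.
-/
theorem storageCost_bounds (hn : ∀ i, 0 < n i) (hs : ∀ i, 0 < s i) {ε : ℝ} (hε : 0 < ε)
    (hε1 : ε < 1) {r : Fin (k + 1) → ℕ} (hr : IsRankChoice n s ε r) :
    (1 / 4 : ℝ) * (ε ^ (-1 / rate n s 0) + ∑ j : Fin k,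
        ε ^ (-1 / rate n s j.castSucc - 1 / rate n s j.succ)) ≤ storageCost r ∧
    (storageCost r : ℝ) ≤ 4 * (ε ^ (-1 / rate n s 0) + ∑ j : Fin k,
        ε ^ (-1 / rate n s j.castSucc - 1 / rate n s j.succ)) ∧
    (storageCost r : ℝ) ≤ 4 * ((k + 2 : ℕ) : ℝ) * ε ^ (-2 / ⨅ j, rate n s j) := by
  set x := fun j => ε ^ (-1 / rate n s j) with hx
  have hx1 : ∀ j, 1 ≤ x j := fun j => one_le_rpow_neg_inv hε hε1 (rate_pos hn hs j)
  have hlow : ∀ j, x j / 2 ≤ r j := fun j => half_le_of_floor_le (hx1 j) (hr j).1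
  have hupp : ∀ j, (r j : ℝ) ≤ 2 * x j := fun j => le_two_mul_of_le_ceil (hx1 j) (hr j).2
  have hmul : ∀ j : Fin k, ε ^ (-1 / rate n s j.castSucc - 1 / rate n s j.succ) =
      x j.castSucc * x j.succ := by
    intro j
    rw [hx, ← Real.rpow_add hε]
    congr 1
    ring
  have hcost : (storageCost r : ℝ) = r 0 + ∑ j : Fin k, (r j.castSucc : ℝ) * r j.succ := by
    simp [storageCost]
  have h0 : ∀ j, 0 ≤ x j := fun j => zero_le_one.trans (hx1 j)
  have hub : (storageCost r : ℝ) ≤ 4 * (x 0 + ∑ j : Fin k, x j.castSucc * x j.succ) := by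
    rw [hcost, mul_add, Finset.mul_sum]
    refine add_le_add ?_ (Finset.sum_le_sum fun j _ => ?_)
    · linarith [hupp 0, h0 0]
    · calc _ ≤ (2 * x j.castSucc) * (2 * x j.succ) :=
            mul_le_mul (hupp _) (hupp _) (Nat.cast_nonneg _) (mul_nonneg zero_le_two (h0 _))
        _ = _ := by ring
  simp only [hmul]
  refine ⟨?_, hub, hub.trans ?_⟩
  · rw [hcost, mul_add, Finset.mul_sum]
    refine add_le_add ?_ (Finset.sum_le_sum fun j _ => ?_)
    · have := hlow 0
      have := h0 0
      change 1 / 4 * x 0 ≤ _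
      linarith
    · calc _ = (x j.castSucc / 2) * (x j.succ / 2) := by ring
        _ ≤ _ := mul_le_mul (hlow _) (hlow _) (by linarith [h0 j.succ]) (Nat.cast_nonneg _)
  · set b := ⨅ j, rate n s j with hb
    have hb0 : 0 < b := by
      obtain ⟨j, hj⟩ := exists_eq_ciInf_of_finite (f := rate n s)
      rw [hb, ← hj]
      exact rate_pos hn hs j
    set y := ε ^ (-1 / b) with hy
    have hy1 : 1 ≤ y := one_le_rpow_neg_inv hε hε1 hb0
    have hxy : ∀ j, x j ≤ y := by
      intro j
      refine Real.rpow_le_rpow_of_exponent_ge hε hε1.le ?_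
      rw [neg_div, neg_div, neg_le_neg_iff]
      exact one_div_le_one_div_of_le hb0 (ciInf_le (Set.finite_range _).bddBelow j)
    have hyy : ε ^ (-2 / b) = y * y := by
      rw [hy, ← Real.rpow_add hε]
      congr 1
      ring
    rw [hyy, mul_assoc]
    refine mul_le_mul_of_nonneg_left ?_ (by norm_num)
    calc _ ≤ y * y + ∑ _j : Fin k, y * y := by
          refine add_le_add ?_ (Finset.sum_le_sum fun j _ => ?_)
          · nlinarith [hxy 0]
          · exact mul_le_mul (hxy _) (hxy _) (h0 _) (by linarith)
      _ = ((k : ℝ) + 1) * (y * y) := by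
          rw [Finset.sum_const, Finset.card_univ, Fintype.card_fin, nsmul_eq_mul]
          ring
      _ ≤ _ := by
          refine mul_le_mul_of_nonneg_right ?_ (by nlinarith)
          push_cast
          linarith

end Rate

end TTApprox

end

/-- There are `m = k + 2 ≥ 2` bounded open sets `Ω_i ⊆ ℝ^{n_i}`. -/
theorem mainTheorem3 (k : ℕ) (n : Fin (k + 2) → ℕ) (hn : ∀ i, 0 < n i)
    (Ω : (i : Fin (k + 2)) → Set (TTApprox.E (n i)))
    (hΩ : ∀ i, IsOpen (Ω i)) (hΩb : ∀ i, Bornology.IsBounded (Ω i)) (hΩn : ∀ i, (Ω i).Nonempty)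
    (s : Fin (k + 2) → ℝ) (hs : ∀ i, 0 < s i) :
    -- the truncation error; the constants depend neither on `f` nor on `ε`
    (∃ (C : ℝ) (p : ℕ), ∀ (f : ((i : Fin (k + 2)) → TTApprox.E (n i)) → ℝ) (M : ℝ),
      TTApprox.HasMixedSobolevNorm Ω s f M →
      ∀ (ε : ℝ), 0 < ε → ε < 1 → ∀ r : Fin (k + 1) → ℕ, TTApprox.IsRankChoice n s ε r →
        Nonempty (TTApprox.TTDecomposition Ω f r) ∧
        ∀ T : TTApprox.TTDecomposition Ω f r,
          eLpNorm (f - T.approx) 2 (TTApprox.prodMeasure Ω) ≤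
            ENNReal.ofReal (C * √((k + 2 : ℕ) : ℝ) * ε * (1 + |Real.log ε|) ^ p * M)) ∧
    -- the storage cost
    (∀ (ε : ℝ), 0 < ε → ε < 1 → ∀ r : Fin (k + 1) → ℕ, TTApprox.IsRankChoice n s ε r →
      (1 / 4 : ℝ) * (ε ^ (-1 / TTApprox.rate n s 0) + ∑ j : Fin k,
          ε ^ (-1 / TTApprox.rate n s j.castSucc - 1 / TTApprox.rate n s j.succ)) ≤
        TTApprox.storageCost r ∧
      (TTApprox.storageCost r : ℝ) ≤
        4 * (ε ^ (-1 / TTApprox.rate n s 0) + ∑ j : Fin k,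
          ε ^ (-1 / TTApprox.rate n s j.castSucc - 1 / TTApprox.rate n s j.succ)) ∧
      (TTApprox.storageCost r : ℝ) ≤
        4 * ((k + 2 : ℕ) : ℝ) * ε ^ (-2 / ⨅ j, TTApprox.rate n s j)) := by
  refine ⟨?_, fun ε hε hε1 r hr => TTApprox.storageCost_bounds hn hs hε hε1 hr⟩
  have hfin : ∀ i, IsFiniteMeasure (volume.restrict (Ω i)) := fun i =>
    ⟨by rw [Measure.restrict_apply_univ]; exact (hΩb i).measure_lt_top⟩
  obtain ⟨C, hC, hstep⟩ := TTApprox.exists_stepError_le_mul_norm hn hΩ hΩb fun i => (hs i).le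
  choose c hc p hlevel using fun j =>
    TTApprox.exists_level_error_le (k + 2) (TTApprox.rate_pos hn hs j)
  -- There are k + 1 truncations; summing the constants and exponents over j makes the bounds
  -- uniform in j.
  refine ⟨(k + 1 : ℕ) * (C * ∑ j, c j), ∑ j, p j, fun f M hM ε hε hε1 r hr => ⟨?_, fun T => ?_⟩⟩
  · refine TTApprox.nonempty_ttDecomposition (fun j => ?_) hM.1 fun i =>
      TTApprox.not_finiteDimensional_lp_restrict (hn i) (hΩ i) (hΩn i)
    refine lt_of_lt_of_le ?_ (hr j).1
    rw [Nat.floor_pos]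
    exact TTApprox.one_le_rpow_neg_inv hε hε1 (TTApprox.rate_pos hn hs j)
  · have hM0 := hM.nonneg
    set ℓ := 1 + |Real.log ε| with hℓ
    have hℓ1 : 1 ≤ ℓ := by rw [hℓ]; linarith [abs_nonneg (Real.log ε)]
    have hδ : ∀ j, T.stepError hM.1 j ≤ C * ((∑ j, c j) * ε * ℓ ^ (∑ j, p j)) * M := by
      intro j
      obtain ⟨L, hL, hL'⟩ := hlevel j ε hε hε1 (r j) (hr j).1 (hr j).2
      refine (hstep f M hM r T hM.1 L j hL).trans (mul_le_mul_of_nonneg_right ?_ hM0)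
      rw [mul_assoc]
      refine mul_le_mul_of_nonneg_left (hL'.trans ?_) hC
      have h1 : c j ≤ ∑ j, c j :=
        Finset.single_le_sum (f := c) (fun i _ => hc i) (Finset.mem_univ j)
      have h2 : p j ≤ ∑ j, p j :=
        Finset.single_le_sum (f := p) (fun i _ => Nat.zero_le _) (Finset.mem_univ j)
      have h3 : 0 ≤ ∑ j, c j := Finset.sum_nonneg fun i _ => hc i
      gcongr
    refine (T.eLpNorm_sub_approx_le hM.1 hδ).trans (ENNReal.ofReal_le_ofReal ?_)
    have h3 : 0 ≤ ∑ j, c j := Finset.sum_nonneg fun i _ => hc i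
    -- The factor √m is at least 1 and may simply be inserted, since C may depend on m.
    have h4 : 1 ≤ √((k + 2 : ℕ) : ℝ) := by
      rw [Real.one_le_sqrt]
      exact_mod_cast Nat.le_add_left 1 (k + 1)
    have h5 : 0 ≤ ((k + 1 : ℕ) : ℝ) * (C * ∑ j, c j) * ε * ℓ ^ (∑ j, p j) * M := by positivity
    calc _ = ((k + 1 : ℕ) : ℝ) * (C * ∑ j, c j) * ε * ℓ ^ (∑ j, p j) * M * 1 := by ring
      _ ≤ ((k + 1 : ℕ) : ℝ) * (C * ∑ j, c j) * ε * ℓ ^ (∑ j, p j) * M * √((k + 2 : ℕ) : ℝ) :=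
          mul_le_mul_of_nonneg_left h4 h5
      _ = _ := by ring
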